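/- **Theorem 5.1 (Banica, Nechita).** Fix an integer $m=m_0\ge 1$ and a real number $b>0$. Let $l=l_n$ be a sequence of non-negative integers with $l_n/n\to b$ as $n\to\infty$. For each $n\ge1$ with $l_n\ge 1$ let $|v_n\rangle$ be a uniformly distributed random unit vector in $\mathbb{C}^{l}\otimes\mathbb{C}^{m}\otimes\mathbb{C}^{n}$, all these vectors being defined on one probability space (with an arbitrary joint distribution). Let $\rho=\operatorname{Tr}_{\mathbb{C}^l}|v_n\rangle\langle v_n|$ be the induced random mixed state on $\mathbb{C}^m\otimes\mathbb{C}^n$, and let $\rho^\Gamma$ be its partial transpose, the transpose acting on $\mathbb{C}^n$ only: $(\rho^\Gamma)_{xy,x'y'}=\rho_{xy',x'y}$. Let $$\mu_{ml\rho^\Gamma}=\frac1{mn}\sum_{i=1}^{mn}\delta_{\lambda_i}$$ be the empirical eigenvalue distribution of $ml\rho^\Gamma$, where $\lambda_1,\dots,\lambda_{mn}$ are its eigenvalues counted with multiplicity. For $\lambda\ge 0$ let $\nu_\lambda$ be the free Poisson distribution with rate $\lambda$ and jump size $1$, $$\nu_\lambda=\max(1-\lambda,0)\,\delta_0+\frac{\sqrt{4\lambda-(t-1-\lambda)^2}}{2\pi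 t}\,\mathbf 1_{[(1-\sqrt\lambda)^2,(1+\sqrt\lambda)^2]}(t)\,dt .$$ Then there is a compactly supported probability measure $\mu$ on $\mathbb{R}$, depending only on $b$ and $m_0$, such that: 1. $\mu$ is the free difference of $\nu_{b(m_0+1)/2}$ and $\nu_{b(m_0-1)/2}$: it is the distribution of $X-Y$ for free self-adjoint elements $X,Y$ of a unital $C^*$-algebra with a state, where $X$ has distribution $\nu_{b(m_0+1)/2}$ and $Y$ has distribution $\nu_{b(m_0-1)/2}$; 2. the free cumulants of $\mu$ are $k_r=bm_0$ for even $r\ge 1$ and $k_r=b$ for odd $r\ge 1$, that is, $\int t^p\,d\mu(t)=\sum_{\tau\in NC(p)}\prod_{B\in\tau}k_{|B|}$ for all $p\ge1$, where $NC(p)$ is the set of noncrossing partitions of $\{1,\dots,p\}$; 3. almost surely, $\mu_{ml\rho^\Gamma}$ converges weakly to $\mu$ as $n\to\infty$. -/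

import Mathlib

open MeasureTheory ProbabilityTheory Filter Topology
open scoped ComplexOrder ComplexConjugate

noncomputable section

namespace RandomState

/-! ### Random mixed states and their partial transpose -/

/-- The partial trace of a matrix on `ℂ^E ⊗ ℂ^S` over the first factor (the environment). -/
def partialTrace {E S : Type*} [Fintype E] (M : Matrix (E × S) (E × S) ℂ) : Matrix S S ℂ :=
  Matrix.of fun p q => ∑ z, M (z, p) (z, q)

/-- The mixed state `Tr_E |v⟩⟨v|` induced by a vector `v` of `ℂ^E ⊗ ℂ^S`. -/
def reducedState {E S : Type*} [Fintype E] (v : EuclideanSpace ℂ (E × S)) : Matrix S S ℂ :=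
  partialTrace (Matrix.vecMulVec (fun i => v i) (fun i => conj (v i)))

/-- The partial transpose of a matrix on `ℂ^X ⊗ ℂ^Y`: transpose on the second factor only. -/
def partialTranspose {X Y : Type*} (M : Matrix (X × Y) (X × Y) ℂ) : Matrix (X × Y) (X × Y) ℂ :=
  Matrix.of fun p q => M (p.1, q.2) (q.1, p.2)

/-- Real multiples of the partially transposed state are Hermitian. -/
theorem isHermitian_smul_partialTranspose {E X Y : Type*} [Fintype E] (c : ℝ)
    (v : EuclideanSpace ℂ (E × X × Y)) :
    (c • partialTranspose (reducedState v)).IsHermitian := by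
  ext p q
  simp [partialTranspose, reducedState, partialTrace, Matrix.vecMulVec_apply, mul_comm]

/-- The law of a uniformly random unit vector of `ℂ^ι`: the normalized surface measure of the unit
sphere, seen as a measure on the whole space. It is a probability measure as soon as `ι` is
nonempty (and is the zero measure when `ι` is empty, where there is no unit vector). -/
def uniformUnitVector (ι : Type*) [Fintype ι] : Measure (EuclideanSpace ℂ ι) :=
  Measure.map Subtype.val
    (((volume : Measure (EuclideanSpace ℂ ι)).toSphere Set.univ)⁻¹ •
      (volume : Measure (EuclideanSpace ℂ ι)).toSphere)

/-- The empirical eigenvalue distribution `(1/N) ∑ᵢ δ_{λᵢ}` of a Hermitian `N × N` matrix, where the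
eigenvalues `λᵢ` are listed with multiplicity. It is a probability measure as soon as `N > 0`
(and is the zero measure when `N = 0`). -/
def empiricalDistribution {ι : Type*} [Fintype ι] [DecidableEq ι] {A : Matrix ι ι ℂ}
    (hA : A.IsHermitian) : FiniteMeasure ℝ :=
  (Fintype.card ι : NNReal)⁻¹ • ∑ i, (diracProba (hA.eigenvalues i)).toFiniteMeasure

/-! ### Free Poisson distributions, free differences and free cumulants -/

/-- The free Poisson distribution with rate `r ≥ 0` and jump size `1`: an atom of mass `1 - r` at `0`
if `r < 1`, plus the density `√(4 r - (t - (1 + r))²) / (2 π t)` on the interval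
`[(1 - √r)², (1 + √r)²]` (off this interval the square root is `0` by convention). -/
def freePoisson (r : ℝ) : Measure ℝ :=
  ENNReal.ofReal (1 - r) • Measure.dirac 0 +
    (volume : Measure ℝ).withDensity fun t =>
      ENNReal.ofReal (√(4 * r - (t - (1 + r)) ^ 2) / (2 * Real.pi * t))

/-- A state on a unital C*-algebra: a positive unital linear functional. -/
def IsState {A : Type*} [CStarAlgebra A] (φ : A →ₗ[ℂ] ℂ) : Prop :=
  φ 1 = 1 ∧ ∀ a, 0 ≤ φ (star a * a)

/-- Unital subalgebras `B i` are free with respect to `φ` if `φ` vanishes on every nonempty product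
`a₁ ⋯ aₙ` of centered elements in which neighbouring factors come from different subalgebras. -/
def AreFree {A : Type*} [CStarAlgebra A] {ι : Type*} (φ : A →ₗ[ℂ] ℂ) (B : ι → Subalgebra ℂ A) :
    Prop :=
  ∀ w : List (ι × A), w ≠ [] → w.IsChain (fun x y => x.1 ≠ y.1) →
    (∀ x ∈ w, x.2 ∈ B x.1 ∧ φ x.2 = 0) → φ (w.map Prod.snd).prod = 0

/-- The self-adjoint elements `X` and `Y` are free: the unital subalgebras they generate are. -/
def FreePair {A : Type*} [CStarAlgebra A] (φ : A →ₗ[ℂ] ℂ) (X Y : A) : Prop :=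
  AreFree φ fun i : Bool => Algebra.adjoin ℂ {cond i X Y}

/-- The distribution of the self-adjoint element `X` in the state `φ` is `μ`: the compactly
supported probability measure whose moments are those of `X`. -/
def HasDistribution {A : Type*} [CStarAlgebra A] (φ : A →ₗ[ℂ] ℂ) (X : A) (μ : Measure ℝ) : Prop :=
  IsProbabilityMeasure μ ∧ (∃ K : Set ℝ, IsCompact K ∧ μ Kᶜ = 0) ∧
    ∀ k : ℕ, φ (X ^ k) = ((∫ t, t ^ k ∂μ : ℝ) : ℂ)

/-- `μ` is the free difference of `μ₁` and `μ₂`: the distribution of `X - Y`, where `X` and `Y` are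
free self-adjoint noncommutative random variables with distributions `μ₁` and `μ₂`. -/
def IsFreeDifference (μ₁ μ₂ μ : Measure ℝ) : Prop :=
  ∃ (A : Type) (_ : CStarAlgebra A) (φ : A →ₗ[ℂ] ℂ) (X Y : A),
    IsState φ ∧ IsSelfAdjoint X ∧ IsSelfAdjoint Y ∧ FreePair φ X Y ∧
      HasDistribution φ X μ₁ ∧ HasDistribution φ Y μ₂ ∧ HasDistribution φ (X - Y) μ

/-- A partition of `{0, …, p - 1}` is noncrossing if `a < b < c < d` with `a, c` in one block and
`b, d` in one block is only possible when all four are in the same block. -/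
def IsNoncrossing {p : ℕ} (τ : Finpartition (Finset.univ : Finset (Fin p))) : Prop :=
  ∀ B ∈ τ.parts, ∀ C ∈ τ.parts, ∀ a ∈ B, ∀ b ∈ C, ∀ c ∈ B, ∀ d ∈ C,
    a < b → b < c → c < d → B = C

instance {p : ℕ} : DecidablePred (IsNoncrossing (p := p)) := fun τ => by
  unfold IsNoncrossing; infer_instance

/-- `k 1, k 2, …` are the free cumulants of `μ`: all moments of `μ` are finite and they satisfy the
moment-cumulant formula `m_p = ∑_{τ ∈ NC(p)} ∏_{B ∈ τ} k_{|B|}` (which determines them). -/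
def HasFreeCumulants (μ : Measure ℝ) (k : ℕ → ℝ) : Prop :=
  (∀ p : ℕ, Integrable (fun t : ℝ => t ^ p) μ) ∧
    ∀ p : ℕ, 1 ≤ p → ∫ t, t ^ p ∂μ =
      ∑ τ : Finpartition (Finset.univ : Finset (Fin p)) with IsNoncrossing τ,
        ∏ B ∈ τ.parts, k B.card

end RandomState

end

/-! The proof is the method of moments, fed by a genus expansion over permutations.

The p-th moment of the empirical distribution is a normalized trace, hence a polynomial in the
coordinates of v contracted along the full cycle γ of p points (`permInvariant`). Moments of a
uniform unit vector come from Wick's formula for Gaussian vectors, the radial part being integrated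
out (`integral_uniformUnitVector`). Up to a factor 1 + O(1/(lmn)), the expected moment is a
normalized sum over permutations α of l^#(α) m^#(γα) n^#(α⁻¹γ), where # counts orbits. With |α| = p
- #(α) one has |α| + |α⁻¹γ| = |γ| + 2g for an integer genus g ≥ 0, and the term of α becomes
(l/n)^#(α) m^(#(γα) - 1) n^(-2g) (`sum_pow_orbitCount_eq`). As m is fixed, only g = 0 survives: the
geodesics from 1 to γ.

The squared moment is the same kind of polynomial for two disjoint copies of γ. Its geodesics are
pairs of geodesics, so leading terms cancel and the mean square distance to the genus 0 part is
O(1/n²). This is summable, which gives almost sure convergence whatever the joint distribution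
(`ae_tendsto_zero_of_integral_sq_isBigO`).

The limit has three descriptions: a sum over geodesics, a sum over noncrossing partitions weighted
by the parity of the blocks, and the moments of X - Y. Instead of matching them by bijections, each
is shown to obey `MomentRecursion`, which determines its solution (`cycleSum_eq`, `ncSum_eq`,
`momentRecursion_diffMoment`). In terms of partitions, P p and Q p are sums over p + 1 points in
which the block of the first point has already absorbed an even, respectively odd, number of extra
points; the recursion asks which point follows the first one in its block.

The measure μ is built on the full Fock space: X = V V* with V a creation operator plus a scalar r,
where r² is the rate, and Y likewise with the other letter. Freeness follows from commutation with
concatenation on the right, and the law of X from the Jacobi matrix of V* V, diagonalized by sines.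
The Riesz theorem turns the vacuum moments of X - Y into a compactly supported measure
(`exists_isFreeDifference_freePoisson`), and compact support lets convergence of moments imply weak
convergence. -/

set_option linter.unusedSectionVars false

/-! ### Length and orbits of permutations -/

section PermLength

open Equiv Equiv.Perm

variable {I : Type*} [Fintype I] [DecidableEq I]

/-- The number of orbits of a permutation. -/
noncomputable def orbitCount (σ : Perm I) : ℕ := Nat.card (Quotient (SameCycle.setoid σ))

/-- The least number of transpositions whose product is `σ`. -/
def permLength (σ : Perm I) : ℕ := σ.cycleType.sum - Multiset.card σ.cycleType

theorem card_cycleType_le_sum (σ : Perm I) : Multiset.card σ.cycleType ≤ σ.cycleType.sum := by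
  have := Multiset.card_nsmul_le_sum (s := σ.cycleType) (a := 1)
    fun x hx => (one_lt_of_mem_cycleType hx).le
  simpa using this

/-- An orbit is a fixed point or the support of exactly one nontrivial cycle factor, and the cycle
type lists the sizes of the latter. -/
theorem orbitCount_add_permLength (σ : Perm I) : orbitCount σ + permLength σ = Fintype.card I := by
  have key : orbitCount σ = Fintype.card (Function.fixedPoints σ) + σ.cycleFactorsFinset.card := by
    rw [orbitCount, ← Fintype.card_coe σ.cycleFactorsFinset, ← Fintype.card_sum,
      ← Nat.card_eq_fintype_card]
    refine Nat.card_congr (Equiv.ofBijective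
      (Quotient.lift (s := SameCycle.setoid σ) (fun x => if h : σ x = x then
        (Sum.inl ⟨x, h⟩ : Function.fixedPoints σ ⊕ σ.cycleFactorsFinset) else
        Sum.inr ⟨σ.cycleOf x, cycleOf_mem_cycleFactorsFinset_iff.2 (mem_support.2 h)⟩) ?_) ⟨?_, ?_⟩)
    · intro x y (hxy : SameCycle σ x y)
      by_cases h : σ x = x
      · have : x = y := hxy.eq_of_left h
        subst this; rfl
      · have h' : σ y ≠ y := fun h' => h (by
          have : x = y := hxy.eq_of_right h'
          rw [this]; exact h')
        simp only [h, h', dite_false, Sum.inr.injEq, Subtype.mk.injEq]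
        exact hxy.cycleOf_eq
    · intro a b
      induction a using Quotient.inductionOn with | _ x =>
      induction b using Quotient.inductionOn with | _ y =>
      intro hxy
      apply Quotient.sound
      change SameCycle σ x y
      simp only [Quotient.lift_mk] at hxy
      split_ifs at hxy with h1 h2 h2
      · have : x = y := congrArg Subtype.val (Sum.inl.inj hxy)
        subst this; rfl
      · simp only [Sum.inr.injEq, Subtype.mk.injEq] at hxy
        exact (sameCycle_iff_cycleOf_eq_of_mem_support (mem_support.2 h1) (mem_support.2 h2)).2 hxy
    · rintro (⟨x, hx⟩ | ⟨c, hc⟩)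
      · refine ⟨Quotient.mk (SameCycle.setoid σ) x, ?_⟩
        have hx' : σ x = x := hx
        simp [Quotient.lift_mk, hx']
      · obtain ⟨hc1, hc2⟩ := mem_cycleFactorsFinset_iff.1 hc
        obtain ⟨x, hx⟩ := hc1.nonempty_support
        refine ⟨Quotient.mk (SameCycle.setoid σ) x, ?_⟩
        have hx' : σ x ≠ x := by
          rw [← hc2 x hx]; exact mem_support.1 hx
        simp only [Quotient.lift_mk, hx', dite_false, Sum.inr.injEq, Subtype.mk.injEq]
        exact (cycle_is_cycleOf hx hc).symm
  have h1 : Multiset.card σ.cycleType = σ.cycleFactorsFinset.card := by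
    simp [cycleType_def]
  rw [key, card_fixedPoints, permLength, ← h1]
  have := card_cycleType_le_sum σ
  have := sum_cycleType_le σ
  omega

theorem neg_one_pow_permLength (σ : Perm I) : (-1 : ℤˣ) ^ permLength σ = sign σ := by
  have h := card_cycleType_le_sum σ
  have : σ.cycleType.sum + Multiset.card σ.cycleType
      = permLength σ + 2 * Multiset.card σ.cycleType := by
    unfold permLength; omega
  rw [sign_of_cycleType, this, pow_add, pow_mul]
  simp

theorem permLength_one : permLength (1 : Perm I) = 0 := by simp [permLength]

theorem permLength_inv (σ : Perm I) : permLength σ⁻¹ = permLength σ := by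
  simp [permLength, cycleType_inv]

theorem permLength_conj (σ τ : Perm I) : permLength (τ * σ * τ⁻¹) = permLength σ := by
  simp [permLength, cycleType_conj]

theorem permLength_mul_comm (σ τ : Perm I) : permLength (σ * τ) = permLength (τ * σ) := by
  rw [← permLength_conj (σ * τ) τ]; congr 1; group

theorem permLength_eq_zero {σ : Perm I} (h : permLength σ = 0) : σ = 1 := by
  by_contra hne
  have h1 : 0 < Multiset.card σ.cycleType := card_cycleType_pos.2 hne
  have := Multiset.card_nsmul_le_sum (s := σ.cycleType) (a := 2)
    fun x hx => two_le_of_mem_cycleType hx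
  simp only [smul_eq_mul] at this
  unfold permLength at h
  omega

theorem permLength_swap {a b : I} (h : a ≠ b) : permLength (swap a b) = 1 := by
  have : (swap a b).cycleType = {2} := isSwap_iff_cycleType.1 ⟨a, b, h, rfl⟩
  simp [permLength, this]

theorem permLength_mul_of_disjoint {σ τ : Perm I} (h : Disjoint σ τ) :
    permLength (σ * τ) = permLength σ + permLength τ := by
  have h1 := card_cycleType_le_sum σ
  have h2 := card_cycleType_le_sum τ
  simp only [permLength, h.cycleType_mul, Multiset.sum_add, Multiset.card_add]
  omega

/-- Functions invariant under a permutation are functions on its orbits. -/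
def invariantEquiv (σ : Perm I) (F : Type*) :
    {f : I → F // ∀ i, f (σ i) = f i} ≃ (Quotient (SameCycle.setoid σ) → F) where
  toFun f := Quotient.lift f.1 (by
    rintro x y ⟨k, rfl⟩
    have hn : ∀ (n : ℕ) (x), f.1 ((σ ^ n) x) = f.1 x := by
      intro n
      induction n with
      | zero => simp
      | succ n ih => intro x; rw [pow_succ', Perm.mul_apply, f.2, ih]
    cases k with
    | ofNat n => exact (hn n x).symm
    | negSucc n =>
      have := hn (n + 1) ((σ ^ Int.negSucc n) x)
      rw [← this, zpow_negSucc, ← Perm.mul_apply, mul_inv_cancel, Perm.one_apply])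
  invFun g := ⟨fun i => g (Quotient.mk _ i), fun i => by
    refine congrArg g (Quotient.sound ?_)
    change SameCycle σ (σ i) i
    exact (sameCycle_apply_left).2 (SameCycle.refl _ _)⟩
  left_inv f := rfl
  right_inv g := by
    funext q
    induction q using Quotient.inductionOn
    rfl

theorem card_invariant (σ : Perm I) (F : Type*) [Fintype F] :
    Nat.card {f : I → F // ∀ i, f (σ i) = f i} = Fintype.card F ^ orbitCount σ := by
  have : Finite (Quotient (SameCycle.setoid σ)) := inferInstance
  rw [Nat.card_congr (invariantEquiv σ F), Nat.card_fun, orbitCount, Nat.card_eq_fintype_card]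

/-- The space of functions invariant under a permutation. -/
def fixedSpace (σ : Perm I) : Submodule ℚ (I → ℚ) where
  carrier := {f | ∀ i, f (σ i) = f i}
  add_mem' hf hg i := by simp [hf i, hg i]
  zero_mem' i := rfl
  smul_mem' c f hf i := by simp [hf i]

theorem mem_fixedSpace {σ : Perm I} {f : I → ℚ} : f ∈ fixedSpace σ ↔ ∀ i, f (σ i) = f i := Iff.rfl

theorem finrank_fixedSpace (σ : Perm I) : Module.finrank ℚ (fixedSpace σ) = orbitCount σ := by
  have : Finite (Quotient (SameCycle.setoid σ)) := inferInstance
  have : Fintype (Quotient (SameCycle.setoid σ)) := Fintype.ofFinite _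
  let e : fixedSpace σ ≃ₗ[ℚ] (Quotient (SameCycle.setoid σ) → ℚ) :=
    { (invariantEquiv σ ℚ) with
      map_add' := fun f g => by
        funext q
        induction q using Quotient.inductionOn
        rfl
      map_smul' := fun c f => by
        funext q
        induction q using Quotient.inductionOn
        rfl }
  rw [e.finrank_eq, Module.finrank_fintype_fun_eq_card, orbitCount, Nat.card_eq_fintype_card]

theorem fixedSpace_inf_le (σ τ : Perm I) : fixedSpace σ ⊓ fixedSpace τ ≤ fixedSpace (σ * τ) := by
  intro f hf i
  rw [Perm.mul_apply, hf.1, hf.2]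

/-- The fixed space of σ has codimension |σ|, so this is the dimension formula for a sum of two
subspaces. The triangle inequality and its equality case both follow from it. -/
theorem finrank_fixedSpace_inf (σ τ : Perm I) :
    Fintype.card I ≤ Module.finrank ℚ (fixedSpace σ ⊓ fixedSpace τ : Submodule ℚ (I → ℚ))
      + permLength σ + permLength τ := by
  have h1 := Submodule.finrank_sup_add_finrank_inf_eq (fixedSpace σ) (fixedSpace τ)
  have h2 : Module.finrank ℚ (fixedSpace σ ⊔ fixedSpace τ : Submodule ℚ (I → ℚ))
      ≤ Fintype.card I := by
    simpa using Submodule.finrank_le (fixedSpace σ ⊔ fixedSpace τ : Submodule ℚ (I → ℚ))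
  rw [finrank_fixedSpace, finrank_fixedSpace] at h1
  have := orbitCount_add_permLength σ
  have := orbitCount_add_permLength τ
  omega

theorem permLength_mul_le (σ τ : Perm I) :
    permLength (σ * τ) ≤ permLength σ + permLength τ := by
  have h1 := finrank_fixedSpace_inf σ τ
  have h2 := Submodule.finrank_mono (fixedSpace_inf_le σ τ)
  rw [finrank_fixedSpace] at h2
  have := orbitCount_add_permLength (σ * τ)
  omega

/-- If `σ` lies on a geodesic from `1` to `σ * τ`, functions invariant under `σ * τ` are
invariant under `σ`. -/
theorem fixedSpace_mul_le (σ τ : Perm I)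
    (h : permLength (σ * τ) = permLength σ + permLength τ) :
    fixedSpace (σ * τ) ≤ fixedSpace σ := by
  have h1 := finrank_fixedSpace_inf σ τ
  have h3 := orbitCount_add_permLength (σ * τ)
  have : fixedSpace σ ⊓ fixedSpace τ = fixedSpace (σ * τ) := by
    apply Submodule.eq_of_le_of_finrank_le (fixedSpace_inf_le σ τ)
    rw [finrank_fixedSpace]
    omega
  rw [← this]
  exact inf_le_left

/-- The sign is multiplicative. Hence the defect in the triangle inequality is even, which makes the
genus an integer. -/
theorem permLength_parity (σ τ : Perm I) :
    (permLength (σ * τ) + permLength σ + permLength τ) % 2 = 0 := by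
  have h : (-1 : ℤˣ) ^ (permLength (σ * τ) + permLength σ + permLength τ) = 1 := by
    rw [pow_add, pow_add, neg_one_pow_permLength, neg_one_pow_permLength, neg_one_pow_permLength,
      Perm.sign_mul, mul_assoc, Int.units_mul_self]
  rcases Nat.even_or_odd (permLength (σ * τ) + permLength σ + permLength τ) with h' | h'
  · exact Nat.even_iff.1 h'
  · rw [h'.neg_one_pow] at h
    exact absurd h (by decide)

/-- The triangle inequality and parity leave only a change by one. If the length dropped, the
transposition would lie on a geodesic to σ and f would be invariant under it, against f a ≠ f b. -/
theorem permLength_swap_mul {a b : I} {σ : Perm I} (f : I → ℚ) (hf : ∀ i, f (σ i) = f i)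
    (hab : f a ≠ f b) : permLength (swap a b * σ) = permLength σ + 1 := by
  have hne : a ≠ b := fun h => hab (by rw [h])
  have h1 := permLength_mul_le (swap a b) σ
  have h2 := permLength_mul_le (swap a b) (swap a b * σ)
  have h3 := permLength_parity (swap a b) σ
  rw [← mul_assoc, swap_mul_self, one_mul] at h2
  rw [permLength_swap hne] at h1 h2 h3
  by_contra hcon
  have h4 : permLength σ = 1 + permLength (swap a b * σ) := by omega
  have h5 := fixedSpace_mul_le (swap a b) (swap a b * σ)
  rw [← mul_assoc, swap_mul_self, one_mul, permLength_swap hne] at h5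
  have h6 := h5 h4 (mem_fixedSpace.2 hf) a
  rw [swap_apply_left] at h6
  exact hab h6.symm

/-- Multiplying by a transposition that moves a fixed point raises the length by one. -/
theorem permLength_swap_mul_of_fixed {a b : I} {σ : Perm I} (hab : a ≠ b) (ha : σ a = a) :
    permLength (swap a b * σ) = permLength σ + 1 := by
  refine permLength_swap_mul (fun i => if i = a then 1 else 0) (fun i => ?_) (by simp [hab.symm])
  have : σ i = a ↔ i = a := by
    constructor
    · intro h; apply σ.injective; rw [h, ha]
    · rintro rfl; exact ha
  simp [this]

end PermLength

/-! ### Geodesics in the symmetric group and their splitting -/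

section Geodesics

open Equiv Equiv.Perm

variable {I : Type*} [Fintype I] [DecidableEq I]

/-- The permutation `σ` moves only points of `A`. -/
def FixesOff (σ : Perm I) (A : Set I) : Prop := ∀ x, x ∉ A → σ x = x

theorem FixesOff.mul {σ τ : Perm I} {A : Set I} (hσ : FixesOff σ A) (hτ : FixesOff τ A) :
    FixesOff (σ * τ) A := fun x hx => by rw [Perm.mul_apply, hτ x hx, hσ x hx]

theorem FixesOff.inv {σ : Perm I} {A : Set I} (hσ : FixesOff σ A) : FixesOff σ⁻¹ A :=
  fun x hx => by rw [Perm.inv_eq_iff_eq, hσ x hx]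

theorem FixesOff.mono {σ : Perm I} {A B : Set I} (hσ : FixesOff σ A) (h : A ⊆ B) :
    FixesOff σ B := fun x hx => hσ x fun hA => hx (h hA)

theorem FixesOff.apply_mem {σ : Perm I} {A : Set I} (hσ : FixesOff σ A) {x : I} :
    σ x ∈ A ↔ x ∈ A := by
  constructor
  · intro h
    by_contra hx
    exact hx (hσ x hx ▸ h)
  · intro h
    by_contra hx
    have : σ x = x := σ.injective (hσ _ hx)
    exact hx (this.symm ▸ h)

theorem FixesOff.disjoint {σ τ : Perm I} {A B : Set I} (hσ : FixesOff σ A) (hτ : FixesOff τ B)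
    (h : _root_.Disjoint A B) : Perm.Disjoint σ τ := fun x => by
  by_cases hx : x ∈ A
  · exact Or.inr (hτ x fun hB => Set.disjoint_left.1 h hx hB)
  · exact Or.inl (hσ x hx)

theorem FixesOff.apply_mem_of_disjoint {σ : Perm I} {A B : Set I} (hσ : FixesOff σ A)
    (h : _root_.Disjoint A B) {x : I} : σ x ∈ B ↔ x ∈ B := by
  by_cases hx : x ∈ A
  · have := hσ.apply_mem.2 hx
    exact iff_of_false (Set.disjoint_left.1 h this) (Set.disjoint_left.1 h hx)
  · rw [hσ x hx]

theorem fixesOff_formPerm (L : List I) : FixesOff L.formPerm {x | x ∈ L} :=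
  fun _ hx => List.formPerm_apply_of_notMem hx

/-- A nontrivial permutation has at least one cycle, so its length is at most the size of its
support minus one. -/
theorem permLength_le_of_fixesOff {σ : Perm I} {L : List I} (h : FixesOff σ {x | x ∈ L}) :
    permLength σ ≤ L.length - 1 := by
  by_cases h1 : σ = 1
  · subst h1; simp [permLength_one]
  · have h2 : 0 < Multiset.card σ.cycleType := card_cycleType_pos.2 h1
    have h3 : σ.support.card ≤ L.length := by
      refine le_trans (Finset.card_le_card (t := L.toFinset) fun x hx => ?_) L.toFinset_card_le
      by_contra hx'
      exact mem_support.1 hx (h x fun h' => hx' (List.mem_toFinset.2 h'))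
    have h4 := sum_cycleType σ
    unfold permLength
    omega

/-- The permutations lying on a geodesic (for the length by transpositions) from `1` to `γ`. -/
def geodesics (γ : Perm I) : Finset (Perm I) :=
  {α | permLength α + permLength (α⁻¹ * γ) = permLength γ}

theorem mem_geodesics {γ α : Perm I} :
    α ∈ geodesics γ ↔ permLength α + permLength (α⁻¹ * γ) = permLength γ := by
  simp [geodesics]

theorem geodesics_one : geodesics (1 : Perm I) = {1} := by
  ext α
  rw [mem_geodesics, mul_one, permLength_inv, permLength_one, Finset.mem_singleton]
  constructor
  · intro h; exact permLength_eq_zero (by omega)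
  · rintro rfl; simp [permLength_one]

/-- Equality case of the triangle inequality: every orbit of α lies inside an orbit of γ. -/
theorem apply_eq_of_mem_geodesics {γ α : Perm I} (h : α ∈ geodesics γ) {f : I → ℚ}
    (hf : ∀ i, f (γ i) = f i) (i : I) : f (α i) = f i := by
  have := fixedSpace_mul_le α (α⁻¹ * γ) (by rw [mul_inv_cancel_left, mem_geodesics.1 h])
  rw [mul_inv_cancel_left] at this
  exact this (mem_fixedSpace.2 hf) i

theorem apply_mem_of_mem_geodesics {γ α : Perm I} (h : α ∈ geodesics γ) {A : Set I}
    (hA : ∀ x, γ x ∈ A ↔ x ∈ A) (x : I) : α x ∈ A ↔ x ∈ A := by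
  classical
  have := apply_eq_of_mem_geodesics h (f := fun i => if i ∈ A then 1 else 0)
    (fun i => by simp [hA]) x
  by_cases h1 : α x ∈ A <;> by_cases h2 : x ∈ A <;> simp_all

theorem fixesOff_of_mem_geodesics {γ α : Perm I} (h : α ∈ geodesics γ) {A : Set I}
    (hγ : FixesOff γ A) : FixesOff α A := fun x hx => by
  have hfix := hγ x hx
  have := (apply_mem_of_mem_geodesics h (A := {x}) (fun y => by
    simp only [Set.mem_singleton_iff]
    constructor
    · intro h; apply γ.injective; rw [h, hfix]
    · rintro rfl; exact hfix) x).2 rfl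
  exact this

/-- Lengths add over disjoint supports, and the triangle inequality holds in each factor, so
equality in the sum forces equality in both. -/
theorem mul_mem_geodesics {γ₁ γ₂ α₁ α₂ : Perm I} {A B : Set I} (hAB : _root_.Disjoint A B)
    (hγ₁ : FixesOff γ₁ A) (hγ₂ : FixesOff γ₂ B) (h1 : FixesOff α₁ A) (h2 : FixesOff α₂ B) :
    α₁ * α₂ ∈ geodesics (γ₁ * γ₂) ↔ α₁ ∈ geodesics γ₁ ∧ α₂ ∈ geodesics γ₂ := by
  have hc : (α₁ * α₂)⁻¹ * (γ₁ * γ₂) = (α₁⁻¹ * γ₁) * (α₂⁻¹ * γ₂) := by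
    have e1 := (h2.inv.disjoint h1.inv hAB.symm).commute.eq
    have e2 := (h2.inv.disjoint hγ₁ hAB.symm).commute.eq
    calc (α₁ * α₂)⁻¹ * (γ₁ * γ₂) = (α₂⁻¹ * α₁⁻¹) * γ₁ * γ₂ := by group
      _ = α₁⁻¹ * (α₂⁻¹ * γ₁) * γ₂ := by rw [e1]; group
      _ = _ := by rw [e2]; group
  rw [mem_geodesics, mem_geodesics, mem_geodesics, hc,
    permLength_mul_of_disjoint (h1.disjoint h2 hAB),
    permLength_mul_of_disjoint (hγ₁.disjoint hγ₂ hAB),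
    permLength_mul_of_disjoint ((h1.inv.mul hγ₁).disjoint (h2.inv.mul hγ₂) hAB)]
  have t1 := permLength_mul_le α₁ (α₁⁻¹ * γ₁)
  have t2 := permLength_mul_le α₂ (α₂⁻¹ * γ₂)
  rw [mul_inv_cancel_left] at t1 t2
  omega

/-- A geodesic of the product preserves A and B, since both are invariant under the product, and
therefore factors uniquely into its two restrictions. -/
theorem sum_geodesics_mul {R : Type*} [AddCommMonoid R] {γ₁ γ₂ : Perm I} {A B : Set I}
    (hAB : _root_.Disjoint A B) (hγ₁ : FixesOff γ₁ A) (hγ₂ : FixesOff γ₂ B) (F : Perm I → R) :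
    ∑ α ∈ geodesics (γ₁ * γ₂), F α = ∑ a ∈ geodesics γ₁, ∑ c ∈ geodesics γ₂, F (a * c) := by
  classical
  rw [← Finset.sum_product' (f := fun a c => F (a * c))]
  symm
  refine Finset.sum_nbij (fun p => p.1 * p.2) ?_ ?_ ?_ (fun _ _ => rfl)
  · rintro ⟨a, c⟩ h
    obtain ⟨h1, h2⟩ := Finset.mem_product.1 h
    exact (mul_mem_geodesics hAB hγ₁ hγ₂ (fixesOff_of_mem_geodesics h1 hγ₁)
      (fixesOff_of_mem_geodesics h2 hγ₂)).2 ⟨h1, h2⟩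
  · rintro ⟨a, c⟩ h ⟨a', c'⟩ h' (heq : a * c = a' * c')
    obtain ⟨h1, h2⟩ := Finset.mem_product.1 h
    obtain ⟨h1', h2'⟩ := Finset.mem_product.1 h'
    have f1 := fixesOff_of_mem_geodesics h1 hγ₁
    have f2 := fixesOff_of_mem_geodesics h2 hγ₂
    have f1' := fixesOff_of_mem_geodesics h1' hγ₁
    have f2' := fixesOff_of_mem_geodesics h2' hγ₂
    have ha : a = a' := by
      ext x
      by_cases hx : x ∈ A
      · have e := congrArg (fun σ : Perm I => σ x) heq
        have hB := Set.disjoint_left.1 hAB hx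
        simpa [Perm.mul_apply, f2 x hB, f2' x hB] using e
      · rw [f1 x hx, f1' x hx]
    subst ha
    simpa using heq
  · intro α hα
    have hinv : ∀ x, x ∈ A ↔ α x ∈ A := fun x => (apply_mem_of_mem_geodesics hα (fun x => by
      rw [Perm.mul_apply, hγ₁.apply_mem, hγ₂.apply_mem_of_disjoint hAB.symm]) x).symm
    have hinvB : ∀ x, α x ∈ B ↔ x ∈ B := fun x => apply_mem_of_mem_geodesics hα (fun x => by
      rw [Perm.mul_apply, hγ₁.apply_mem_of_disjoint hAB, hγ₂.apply_mem]) x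
    have hoff : ∀ x, x ∉ A → x ∉ B → α x = x := fun x hA hB =>
      fixesOff_of_mem_geodesics (A := A ∪ B) hα
        ((hγ₁.mono Set.subset_union_left).mul (hγ₂.mono Set.subset_union_right)) x
        (by simp [hA, hB])
    -- The restriction of α to A, extended by the identity; the other factor is then a⁻¹ * α.
    set a : Perm I := Perm.ofSubtype (α.subtypePerm (p := (· ∈ A)) fun x => (hinv x).symm) with ha
    have ha1 : ∀ x, x ∈ A → a x = α x := fun x hx => by
      rw [ha, Perm.ofSubtype_apply_of_mem _ hx]; rfl
    have ha2 : FixesOff a A := fun x hx => Perm.ofSubtype_apply_of_not_mem _ hx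
    have hc : FixesOff (a⁻¹ * α) B := fun x hx => by
      rw [Perm.mul_apply, Perm.inv_eq_iff_eq]
      by_cases hA : x ∈ A
      · exact (ha1 x hA).symm
      · rw [ha2 x hA, hoff x hA hx]
    have hm : a * (a⁻¹ * α) ∈ geodesics (γ₁ * γ₂) := by rwa [mul_inv_cancel_left]
    refine ⟨(a, a⁻¹ * α), ?_, mul_inv_cancel_left _ _⟩
    exact Finset.mem_coe.2 (Finset.mem_product.2
      ((mul_mem_geodesics hAB hγ₁ hγ₂ ha2 hc).1 hm))

/-- Moving the transposition across α⁻¹ turns it into one that still moves s, a fixed point of α⁻¹ *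
γ. So both |γ| and |α⁻¹ γ| grow by one and the geodesic condition is unchanged. -/
theorem mem_geodesics_swap_mul {s h : I} (hsh : s ≠ h) {γ α : Perm I} (hγ : γ s = s)
    (hα : α s = s) : α ∈ geodesics (swap s h * γ) ↔ α ∈ geodesics γ := by
  have hα' : α⁻¹ s = s := by rw [Perm.inv_eq_iff_eq, hα]
  have e : α⁻¹ * (swap s h * γ) = swap s (α⁻¹ h) * (α⁻¹ * γ) := by
    have := Equiv.mul_swap_eq_swap_mul (α⁻¹) s h
    rw [← mul_assoc, this, hα', mul_assoc]
  have hne : s ≠ α⁻¹ h := fun hs => hsh (by rw [← hα, hs, ← Perm.mul_apply, mul_inv_cancel]; rfl)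
  rw [mem_geodesics, mem_geodesics, e, permLength_swap_mul_of_fixed hsh hγ,
    permLength_swap_mul_of_fixed hne (by rw [Perm.mul_apply, hγ, hα'])]
  omega

theorem formPerm_cons_append {s j : I} {A C : List I} (h : (s :: (A ++ j :: C)).Nodup) :
    (s :: (A ++ j :: C)).formPerm = swap s j * (s :: A).formPerm * (j :: C).formPerm := by
  induction A generalizing s with
  | nil => simp [List.formPerm_cons_cons]
  | cons a A ih =>
    have hsj : s ≠ j := by
      rintro rfl; simp at h
    have hsa : s ≠ a := by
      rintro rfl; simp at h
    have haj : a ≠ j := by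
      rintro rfl; simp at h
    have h' : (a :: (A ++ j :: C)).Nodup := (List.nodup_cons.1 h).2
    rw [List.cons_append, List.formPerm_cons_cons, List.formPerm_cons_cons, ih h']
    have : swap s a * swap a j = swap s j * swap s a := by
      have := Equiv.mul_swap_eq_swap_mul (swap s a) a j
      rw [this, swap_apply_right, swap_apply_of_ne_of_ne hsj.symm haj.symm]
    rw [← mul_assoc, ← mul_assoc, this]
    group

theorem formPerm_cons_apply {s : I} {L : List I} (h : (s :: L).Nodup) : L.formPerm s = s :=
  List.formPerm_apply_of_notMem (List.nodup_cons.1 h).1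

theorem permLength_formPerm {L : List I} (h : L.Nodup) :
    permLength L.formPerm = L.length - 1 := by
  induction L with
  | nil => simp [permLength_one]
  | cons s L ih =>
    cases L with
    | nil => simp [permLength_one]
    | cons a L =>
      have hsa : s ≠ a := by
        rintro rfl; simp at h
      rw [List.formPerm_cons_cons, permLength_swap_mul_of_fixed hsa (formPerm_cons_apply h),
        ih (List.nodup_cons.1 h).2]
      simp

theorem mem_geodesics_cons {s : I} {L : List I} (h : (s :: L).Nodup) {α γ : Perm I}
    (hγ : γ s = s) (hα : α s = s) :
    α ∈ geodesics ((s :: L).formPerm * γ) ↔ α ∈ geodesics (L.formPerm * γ) := by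
  cases L with
  | nil => simp
  | cons a L =>
    have hsa : s ≠ a := by
      rintro rfl; simp at h
    rw [List.formPerm_cons_cons, mul_assoc]
    exact mem_geodesics_swap_mul hsa (by rw [Perm.mul_apply, hγ, formPerm_cons_apply h]) hα

/-- Cutting the cycle at j reads (s A j C) = (s j)(s A)(j C). The transposition cancels in the
quotient by `swap s j * α`, while both |α| and the length of the target drop by one when it is
removed. The point s can then be dropped from (s A) because α fixes it. -/
theorem swap_mul_mem_geodesics {s j : I} {A C : List I} (h : (s :: (A ++ j :: C)).Nodup)
    {α : Perm I} (hα : α s = s) :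
    swap s j * α ∈ geodesics (s :: (A ++ j :: C)).formPerm ↔
      α ∈ geodesics (A.formPerm * (j :: C).formPerm) := by
  have hsj : s ≠ j := by
    rintro rfl; simp at h
  have hsA : (s :: A).Nodup := (List.Sublist.cons_cons s (List.sublist_append_left A _)).nodup h
  have hjC : (j :: C).Nodup := (List.Sublist.cons s (List.sublist_append_right A _)).nodup h
  have hs : s ∉ j :: C := fun hs => (List.nodup_cons.1 h).1 (List.mem_append_right _ hs)
  have hdis : Perm.Disjoint (s :: A).formPerm (j :: C).formPerm := by
    refine (fixesOff_formPerm _).disjoint (fixesOff_formPerm _) (Set.disjoint_left.2 ?_)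
    intro x hx hx'
    have : ((s :: A) ++ (j :: C)).Nodup := h
    exact (List.nodup_append.1 this).2.2 x hx x hx' rfl
  rw [← mem_geodesics_cons hsA (List.formPerm_apply_of_notMem hs) hα, mem_geodesics,
    mem_geodesics, permLength_swap_mul_of_fixed hsj hα, permLength_formPerm h,
    permLength_mul_of_disjoint hdis, permLength_formPerm hsA, permLength_formPerm hjC,
    mul_inv_rev, swap_inv, formPerm_cons_append h]
  have : α⁻¹ * swap s j * (swap s j * (s :: A).formPerm * (j :: C).formPerm)
      = α⁻¹ * ((s :: A).formPerm * (j :: C).formPerm) := by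
    rw [mul_assoc, mul_assoc (swap s j), ← mul_assoc (swap s j) (swap s j), swap_mul_self, one_mul]
  rw [this]
  simp only [List.length_cons, List.length_append]
  omega

theorem sum_geodesics_of_apply {R : Type*} [AddCommMonoid R] {s j : I} {A C : List I}
    (h : (s :: (A ++ j :: C)).Nodup) (F : Perm I → R) :
    ∑ α ∈ geodesics (s :: (A ++ j :: C)).formPerm with α s = j, F α =
      ∑ a ∈ geodesics A.formPerm, ∑ c ∈ geodesics (j :: C).formPerm, F (swap s j * (a * c)) := by
  have hAC : (A ++ j :: C).Nodup := (List.nodup_cons.1 h).2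
  have hdis : _root_.Disjoint {x | x ∈ A} {x | x ∈ j :: C} := Set.disjoint_left.2
    fun x hx hx' => (List.nodup_append.1 hAC).2.2 x hx x hx' rfl
  have hfs : ∀ α ∈ geodesics (A.formPerm * (j :: C).formPerm), α s = s := fun α hα => by
    refine fixesOff_of_mem_geodesics (A := {x | x ∈ A} ∪ {x | x ∈ j :: C}) hα
      (((fixesOff_formPerm _).mono Set.subset_union_left).mul
        ((fixesOff_formPerm _).mono Set.subset_union_right)) s ?_
    intro hs
    exact (List.nodup_cons.1 h).1 (List.mem_append.2 hs)
  rw [← sum_geodesics_mul hdis (fixesOff_formPerm _) (fixesOff_formPerm _)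
    (fun α => F (swap s j * α))]
  symm
  refine Finset.sum_nbij (fun α => swap s j * α) ?_ ?_ ?_ (fun _ _ => rfl)
  · intro α hα
    refine Finset.mem_filter.2 ⟨(swap_mul_mem_geodesics h (hfs α hα)).2 hα, ?_⟩
    rw [Perm.mul_apply, hfs α hα, swap_apply_left]
  · intro a _ b _ hab
    exact mul_left_cancel hab
  · intro α hα
    obtain ⟨h1, h2⟩ := Finset.mem_filter.1 (Finset.mem_coe.1 hα)
    have h3 : (swap s j * α) s = s := by rw [Perm.mul_apply, h2, swap_apply_right]
    have h4 : swap s j * (swap s j * α) = α := by rw [← mul_assoc, swap_mul_self, one_mul]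
    exact ⟨swap s j * α, (swap_mul_mem_geodesics h h3).1 (by rwa [h4]), h4⟩

/-- Geodesics are sorted by the image of s. An image L[i] ≠ s cuts the cycle in two, just as a
noncrossing partition splits at the successor of its first point. -/
theorem sum_geodesics_cons {R : Type*} [AddCommMonoid R] {s : I} {L : List I}
    (h : (s :: L).Nodup) (F : Perm I → R) :
    ∑ α ∈ geodesics (s :: L).formPerm, F α = ∑ α ∈ geodesics L.formPerm, F α +
      ∑ i : Fin L.length, ∑ a ∈ geodesics (L.take i).formPerm,
        ∑ c ∈ geodesics (L[i] :: L.drop (i + 1)).formPerm, F (swap s L[i] * (a * c)) := by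
  have hL := (List.nodup_cons.1 h).2
  have hsL := (List.nodup_cons.1 h).1
  rw [← Finset.sum_filter_add_sum_filter_not _ (fun α : Perm I => α s = s)]
  congr 1
  · refine Finset.sum_congr ?_ fun _ _ => rfl
    ext α
    rw [Finset.mem_filter]
    constructor
    · rintro ⟨h1, h2⟩
      have := (mem_geodesics_cons h (γ := 1) rfl h2).1 (by simpa using h1)
      simpa using this
    · intro h1
      have h2 := fixesOff_of_mem_geodesics h1 (fixesOff_formPerm L) s hsL
      have := (mem_geodesics_cons h (γ := 1) rfl h2).2 (by simpa using h1)
      exact ⟨by simpa using this, h2⟩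
  · have step : ∀ i : Fin L.length, ∑ a ∈ geodesics (L.take i).formPerm,
        ∑ c ∈ geodesics (L[i] :: L.drop (i + 1)).formPerm, F (swap s L[i] * (a * c)) =
        ∑ α ∈ geodesics (s :: L).formPerm with α s = L[i], F α := fun i => by
      have hdecomp : L.take i ++ L[i] :: L.drop (i + 1) = L := by
        simp
      have h' : (s :: (L.take i ++ L[i] :: L.drop (i + 1))).Nodup := by rwa [hdecomp]
      have := sum_geodesics_of_apply h' F
      rw [← this, hdecomp]
    rw [Finset.sum_congr rfl fun i _ => step i]
    -- Exchange the sums: as L has no repetition, a geodesic moving s belongs to exactly one index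
    -- i.
    rw [Finset.sum_comm' (t' := (geodesics (s :: L).formPerm).filter fun α => ¬ α s = s)
      (s' := fun α => Finset.univ.filter fun i : Fin L.length => α s = L[i])]
    · refine Finset.sum_congr rfl fun α hα => ?_
      obtain ⟨h1, h2⟩ := Finset.mem_filter.1 hα
      have h3 : α s ∈ s :: L := ((fixesOff_of_mem_geodesics h1 (fixesOff_formPerm _)).apply_mem
        (x := s)).2 (by simp)
      have h4 : α s ∈ L := by simpa [h2] using h3
      obtain ⟨i, hi, h5⟩ := List.getElem_of_mem h4
      have : (Finset.univ.filter fun i : Fin L.length => α s = L[i]) = {⟨i, hi⟩} := by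
        ext k
        simp only [Finset.mem_filter, Finset.mem_univ, true_and, Finset.mem_singleton]
        rw [← h5]
        constructor
        · intro h6
          exact Fin.ext ((hL.getElem_inj_iff).1 h6).symm
        · rintro rfl; rfl
      rw [this, Finset.sum_singleton]
    · intro i α
      simp only [Finset.mem_filter, Finset.mem_univ, true_and]
      constructor
      · rintro ⟨h1, h2⟩
        refine ⟨h2, h1, ?_⟩
        rw [h2]
        intro h3
        exact hsL (h3 ▸ List.getElem_mem _)
      · rintro ⟨h1, h2, _⟩
        exact ⟨h2, h1⟩

end Geodesics

/-! ### The moment recursion and weighted sums over geodesics -/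

/-- The recursion characterizing the moments `M` of the measure whose free cumulants are `b` in odd
and `d` in even degree. -/
structure MomentRecursion (b d : ℝ) (M P Q : ℕ → ℝ) : Prop where
  zero : M 0 = 1
  succ : ∀ p, M (p + 1) = P p
  odd : ∀ p, P p = b * M p + ∑ i ∈ Finset.range p, M i * Q (p - 1 - i)
  even : ∀ p, Q p = d * M p + ∑ i ∈ Finset.range p, M i * P (p - 1 - i)

section GeodesicSums

open Equiv Equiv.Perm

variable {I : Type*} [Fintype I] [DecidableEq I]

theorem disjoint_of_nodup_append {A B : List I} (h : (A ++ B).Nodup) :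
    _root_.Disjoint {x | x ∈ A} {x | x ∈ B} :=
  Set.disjoint_left.2 fun x hx hx' => (List.nodup_append.1 h).2.2 x hx x hx' rfl

/-- The term `min 1 L.length` covers the empty list, where s alone gives the identity and no
transposition is spent. -/
theorem permLength_formPerm_cons_mul {s : I} {L : List I} (h : (s :: L).Nodup) {α : Perm I}
    (hα : α s = s) :
    permLength ((s :: L).formPerm * α) = min 1 L.length + permLength (L.formPerm * α) := by
  cases L with
  | nil => simp
  | cons a L =>
    have hsa : s ≠ a := by
      rintro rfl; simp at h
    rw [List.formPerm_cons_cons, mul_assoc, permLength_swap_mul_of_fixed hsa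
      (by rw [Perm.mul_apply, hα, formPerm_cons_apply h])]
    simp [add_comm]

/-- The indicator function of A is invariant under σ * τ and separates a from b. -/
theorem permLength_swap_mul_mul {A : Set I} {a b : I} (ha : a ∉ A) (hb : b ∈ A) {σ τ : Perm I}
    {B : Set I} (hAB : _root_.Disjoint A B) (hσ : FixesOff σ A) (hτ : FixesOff τ B) :
    permLength (swap a b * (σ * τ)) = 1 + (permLength σ + permLength τ) := by
  classical
  rw [permLength_swap_mul (f := fun i => if i ∈ A then 1 else 0) _ (by simp [ha, hb]),
    permLength_mul_of_disjoint (hσ.disjoint hτ hAB), add_comm]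
  intro i
  simp only [Perm.mul_apply, hσ.apply_mem, hτ.apply_mem_of_disjoint hAB.symm]

theorem permLength_formPerm_append_mul {j : I} {A C : List I} (h : (A ++ j :: C).Nodup)
    {a c : Perm I} (ha : FixesOff a {x | x ∈ A}) (hc : FixesOff c {x | x ∈ j :: C}) :
    permLength ((A ++ j :: C).formPerm * (a * c)) = min 1 A.length + permLength (A.formPerm * a) +
      permLength ((j :: C).formPerm * c) := by
  have hdis := disjoint_of_nodup_append h
  cases A with
  | nil =>
    have : a = 1 := by
      ext x
      exact ha x (by simp)
    simp [this, permLength_one]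
  | cons s A =>
    have hsj : s ≠ j := by
      rintro rfl; simp at h
    have hcomm := (ha.disjoint (fixesOff_formPerm (j :: C)) hdis).commute.eq
    have e : (s :: A ++ j :: C).formPerm * (a * c)
        = swap j s * (((s :: A).formPerm * a) * ((j :: C).formPerm * c)) := by
      rw [List.cons_append, formPerm_cons_append h, swap_comm]
      calc swap j s * (s :: A).formPerm * (j :: C).formPerm * (a * c)
          = swap j s * (s :: A).formPerm * ((j :: C).formPerm * a) * c := by group
        _ = _ := by rw [← hcomm]; group
    rw [e, permLength_swap_mul_mul (A := {x | x ∈ s :: A}) (B := {x | x ∈ j :: C})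
      (fun hj => Set.disjoint_left.1 hdis hj (by simp)) (by simp) hdis
      ((fixesOff_formPerm _).mul ha) ((fixesOff_formPerm _).mul hc)]
    simp [add_assoc]

theorem swap_mul_formPerm_cons_mul_swap {s j : I} {A : List I} (h : (s :: A).Nodup)
    (hs : j ∉ A) : swap s j * (s :: A).formPerm * swap s j = (j :: A).formPerm := by
  cases A with
  | nil => simp
  | cons a A =>
    have hsa : s ≠ a := by
      rintro rfl; simp at h
    have hja : j ≠ a := by
      rintro rfl; simp at hs
    have hcomm : (a :: A).formPerm * swap s j = swap s j * (a :: A).formPerm := by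
      rw [Equiv.mul_swap_eq_swap_mul, formPerm_cons_apply h, List.formPerm_apply_of_notMem hs]
    have key : swap s j * swap s a * swap s j = swap j a := by
      rw [Equiv.mul_swap_eq_swap_mul (swap s j) s a, swap_apply_left,
        swap_apply_of_ne_of_ne hsa.symm hja.symm, mul_assoc, swap_mul_self, mul_one]
    rw [List.formPerm_cons_cons, List.formPerm_cons_cons, ← key]
    calc swap s j * (swap s a * (a :: A).formPerm) * swap s j
        = swap s j * swap s a * ((a :: A).formPerm * swap s j) := by group
      _ = _ := by rw [hcomm]; group

/-- The transposition exchanges the heads of the two pieces: (s A j C)(s j) = (j A)(s C). Each head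
then costs one transposition if its tail is nonempty. The point j stays in the domain of c although
the cycle of C does not contain it; this is the origin of `doubledCycleSum`. -/
theorem permLength_formPerm_mul_swap {s j : I} {A C : List I} (h : (s :: (A ++ j :: C)).Nodup)
    {a c : Perm I} (ha : FixesOff a {x | x ∈ A}) (hc : FixesOff c {x | x ∈ j :: C}) :
    permLength ((s :: (A ++ j :: C)).formPerm * (swap s j * (a * c))) =
      min 1 A.length + permLength (A.formPerm * a) + min 1 C.length
        + permLength (C.formPerm * c) := by
  have hAC : (A ++ j :: C).Nodup := (List.nodup_cons.1 h).2
  have hs : s ∉ A ++ j :: C := (List.nodup_cons.1 h).1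
  have hsA : s ∉ A := fun h => hs (List.mem_append_left _ h)
  have hsjC : s ∉ j :: C := fun h => hs (List.mem_append_right _ h)
  have hjC : (j :: C).Nodup := (List.nodup_append.1 hAC).2.1
  have hjA : j ∉ A := fun hj => (List.nodup_append.1 hAC).2.2 j hj j (by simp) rfl
  have hA : A.Nodup := (List.nodup_append.1 hAC).1
  have hsC : (s :: C).Nodup := List.nodup_cons.2
    ⟨fun h => hsjC (List.mem_cons_of_mem _ h), (List.nodup_cons.1 hjC).2⟩
  have e : (s :: (A ++ j :: C)).formPerm * (swap s j * (a * c))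
      = (j :: A).formPerm * ((s :: C).formPerm * (a * c)) := by
    rw [formPerm_cons_append h, ← swap_mul_formPerm_cons_mul_swap
      (List.nodup_cons.2 ⟨hsA, hA⟩) hjA, ← swap_mul_formPerm_cons_mul_swap hjC
      (List.not_mem_of_not_mem_cons hsjC), swap_comm j s]
    have := swap_mul_self s j
    calc _ = swap s j * (s :: A).formPerm * 1 * (j :: C).formPerm * swap s j * (a * c) := by group
      _ = _ := by rw [← this]; group
  have hdis : _root_.Disjoint {x | x ∈ A} {x | x ∈ s :: j :: C} := by
    refine Set.disjoint_left.2 fun x hx hx' => ?_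
    rcases List.mem_cons.1 hx' with rfl | hx'
    · exact hsA hx
    · exact Set.disjoint_left.1 (disjoint_of_nodup_append hAC) hx hx'
  have hsC' : FixesOff (s :: C).formPerm {x | x ∈ s :: j :: C} :=
    (fixesOff_formPerm _).mono fun x hx => by
      simp only [Set.mem_ofPred_eq, List.mem_cons] at hx ⊢
      tauto
  have hc' : FixesOff c {x | x ∈ s :: j :: C} := hc.mono fun x hx => List.mem_cons_of_mem _ hx
  have hcomm := (ha.disjoint hsC' hdis).commute.eq
  have hcs : c s = s := hc s hsjC
  have key : permLength ((j :: A).formPerm * ((s :: C).formPerm * (a * c))) =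
      min 1 A.length + permLength (A.formPerm * a) + permLength ((s :: C).formPerm * c) := by
    rw [← mul_assoc _ a, ← hcomm]
    cases A with
    | nil =>
      have : a = 1 := by
        ext x
        exact ha x (by simp)
      simp [this, permLength_one]
    | cons t A =>
      have : (j :: t :: A).formPerm * (a * (s :: C).formPerm * c)
          = swap j t * (((t :: A).formPerm * a) * ((s :: C).formPerm * c)) := by
        rw [List.formPerm_cons_cons]; group
      rw [this, permLength_swap_mul_mul (A := {x | x ∈ t :: A}) (B := {x | x ∈ s :: j :: C}) hjA
        (by simp) hdis ((fixesOff_formPerm _).mul ha) (hsC'.mul hc')]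
      simp [add_assoc]
  rw [e, key, permLength_formPerm_cons_mul hsC hcs]
  ring

/-- Length is invariant under rotating a product. After rotation the transposition multiplies a
permutation fixing j. -/
theorem permLength_formPerm_mul_swap_of_notMem {j k : I} {A C : List I}
    (h : (j :: (A ++ k :: C)).Nodup) {a c : Perm I} (ha : FixesOff a {x | x ∈ A})
    (hc : FixesOff c {x | x ∈ k :: C}) :
    permLength ((A ++ k :: C).formPerm * (swap j k * (a * c))) =
      1 + min 1 A.length + permLength (A.formPerm * a) + permLength ((k :: C).formPerm * c) := by
  have hj : j ∉ A ++ k :: C := (List.nodup_cons.1 h).1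
  have hjk : j ≠ k := by
    rintro rfl; simp at h
  rw [permLength_mul_comm, mul_assoc, permLength_swap_mul_of_fixed hjk, permLength_mul_comm,
    permLength_formPerm_append_mul (List.nodup_cons.1 h).2 ha hc]
  · ring
  · rw [Perm.mul_apply, Perm.mul_apply, List.formPerm_apply_of_notMem hj,
      hc j fun h => hj (List.mem_append_right _ h), ha j fun h => hj (List.mem_append_left _ h)]

/-- The generating polynomial of the geodesics of a full cycle `γ`, by the numbers of orbits of `α`
and of `γ * α`. -/
noncomputable def cycleSum (β m : ℝ) (L : List I) : ℝ :=
  ∑ α ∈ geodesics L.formPerm, β ^ (L.length - permLength α) *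
    m ^ (L.length - permLength (L.formPerm * α) - 1)

/-- The variant of `cycleSum` where the first point counts double. -/
noncomputable def doubledCycleSum (β m : ℝ) (j : I) (C : List I) : ℝ :=
  ∑ c ∈ geodesics (j :: C).formPerm, β ^ (C.length + 1 - permLength c) *
    m ^ (C.length + 1 - min 1 C.length - permLength (C.formPerm * c))

theorem permLength_le_of_mem_geodesics {L : List I} {α : Perm I}
    (h : α ∈ geodesics L.formPerm) : permLength α ≤ L.length - 1 ∧
      permLength (L.formPerm * α) ≤ L.length - 1 :=
  have h1 := fixesOff_of_mem_geodesics h (fixesOff_formPerm L)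
  ⟨permLength_le_of_fixesOff h1, permLength_le_of_fixesOff ((fixesOff_formPerm L).mul h1)⟩

/-- If s is fixed it is a singleton orbit, worth β and no power of m. Otherwise the two length
computations above are additive over the pieces, and the second piece carries the doubled head. -/
theorem cycleSum_cons (β m : ℝ) {s : I} {L : List I} (h : (s :: L).Nodup) :
    cycleSum β m (s :: L) = β * cycleSum β m L +
      ∑ i : Fin L.length, cycleSum β m (L.take i) *
        doubledCycleSum β m L[i] (L.drop (i + 1)) := by
  rw [cycleSum, sum_geodesics_cons h, cycleSum, Finset.mul_sum]
  congr 1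
  · refine Finset.sum_congr rfl fun α hα => ?_
    obtain ⟨h1, h2⟩ := permLength_le_of_mem_geodesics hα
    have h3 := fixesOff_of_mem_geodesics hα (fixesOff_formPerm L) s (List.nodup_cons.1 h).1
    rw [permLength_formPerm_cons_mul h h3, ← mul_assoc, ← pow_succ', List.length_cons]
    congr 2
    · omega
    · rcases Nat.eq_zero_or_pos L.length with h0 | h0 <;> omega
  · refine Finset.sum_congr rfl fun i _ => ?_
    have hdecomp : L.take i ++ L[i] :: L.drop (i + 1) = L := by simp
    have hlen : (L.take i).length + ((L.drop (i + 1)).length + 1) = L.length := by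
      have := i.2
      simp; omega
    have h' : (s :: (L.take i ++ L[i] :: L.drop (i + 1))).Nodup := by rwa [hdecomp]
    rw [cycleSum, doubledCycleSum, Finset.sum_mul_sum]
    refine Finset.sum_congr rfl fun a ha => Finset.sum_congr rfl fun c hc => ?_
    have ha' := fixesOff_of_mem_geodesics ha (fixesOff_formPerm _)
    have hc' := fixesOff_of_mem_geodesics hc (fixesOff_formPerm _)
    obtain ⟨a1, a2⟩ := permLength_le_of_mem_geodesics ha
    obtain ⟨c1, -⟩ := permLength_le_of_mem_geodesics hc
    have hdis := disjoint_of_nodup_append (List.nodup_cons.1 h').2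
    have hs := (List.nodup_cons.1 h').1
    have hsL : s ≠ L[i] := fun e => hs (by simp [← e])
    have l1 : permLength (swap s L[i] * (a * c)) = permLength a + permLength c + 1 := by
      rw [permLength_swap_mul_of_fixed hsL, permLength_mul_of_disjoint (ha'.disjoint hc' hdis)]
      rw [Perm.mul_apply, hc' s fun h => hs (List.mem_append_right _ h),
        ha' s fun h => hs (List.mem_append_left _ h)]
    have l2 := permLength_formPerm_mul_swap h' ha' hc'
    rw [hdecomp] at l2
    -- Here c may move L[i], so the bound is the one for the list with that extra point; it keeps
    -- the natural subtractions below exact.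
    have l3 : permLength ((L.drop (i + 1)).formPerm * c) ≤ (L.drop (i + 1)).length := by
      have := permLength_le_of_fixesOff (σ := (L.drop (i + 1)).formPerm * c)
        (L := L[i] :: L.drop (i + 1)) (((fixesOff_formPerm _).mono
          fun x hx => List.mem_cons_of_mem _ hx).mul hc')
      simpa [Nat.sub_sub] using this
    have l4 : (L.drop (i + 1)).length = 0 → permLength ((L.drop (i + 1)).formPerm * c) = 0 := by
      intro h0
      omega
    rw [l1, l2, mul_mul_mul_comm, ← pow_add, ← pow_add, List.length_cons]
    simp only [List.length_cons] at c1
    congr 2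
    · rcases Nat.eq_zero_or_pos (L.take i).length with h0 | h0 <;> omega
    · generalize (L.take i).length = A at *
      generalize (L.drop (i + 1)).length = C at *
      rcases Nat.eq_zero_or_pos A with h0 | h0 <;> rcases Nat.eq_zero_or_pos C with h1 | h1 <;>
        omega

/-- A fixed head now counts as an orbit of even size, worth β m. If the head is moved, its double
count and the step to C[i] cancel in parity, so an ordinary sum remains. -/
theorem doubledCycleSum_cons (β m : ℝ) {j : I} {C : List I} (h : (j :: C).Nodup) :
    doubledCycleSum β m j C = β * m * cycleSum β m C +
      ∑ i : Fin C.length, cycleSum β m (C.take i) *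
        cycleSum β m (C[i] :: C.drop (i + 1)) := by
  rw [doubledCycleSum, sum_geodesics_cons h, cycleSum, Finset.mul_sum]
  congr 1
  · refine Finset.sum_congr rfl fun α hα => ?_
    obtain ⟨h1, h2⟩ := permLength_le_of_mem_geodesics hα
    rw [mul_mul_mul_comm, ← pow_succ', ← pow_succ']
    congr 2
    · omega
    · rcases Nat.eq_zero_or_pos C.length with h0 | h0 <;> omega
  · refine Finset.sum_congr rfl fun i _ => ?_
    have hdecomp : C.take i ++ C[i] :: C.drop (i + 1) = C := by simp
    have hlen : (C.take i).length + ((C.drop (i + 1)).length + 1) = C.length := by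
      have := i.2
      simp; omega
    have h' : (j :: (C.take i ++ C[i] :: C.drop (i + 1))).Nodup := by rwa [hdecomp]
    rw [cycleSum, cycleSum, Finset.sum_mul_sum]
    refine Finset.sum_congr rfl fun a ha => Finset.sum_congr rfl fun c hc => ?_
    have ha' := fixesOff_of_mem_geodesics ha (fixesOff_formPerm _)
    have hc' := fixesOff_of_mem_geodesics hc (fixesOff_formPerm _)
    obtain ⟨a1, a2⟩ := permLength_le_of_mem_geodesics ha
    obtain ⟨c1, c2⟩ := permLength_le_of_mem_geodesics hc
    have hdis := disjoint_of_nodup_append (List.nodup_cons.1 h').2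
    have hs := (List.nodup_cons.1 h').1
    have hsL : j ≠ C[i] := fun e => hs (by simp [← e])
    have l1 : permLength (swap j C[i] * (a * c)) = permLength a + permLength c + 1 := by
      rw [permLength_swap_mul_of_fixed hsL, permLength_mul_of_disjoint (ha'.disjoint hc' hdis)]
      rw [Perm.mul_apply, hc' j fun h => hs (List.mem_append_right _ h),
        ha' j fun h => hs (List.mem_append_left _ h)]
    have l2 := permLength_formPerm_mul_swap_of_notMem h' ha' hc'
    rw [hdecomp] at l2
    rw [l1, l2, mul_mul_mul_comm, ← pow_add, ← pow_add, List.length_cons]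
    simp only [List.length_cons] at c1 c2
    generalize (C.take i).length = A at *
    generalize (C.drop (i + 1)).length = D at *
    congr 2 <;> rcases Nat.eq_zero_or_pos A with h0 | h0 <;> omega

/-- Simultaneous strong induction for both sums; in particular they depend on the list only through
its length. -/
theorem cycleSum_eq {β m : ℝ} {M P Q : ℕ → ℝ} (hM : MomentRecursion β (β * m) M P Q)
    {L : List I} (h : L.Nodup) : cycleSum β m L = M L.length := by
  suffices H : ∀ n, (∀ L : List I, L.Nodup → L.length = n → cycleSum β m L = M n) ∧
      ∀ (j : I) (C : List I), (j :: C).Nodup → C.length = n → doubledCycleSum β m j C = Q n from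
    (H _).1 L h rfl
  intro n
  induction n using Nat.strong_induction_on with
  | _ n ih =>
    have hn : ∀ L : List I, L.Nodup → L.length = n → cycleSum β m L = M n := by
      intro L hL hn
      cases L with
      | nil =>
        subst hn
        simp [cycleSum, geodesics_one, hM.zero]
      | cons s L =>
        subst hn
        rw [cycleSum_cons β m hL, List.length_cons, hM.succ, hM.odd,
          (ih _ (by simp)).1 L (List.nodup_cons.1 hL).2 rfl]
        congr 1
        rw [Finset.sum_range]
        refine Finset.sum_congr rfl fun i _ => ?_
        have hi := i.2
        have hdecomp : L.take i ++ L[i] :: L.drop (i + 1) = L := by simp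
        have hL' := (List.nodup_cons.1 hL).2
        rw [(ih i (by rw [List.length_cons]; omega)).1 (L.take i) ((List.take_sublist _ _).nodup hL')
          (by simp), (ih (L.length - 1 - i) (by simp; omega)).2]
        · rw [← hdecomp] at hL'
          exact (List.nodup_append.1 hL').2.1
        · simp; omega
    refine ⟨hn, fun j C hC hCn => ?_⟩
    subst hCn
    have hC' := (List.nodup_cons.1 hC).2
    rw [doubledCycleSum_cons β m hC, hM.even, hn C hC' rfl]
    congr 1
    rw [Finset.sum_range]
    refine Finset.sum_congr rfl fun i _ => ?_
    have hi := i.2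
    have hdecomp : C.take i ++ C[i] :: C.drop (i + 1) = C := by simp
    rw [(ih i (by omega)).1 (C.take i) ((List.take_sublist _ _).nodup hC') (by simp)]
    congr 1
    have hnd : (C[i] :: C.drop (i + 1)).Nodup := by
      rw [← hdecomp] at hC'
      exact (List.nodup_append.1 hC').2.1
    have hlen : (C[i] :: C.drop (i + 1)).length = C.length - 1 - i + 1 := by simp; omega
    rw [← hM.succ, ← hlen]
    -- The term i = 0 has full length n, outside the induction hypothesis; it is covered by `hn`,
    -- just proved at n.
    by_cases h0 : (C[i] :: C.drop (i + 1)).length = C.length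
    · rw [h0]
      exact hn _ hnd h0
    · exact (ih _ (by omega)).1 _ hnd rfl

end GeodesicSums

/-! ### Noncrossing partitions, split at the successor of the first point -/

section Noncrossing

variable {X : Type*} [LinearOrder X]

/-- Noncrossing partitions of a finite subset of a linear order. -/
def Noncross {s : Finset X} (τ : Finpartition s) : Prop :=
  ∀ B ∈ τ.parts, ∀ C ∈ τ.parts, ∀ a ∈ B, ∀ b ∈ C, ∀ c ∈ B, ∀ d ∈ C,
    a < b → b < c → c < d → B = C

open scoped Classical in
/-- The sum over noncrossing partitions of the products of the weights of the blocks. -/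
noncomputable def ncSum (k : ℕ → ℝ) (s : Finset X) : ℝ :=
  ∑ τ : Finpartition s with Noncross τ, ∏ B ∈ τ.parts, k B.card

open scoped Classical in
/-- The variant of `ncSum` where the point `x` counts `c` times more. -/
noncomputable def ncSumFrom (k : ℕ → ℝ) (x : X) (c : ℕ) (s : Finset X) : ℝ :=
  ∑ τ : Finpartition s with Noncross τ, ∏ B ∈ τ.parts, k (B.card + if x ∈ B then c else 0)

theorem ncSumFrom_zero (k : ℕ → ℝ) (x : X) (s : Finset X) : ncSumFrom k x 0 s = ncSum k s := by
  simp [ncSumFrom, ncSum]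

theorem ncSum_empty (k : ℕ → ℝ) : ncSum k (∅ : Finset X) = 1 := by
  classical
  have h : ∀ τ : Finpartition (∅ : Finset X), τ.parts = ∅ := fun τ => by
    rw [Finpartition.parts_eq_empty_iff]; rfl
  have hn : ∀ τ : Finpartition (∅ : Finset X), Noncross τ := fun τ B hB => by
    rw [h] at hB; simp at hB
  have hs : Subsingleton (Finpartition (∅ : Finset X)) :=
    ⟨fun a b => Finpartition.ext (by rw [h, h])⟩
  have : (Finset.univ.filter fun τ : Finpartition (∅ : Finset X) => Noncross τ) =
      {Finpartition.empty _} := by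
    ext τ
    simp [hn, Subsingleton.elim τ (Finpartition.empty _)]
  rw [ncSum, this, Finset.sum_singleton, h, Finset.prod_empty]

variable {s : Finset X} {x : X}

/-- Adjoin a new point as a singleton block. -/
def addSingleton (hx : x ∉ s) (τ : Finpartition s) : Finpartition (insert x s) :=
  τ.extend (b := {x}) (Finset.singleton_ne_empty x) (Finset.disjoint_singleton_right.2 hx)
    (by rw [Finset.sup_eq_union, Finset.union_comm]; rfl)

theorem addSingleton_parts (hx : x ∉ s) (τ : Finpartition s) :
    (addSingleton hx τ).parts = insert {x} τ.parts := rfl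

theorem singleton_notMem_parts (hx : x ∉ s) (τ : Finpartition s) : {x} ∉ τ.parts :=
  fun h => hx (τ.subset h (Finset.mem_singleton_self x))

theorem noncross_addSingleton (hx : x ∉ s) (τ : Finpartition s) :
    Noncross (addSingleton hx τ) ↔ Noncross τ := by
  constructor
  · intro h B hB C hC
    exact h B (Finset.mem_insert_of_mem hB) C (Finset.mem_insert_of_mem hC)
  · intro h B hB C hC a ha b hb c hc d hd hab hbc hcd
    rcases Finset.mem_insert.1 hB with rfl | hB
    · rw [Finset.mem_singleton] at ha hc
      subst ha hc
      exact absurd (hab.trans hbc) (lt_irrefl _)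
    · rcases Finset.mem_insert.1 hC with rfl | hC
      · rw [Finset.mem_singleton] at hb hd
        subst hb hd
        exact absurd (hbc.trans hcd) (lt_irrefl _)
      · exact h B hB C hC a ha b hb c hc d hd hab hbc hcd

open scoped Classical in
theorem sum_noncross_singleton (hx : x ∉ s) (k : ℕ → ℝ) (c : ℕ) :
    ∑ τ : Finpartition (insert x s) with Noncross τ ∧ {x} ∈ τ.parts,
      ∏ B ∈ τ.parts, k (B.card + if x ∈ B then c else 0) = k (1 + c) * ncSum k s := by
  rw [ncSum, Finset.mul_sum]
  symm
  refine Finset.sum_nbij (addSingleton hx) ?_ ?_ ?_ ?_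
  · intro τ hτ
    simp only [Finset.mem_filter, Finset.mem_univ, true_and] at hτ ⊢
    exact ⟨(noncross_addSingleton hx τ).2 hτ, Finset.mem_insert_self _ _⟩
  · intro τ _ τ' _ h
    have h1 := congrArg Finpartition.parts h
    rw [addSingleton_parts, addSingleton_parts] at h1
    apply Finpartition.ext
    rw [← Finset.erase_insert (singleton_notMem_parts hx τ), h1,
      Finset.erase_insert (singleton_notMem_parts hx τ')]
  · intro τ hτ
    simp only [Finset.coe_filter, Finset.mem_univ, true_and, Set.mem_ofPred_eq] at hτ
    let τ' : Finpartition s := Finpartition.ofSubset τ (Finset.erase_subset {x} τ.parts) (by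
      ext z
      simp only [Finset.sup_eq_biUnion, Finset.mem_biUnion, Finset.mem_erase, id]
      constructor
      · rintro ⟨B, ⟨h1, h2⟩, h3⟩
        refine Finset.mem_of_mem_insert_of_ne (τ.subset h2 h3) ?_
        rintro rfl
        exact h1 (τ.eq_of_mem_parts h2 hτ.2 h3 (Finset.mem_singleton_self _))
      · intro hz
        obtain ⟨B, hB, hzB⟩ := τ.exists_mem (Finset.mem_insert_of_mem hz)
        refine ⟨B, ⟨?_, hB⟩, hzB⟩
        rintro rfl
        rw [Finset.mem_singleton] at hzB
        exact hx (hzB ▸ hz))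
    have he : addSingleton hx τ' = τ := by
      apply Finpartition.ext
      rw [addSingleton_parts]
      exact Finset.insert_erase hτ.2
    refine ⟨τ', ?_, he⟩
    simp only [Finset.coe_filter, Finset.mem_univ, true_and, Set.mem_ofPred_eq]
    exact (noncross_addSingleton hx τ').1 (he ▸ hτ.1)
  · intro τ _
    rw [addSingleton_parts, Finset.prod_insert (singleton_notMem_parts hx τ)]
    simp only [Finset.card_singleton, Finset.mem_singleton, if_true]
    congr 1
    refine Finset.prod_congr rfl fun B hB => ?_
    have : x ∉ B := fun h => hx (τ.subset hB h)
    simp [this]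

section Glue

variable {y : X}

/-- Adjoin the point `x` to the sets containing `y`. -/
def attach (x y : X) (B : Finset X) : Finset X := if y ∈ B then insert x B else B

theorem mem_attach {x y z : X} {B : Finset X} : z ∈ attach x y B ↔ z ∈ B ∨ (z = x ∧ y ∈ B) := by
  unfold attach
  split_ifs with h
  · rw [Finset.mem_insert]; tauto
  · tauto

theorem attach_erase {B : Finset X} (hx : x ∉ B) : (attach x y B).erase x = B := by
  ext z
  rw [Finset.mem_erase, mem_attach]
  constructor
  · tauto
  · intro hz
    exact ⟨fun h => hx (h ▸ hz), Or.inl hz⟩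

variable (hx : ∀ z ∈ s, x < z) (hy : y ∈ s)
include hx hy

/-- Glue a partition of the points below `y` and one of the points from `y` on, adjoining `x` to the
block of `y`. -/
def gluePartition (τ₁ : Finpartition (s.filter (· < y))) (τ₂ : Finpartition (s.filter (y ≤ ·))) :
    Finpartition (insert x s) :=
  Finpartition.ofExistsUnique (τ₁.parts ∪ τ₂.parts.image (attach x y))
    (by
      intro B hB
      rcases Finset.mem_union.1 hB with hB | hB
      · exact (τ₁.subset hB).trans ((Finset.filter_subset _ _).trans (Finset.subset_insert _ _))
      · obtain ⟨B', hB', rfl⟩ := Finset.mem_image.1 hB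
        intro z hz
        rcases mem_attach.1 hz with hz | ⟨rfl, -⟩
        · exact Finset.mem_insert_of_mem (Finset.mem_filter.1 (τ₂.subset hB' hz)).1
        · exact Finset.mem_insert_self _ _)
    (by
      have hyC : y ∈ s.filter (y ≤ ·) := Finset.mem_filter.2 ⟨hy, le_rfl⟩
      have key : ∀ B ∈ τ₂.parts, ∀ D ∈ τ₂.parts, ∀ z, z ∈ attach x y B → z ∈ attach x y D →
          B = D := by
        intro B hB D hD z h1 h2
        rcases mem_attach.1 h1 with h3 | ⟨h3, h3'⟩ <;> rcases mem_attach.1 h2 with h4 | ⟨h4, h4'⟩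
        · exact τ₂.eq_of_mem_parts hB hD h3 h4
        · exact absurd (hx _ (Finset.mem_filter.1 (τ₂.subset hB h3)).1) (h4 ▸ lt_irrefl _)
        · exact absurd (hx _ (Finset.mem_filter.1 (τ₂.subset hD h4)).1) (h3 ▸ lt_irrefl _)
        · exact τ₂.eq_of_mem_parts hB hD h3' h4'
      have key2 : ∀ B ∈ τ₁.parts, ∀ D ∈ τ₂.parts, ∀ z, z ∈ B → z ∈ attach x y D → False := by
        intro B hB D hD z h1 h2
        have h3 := Finset.mem_filter.1 (τ₁.subset hB h1)
        rcases mem_attach.1 h2 with h2 | ⟨rfl, h2⟩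
        · exact absurd (Finset.mem_filter.1 (τ₂.subset hD h2)).2 (not_le.2 h3.2)
        · exact lt_irrefl _ (hx _ h3.1)
      intro z hz
      by_cases h1 : z ∈ s.filter (· < y)
      · obtain ⟨B, hB, hzB⟩ := τ₁.exists_mem h1
        refine ⟨B, ⟨Finset.mem_union_left _ hB, hzB⟩, ?_⟩
        rintro D ⟨hD, hzD⟩
        rcases Finset.mem_union.1 hD with hD | hD
        · exact τ₁.eq_of_mem_parts hD hB hzD hzB
        · obtain ⟨D', hD', rfl⟩ := Finset.mem_image.1 hD
          exact (key2 B hB D' hD' z hzB hzD).elim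
      · obtain ⟨B, hB, hzB⟩ : ∃ B ∈ τ₂.parts, z ∈ attach x y B := by
          rcases Finset.mem_insert.1 hz with rfl | hz
          · obtain ⟨B, hB, hyB⟩ := τ₂.exists_mem hyC
            exact ⟨B, hB, mem_attach.2 (Or.inr ⟨rfl, hyB⟩)⟩
          · obtain ⟨B, hB, hzB⟩ := τ₂.exists_mem (a := z) (Finset.mem_filter.2
              ⟨hz, not_lt.1 fun h => h1 (Finset.mem_filter.2 ⟨hz, h⟩)⟩)
            exact ⟨B, hB, mem_attach.2 (Or.inl hzB)⟩
        refine ⟨_, ⟨Finset.mem_union_right _ (Finset.mem_image_of_mem _ hB), hzB⟩, ?_⟩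
        rintro D ⟨hD, hzD⟩
        rcases Finset.mem_union.1 hD with hD | hD
        · exact (key2 D hD B hB z hzD hzB).elim
        · obtain ⟨D', hD', rfl⟩ := Finset.mem_image.1 hD
          rw [key D' hD' B hB z hzD hzB])
    (by
      intro h
      rcases Finset.mem_union.1 h with h | h
      · exact τ₁.empty_notMem_parts h
      · obtain ⟨B, hB, h0⟩ := Finset.mem_image.1 h
        obtain ⟨z, hz⟩ := τ₂.nonempty_of_mem_parts hB
        have : z ∈ attach x y B := mem_attach.2 (Or.inl hz)
        rw [h0] at this
        simp at this)

theorem gluePartition_parts (τ₁ : Finpartition (s.filter (· < y)))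
    (τ₂ : Finpartition (s.filter (y ≤ ·))) :
    (gluePartition hx hy τ₁ τ₂).parts = τ₁.parts ∪ τ₂.parts.image (attach x y) := rfl

/-- Blocks of τ₁ lie strictly between x and y and blocks of τ₂ lie from y on, so only two upper
blocks could cross. -/
theorem noncross_gluePartition {τ₁ : Finpartition (s.filter (· < y))}
    {τ₂ : Finpartition (s.filter (y ≤ ·))} (h1 : Noncross τ₁) (h2 : Noncross τ₂) :
    Noncross (gluePartition hx hy τ₁ τ₂) := by
  have hA : ∀ B ∈ τ₁.parts, ∀ z ∈ B, x < z ∧ z < y := fun B hB z hz =>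
    have := Finset.mem_filter.1 (τ₁.subset hB hz)
    ⟨hx z this.1, this.2⟩
  have hC : ∀ B ∈ τ₂.parts, ∀ z ∈ B, x < z ∧ y ≤ z := fun B hB z hz =>
    have := Finset.mem_filter.1 (τ₂.subset hB hz)
    ⟨hx z this.1, this.2⟩
  have hC' : ∀ B ∈ τ₂.parts, ∀ z ∈ attach x y B, x ≤ z ∧ (x < z → z ∈ B) := by
    intro B hB z hz
    rcases mem_attach.1 hz with hz | ⟨rfl, -⟩
    · exact ⟨(hC B hB z hz).1.le, fun _ => hz⟩
    · exact ⟨le_rfl, fun h => absurd h (lt_irrefl _)⟩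
  intro B hB D hD a ha b hb c hc d hd hab hbc hcd
  rw [gluePartition_parts] at hB hD
  rcases Finset.mem_union.1 hB with hB | hB <;> rcases Finset.mem_union.1 hD with hD | hD
  · exact h1 B hB D hD a ha b hb c hc d hd hab hbc hcd
  · obtain ⟨D', hD', rfl⟩ := Finset.mem_image.1 hD
    have e1 := (hC' D' hD' b hb).2 ((hA B hB a ha).1.trans hab)
    exact absurd ((hC D' hD' b e1).2.trans_lt hbc) (not_lt.2 (hA B hB c hc).2.le)
  · obtain ⟨B', hB', rfl⟩ := Finset.mem_image.1 hB
    have e1 := (hC' B' hB' c hc).2 ((hA D hD b hb).1.trans hbc)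
    exact absurd ((hC B' hB' c e1).2.trans_lt hcd) (not_lt.2 (hA D hD d hd).2.le)
  · obtain ⟨B', hB', rfl⟩ := Finset.mem_image.1 hB
    obtain ⟨D', hD', rfl⟩ := Finset.mem_image.1 hD
    have hxa := (hC' B' hB' a ha).1
    have hb' := (hC' D' hD' b hb).2 (hxa.trans_lt hab)
    have hc' := (hC' B' hB' c hc).2 ((hxa.trans_lt hab).trans hbc)
    have hd' := (hC' D' hD' d hd).2 (((hxa.trans_lt hab).trans hbc).trans hcd)
    congr 1
    -- As x lies below all other points, it can only be the first of the four; there y, in the same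
    -- block of τ₂, can replace it.
    rcases mem_attach.1 ha with ha | ⟨rfl, hy'⟩
    · exact h2 B' hB' D' hD' a ha b hb' c hc' d hd' hab hbc hcd
    · rcases (hC D' hD' b hb').2.eq_or_lt with rfl | hyb
      · exact τ₂.eq_of_mem_parts hB' hD' hy' hb'
      · exact h2 B' hB' D' hD' y hy' b hb' c hc' d hd' hyb hbc hcd

/-- Recovers both partitions from the glued one, which gives injectivity of the gluing. -/
theorem parts_of_gluePartition (τ₁ : Finpartition (s.filter (· < y)))
    (τ₂ : Finpartition (s.filter (y ≤ ·))) :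
    τ₁.parts = (gluePartition hx hy τ₁ τ₂).parts.filter (· ⊆ s.filter (· < y)) ∧
    τ₂.parts = ((gluePartition hx hy τ₁ τ₂).parts.filter
      (¬ · ⊆ s.filter (· < y))).image (·.erase x) := by
  have e1 : ∀ B ∈ τ₁.parts, B ⊆ s.filter (· < y) := fun B hB => τ₁.subset hB
  have e2 : ∀ B ∈ τ₂.parts, ¬ attach x y B ⊆ s.filter (· < y) := fun B hB h => by
    obtain ⟨z, hz⟩ := τ₂.nonempty_of_mem_parts hB
    have h1 := (Finset.mem_filter.1 (h (mem_attach.2 (Or.inl hz)))).2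
    exact absurd (Finset.mem_filter.1 (τ₂.subset hB hz)).2 (not_le.2 h1)
  have e3 : ∀ B ∈ τ₂.parts, (attach x y B).erase x = B := fun B hB =>
    attach_erase fun h => lt_irrefl _ (hx x (Finset.mem_filter.1 (τ₂.subset hB h)).1)
  constructor
  · ext B
    rw [Finset.mem_filter, gluePartition_parts, Finset.mem_union, Finset.mem_image]
    constructor
    · intro h; exact ⟨Or.inl h, e1 B h⟩
    · rintro ⟨h | ⟨D, hD, rfl⟩, h'⟩
      · exact h
      · exact (e2 D hD h').elim
  · ext B
    rw [Finset.mem_image]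
    simp only [Finset.mem_filter, gluePartition_parts, Finset.mem_union, Finset.mem_image]
    constructor
    · intro h
      exact ⟨attach x y B, ⟨Or.inr ⟨B, h, rfl⟩, e2 B h⟩, e3 B h⟩
    · rintro ⟨D, ⟨h | ⟨D', hD', rfl⟩, h'⟩, rfl⟩
      · exact (h' (e1 D h)).elim
      · rwa [e3 D' hD']

/-- Since x and y are consecutive in B₀, any other block with points on both sides of y would cross
B₀. So every block lies below y, or from y on apart from x. -/
theorem exists_gluePartition {τ : Finpartition (insert x s)} (hτ : Noncross τ)
    {B₀ : Finset X} (hB₀ : B₀ ∈ τ.parts) (hxB : x ∈ B₀) (hyB : y ∈ B₀)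
    (hmin : ∀ z ∈ B₀, z ≠ x → y ≤ z) :
    ∃ τ₁ τ₂, Noncross τ₁ ∧ Noncross τ₂ ∧ gluePartition hx hy τ₁ τ₂ = τ := by
  have hxy := hx y hy
  have hsub : ∀ B ∈ τ.parts, B ⊆ s.filter (· < y) ∨
      (∀ z ∈ B, z ≠ x → z ∈ s.filter (y ≤ ·)) := by
    intro B hB
    by_cases hBB : B = B₀
    · right
      rintro z hz hzx
      have hz' := hBB ▸ hz
      exact Finset.mem_filter.2 ⟨Finset.mem_of_mem_insert_of_ne (τ.subset hB hz) hzx,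
        hmin z hz' hzx⟩
    · have hxB' : x ∉ B := fun h => hBB (τ.eq_of_mem_parts hB hB₀ h hxB)
      have hyB' : y ∉ B := fun h => hBB (τ.eq_of_mem_parts hB hB₀ h hyB)
      have hs : ∀ z ∈ B, z ∈ s := fun z hz =>
        Finset.mem_of_mem_insert_of_ne (τ.subset hB hz) fun h => hxB' (h ▸ hz)
      by_contra hcon
      push Not at hcon
      obtain ⟨hc1, z, hz, hzx, hz2⟩ := hcon
      obtain ⟨w, hw, hw2⟩ := Finset.not_subset.1 hc1
      have hzy : z < y := not_le.1 fun h => hz2 (Finset.mem_filter.2 ⟨hs z hz, h⟩)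
      have hwy : y < w := lt_of_le_of_ne
        (not_lt.1 fun h => hw2 (Finset.mem_filter.2 ⟨hs w hw, h⟩)) fun h => hyB' (h ▸ hw)
      -- The crossing is x < z < y < w, with x, y in B₀ and z, w in B.
      exact hBB (hτ B₀ hB₀ B hB x hxB z hz y hyB w hw (hx z (hs z hz)) hzy hwy).symm
  have hxnot : ∀ B ∈ τ.parts, B ⊆ s.filter (· < y) → x ∉ B := fun B _ h hxB' =>
    lt_irrefl _ (hx x (Finset.mem_filter.1 (h hxB')).1)
  have hB₀' : ¬ B₀ ⊆ s.filter (· < y) := fun h => hxnot B₀ hB₀ h hxB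
  have hup : ∀ B ∈ τ.parts, ¬ B ⊆ s.filter (· < y) → ∃ z ∈ B, z ≠ x := by
    intro B hB hB'
    by_contra hcon
    push Not at hcon
    obtain ⟨z, hz⟩ := τ.nonempty_of_mem_parts hB
    have hzx : x ∈ B := hcon z hz ▸ hz
    have : B = B₀ := τ.eq_of_mem_parts hB hB₀ hzx hxB
    exact absurd (hcon y (this ▸ hyB)) hxy.ne'
  let τ₁ : Finpartition (s.filter (· < y)) := Finpartition.ofSubset τ
    (Finset.filter_subset (· ⊆ s.filter (· < y)) τ.parts) (by
      ext z
      simp only [Finset.sup_eq_biUnion, Finset.mem_biUnion, Finset.mem_filter, id]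
      constructor
      · rintro ⟨B, ⟨h1, h2⟩, h3⟩
        exact Finset.mem_filter.1 (h2 h3)
      · rintro ⟨hz, hzy⟩
        obtain ⟨B, hB, hzB⟩ := τ.exists_mem (Finset.mem_insert_of_mem hz)
        refine ⟨B, ⟨hB, ?_⟩, hzB⟩
        rcases hsub B hB with h | h
        · exact h
        · exact absurd (Finset.mem_filter.1 (h z hzB (hx z hz).ne')).2 (not_le.2 hzy))
  let τ₂ : Finpartition (s.filter (y ≤ ·)) := Finpartition.ofExistsUnique
    ((τ.parts.filter (¬ · ⊆ s.filter (· < y))).image (·.erase x))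
    (by
      intro D hD
      obtain ⟨B, hB, rfl⟩ := Finset.mem_image.1 hD
      obtain ⟨hB, hB'⟩ := Finset.mem_filter.1 hB
      intro z hz
      obtain ⟨h1, h2⟩ := Finset.mem_erase.1 hz
      exact ((hsub B hB).resolve_left hB') z h2 h1)
    (by
      intro z hz
      obtain ⟨hz1, hz2⟩ := Finset.mem_filter.1 hz
      obtain ⟨B, hB, hzB⟩ := τ.exists_mem (Finset.mem_insert_of_mem hz1)
      have hzx : z ≠ x := (hx z hz1).ne'
      refine ⟨B.erase x, ⟨Finset.mem_image_of_mem _ (Finset.mem_filter.2 ⟨hB, fun h =>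
        absurd (Finset.mem_filter.1 (h hzB)).2 (not_lt.2 hz2)⟩),
        Finset.mem_erase.2 ⟨hzx, hzB⟩⟩, ?_⟩
      rintro D ⟨hD, hzD⟩
      obtain ⟨D', hD', rfl⟩ := Finset.mem_image.1 hD
      rw [τ.eq_of_mem_parts (Finset.mem_filter.1 hD').1 hB (Finset.mem_erase.1 hzD).2 hzB])
    (by
      intro h
      obtain ⟨B, hB, h0⟩ := Finset.mem_image.1 h
      obtain ⟨hB, hB'⟩ := Finset.mem_filter.1 hB
      obtain ⟨z, hz, hzx⟩ := hup B hB hB'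
      have : z ∈ B.erase x := Finset.mem_erase.2 ⟨hzx, hz⟩
      rw [h0] at this
      simp at this)
  have hτ₁ : τ₁.parts = τ.parts.filter (· ⊆ s.filter (· < y)) := rfl
  have hτ₂ : τ₂.parts = (τ.parts.filter (¬ · ⊆ s.filter (· < y))).image (·.erase x) := rfl
  have hattach : ∀ B ∈ τ.parts, ¬ B ⊆ s.filter (· < y) → attach x y (B.erase x) = B := by
    intro B hB hB'
    ext z
    rw [mem_attach, Finset.mem_erase, Finset.mem_erase]
    by_cases hzx : z = x
    · subst hzx
      simp only [ne_eq, not_true_eq_false, false_and, true_and, false_or]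
      constructor
      · rintro ⟨_, h⟩
        rwa [τ.eq_of_mem_parts hB hB₀ h hyB]
      · intro h
        have : B = B₀ := τ.eq_of_mem_parts hB hB₀ h hxB
        exact ⟨hxy.ne', this ▸ hyB⟩
    · simp [hzx]
  refine ⟨τ₁, τ₂, ?_, ?_, ?_⟩
  · intro B hB D hD
    exact hτ B (Finset.mem_filter.1 hB).1 D (Finset.mem_filter.1 hD).1
  · intro B hB D hD a ha b hb c hc d hd hab hbc hcd
    obtain ⟨B', hB', rfl⟩ := Finset.mem_image.1 hB
    obtain ⟨D', hD', rfl⟩ := Finset.mem_image.1 hD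
    rw [hτ B' (Finset.mem_filter.1 hB').1 D' (Finset.mem_filter.1 hD').1 a
      (Finset.mem_of_mem_erase ha) b (Finset.mem_of_mem_erase hb) c (Finset.mem_of_mem_erase hc) d
      (Finset.mem_of_mem_erase hd) hab hbc hcd]
  · apply Finpartition.ext
    rw [gluePartition_parts, hτ₁, hτ₂]
    ext B
    simp only [Finset.mem_union, Finset.mem_filter, Finset.mem_image]
    constructor
    · rintro (⟨h, -⟩ | ⟨_, ⟨D, ⟨hD, hD'⟩, rfl⟩, rfl⟩)
      · exact h
      · rwa [hattach D hD hD']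
    · intro hB
      by_cases h : B ⊆ s.filter (· < y)
      · exact Or.inl ⟨hB, h⟩
      · exact Or.inr ⟨B.erase x, ⟨B, ⟨hB, h⟩, rfl⟩, hattach B hB h⟩

open scoped Classical in
-- The minimum condition says that y follows x in its block. Once x is removed, the block of y must
-- remember one more point, hence c + 1.
theorem sum_noncross_next (k : ℕ → ℝ) (c : ℕ) :
    ∑ τ : Finpartition (insert x s) with Noncross τ ∧ ((τ.part x).erase x).min = y,
      ∏ B ∈ τ.parts, k (B.card + if x ∈ B then c else 0) =
    ncSum k (s.filter (· < y)) * ncSumFrom k y (c + 1) (s.filter (y ≤ ·)) := by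
  have hxs : x ∉ s := fun h => lt_irrefl _ (hx x h)
  have hyC : y ∈ s.filter (y ≤ ·) := Finset.mem_filter.2 ⟨hy, le_rfl⟩
  rw [ncSum, ncSumFrom, Finset.sum_mul_sum]
  rw [← Finset.sum_product' (f := fun (τ₁ : Finpartition (s.filter (· < y)))
    (τ₂ : Finpartition (s.filter (y ≤ ·))) => (∏ B ∈ τ₁.parts, k B.card) *
      ∏ B ∈ τ₂.parts, k (B.card + if y ∈ B then c + 1 else 0))]
  symm
  refine Finset.sum_nbij (fun p => gluePartition hx hy p.1 p.2) ?_ ?_ ?_ ?_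
  · rintro ⟨τ₁, τ₂⟩ h
    simp only [Finset.mem_product, Finset.mem_filter, Finset.mem_univ, true_and] at h ⊢
    refine ⟨noncross_gluePartition hx hy h.1 h.2, ?_⟩
    obtain ⟨B, hB, hyB⟩ := τ₂.exists_mem hyC
    have hxB : x ∉ B := fun h => hxs (Finset.mem_filter.1 (τ₂.subset hB h)).1
    have hpart : (gluePartition hx hy τ₁ τ₂).part x = attach x y B := by
      apply Finpartition.part_eq_of_mem
      · rw [gluePartition_parts]
        exact Finset.mem_union_right _ (Finset.mem_image_of_mem _ hB)
      · exact mem_attach.2 (Or.inr ⟨rfl, hyB⟩)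
    rw [hpart, attach_erase hxB]
    refine le_antisymm (Finset.min_le hyB) (Finset.le_min fun z hz => ?_)
    exact WithTop.coe_le_coe.2 (Finset.mem_filter.1 (τ₂.subset hB hz)).2
  · rintro ⟨τ₁, τ₂⟩ _ ⟨τ₁', τ₂'⟩ _ h
    simp only at h
    obtain ⟨a1, a2⟩ := parts_of_gluePartition hx hy τ₁ τ₂
    obtain ⟨b1, b2⟩ := parts_of_gluePartition hx hy τ₁' τ₂'
    rw [h, ← b1] at a1
    rw [h, ← b2] at a2
    rw [Finpartition.ext a1, Finpartition.ext a2]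
  · intro τ hτ
    simp only [Finset.coe_filter, Finset.mem_univ, true_and, Set.mem_ofPred_eq] at hτ
    have hxi : x ∈ insert x s := Finset.mem_insert_self _ _
    have hyB := Finset.mem_of_min hτ.2
    obtain ⟨τ₁, τ₂, h1, h2, h3⟩ := exists_gluePartition hx hy hτ.1 (τ.part_mem.2 hxi)
      (τ.mem_part_self.2 hxi) (Finset.mem_of_mem_erase hyB)
      (fun z hz hzx => WithTop.coe_le_coe.1 (hτ.2 ▸ Finset.min_le (Finset.mem_erase.2 ⟨hzx, hz⟩)))
    refine ⟨(τ₁, τ₂), ?_, h3⟩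
    simp [h1, h2]
  · rintro ⟨τ₁, τ₂⟩ -
    have hx1 : ∀ B ∈ τ₁.parts, x ∉ B := fun B hB h =>
      hxs (Finset.mem_filter.1 (τ₁.subset hB h)).1
    have hx2 : ∀ B ∈ τ₂.parts, x ∉ B := fun B hB h =>
      hxs (Finset.mem_filter.1 (τ₂.subset hB h)).1
    simp only
    rw [gluePartition_parts, Finset.prod_union, Finset.prod_image]
    · congr 1
      · refine Finset.prod_congr rfl fun B hB => ?_
        simp [hx1 B hB]
      · refine Finset.prod_congr rfl fun B hB => ?_
        unfold attach
        split_ifs with h1 h2 h2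
        · rw [Finset.card_insert_of_notMem (hx2 B hB)]
          congr 1; ring
        · exact (h2 (Finset.mem_insert_self _ _)).elim
        · exact (hx2 B hB h2).elim
        · rfl
    · intro B hB D hD h
      have := congrArg (·.erase x) h
      simpa only [attach_erase (hx2 B hB), attach_erase (hx2 D hD)] using this
    · rw [Finset.disjoint_left]
      intro B hB hB'
      obtain ⟨D, hD, rfl⟩ := Finset.mem_image.1 hB'
      obtain ⟨z, hz⟩ := τ₂.nonempty_of_mem_parts hD
      have h1 := (Finset.mem_filter.1 (τ₁.subset hB (mem_attach.2 (Or.inl hz)))).2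
      exact absurd (Finset.mem_filter.1 (τ₂.subset hD hz)).2 (not_le.2 h1)

end Glue

open scoped Classical in
theorem ncSumFrom_insert (hx : ∀ z ∈ s, x < z) (k : ℕ → ℝ) (c : ℕ) :
    ncSumFrom k x c (insert x s) = k (1 + c) * ncSum k s +
      ∑ y ∈ s, ncSum k (s.filter (· < y)) * ncSumFrom k y (c + 1) (s.filter (y ≤ ·)) := by
  have hxs : x ∉ s := fun h => lt_irrefl _ (hx x h)
  have hxi : x ∈ insert x s := Finset.mem_insert_self _ _
  rw [ncSumFrom, ← sum_noncross_singleton hxs]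
  -- Sort by the successor of x in its block; the value ⊤ stands for a singleton block.
  rw [← Finset.sum_fiberwise_of_maps_to (t := insert (⊤ : WithTop X) (s.map ⟨_, WithTop.coe_injective⟩))
    (g := fun τ : Finpartition (insert x s) => ((τ.part x).erase x).min)]
  · rw [Finset.sum_insert (by simp)]
    congr 1
    · rw [Finset.filter_filter]
      refine Finset.sum_congr (Finset.filter_congr fun τ _ => and_congr_right fun _ => ?_)
        fun _ _ => rfl
      rw [Finset.min_eq_top]
      constructor
      · intro h
        have h1 : τ.part x = {x} := by
          rw [← Finset.insert_erase (τ.mem_part_self.2 hxi), h]; rfl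
        rw [← h1]
        exact τ.part_mem.2 hxi
      · intro h
        rw [τ.part_eq_of_mem h (Finset.mem_singleton_self x)]
        simp
    · rw [Finset.sum_map]
      refine Finset.sum_congr rfl fun y hy => ?_
      rw [Finset.filter_filter, ← sum_noncross_next hx hy]
      rfl
  · intro τ _
    rw [Finset.mem_insert, Finset.mem_map]
    rcases ((τ.part x).erase x).eq_empty_or_nonempty with h | h
    · left; rw [h, Finset.min_empty]
    · right
      refine ⟨((τ.part x).erase x).min' h, ?_, Finset.coe_min' h⟩
      obtain ⟨h1, h2⟩ := Finset.mem_erase.1 (Finset.min'_mem _ h)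
      exact Finset.mem_of_mem_insert_of_ne (τ.part_subset x h2) h1

end Noncrossing

/-! ### Noncrossing sums solve the moment recursion -/

section NoncrossingMoments

variable {X : Type*} [LinearOrder X]

/-- The rank of an element is a bijection from s onto an initial segment of ℕ. -/
theorem sum_card_filter_lt {R : Type*} [AddCommMonoid R] (s : Finset X) (f : ℕ → R) :
    ∑ y ∈ s, f (s.filter (· < y)).card = ∑ i ∈ Finset.range s.card, f i := by
  have hmem : ∀ y ∈ s, (s.filter (· < y)).card ∈ Finset.range s.card := fun y hy =>
    Finset.mem_range.2 (Finset.card_lt_card (Finset.filter_ssubset.2 ⟨y, hy, lt_irrefl y⟩))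
  have hlt : ∀ y ∈ s, ∀ z ∈ s, y < z → (s.filter (· < y)).card < (s.filter (· < z)).card := by
    intro y hy z _ hyz
    apply Finset.card_lt_card
    refine Finset.ssubset_iff_subset_ne.2 ⟨fun w hw => ?_, fun h => ?_⟩
    · obtain ⟨h1, h2⟩ := Finset.mem_filter.1 hw
      exact Finset.mem_filter.2 ⟨h1, h2.trans hyz⟩
    · have : y ∈ s.filter (· < y) := h ▸ Finset.mem_filter.2 ⟨hy, hyz⟩
      exact lt_irrefl _ (Finset.mem_filter.1 this).2
  have hinj : Set.InjOn (fun y => (s.filter (· < y)).card) (s : Set X) := by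
    intro y hy z hz h
    rcases lt_trichotomy y z with h1 | h1 | h1
    · exact absurd h (hlt y hy z hz h1).ne
    · exact h1
    · exact absurd h (hlt z hz y hy h1).ne'
  refine Finset.sum_nbij (fun y => (s.filter (· < y)).card) hmem hinj ?_ fun _ _ => rfl
  exact Finset.surjOn_of_injOn_of_card_le _ hmem hinj (by simp)

theorem ncSum_eq {b d : ℝ} {M P Q : ℕ → ℝ} (hM : MomentRecursion b d M P Q) (s : Finset X) :
    ncSum (fun r => if Even r then d else b) s = M s.card := by
  set k : ℕ → ℝ := fun r => if Even r then d else b with hk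
  have hk1 : ∀ c, k (1 + c) = if Even c then b else d := fun c => by
    simp only [hk]
    by_cases h : Even c <;> simp [h, Nat.even_add]
  -- The weights see only parity, so the extra count c matters modulo 2: even c gives P and odd c
  -- gives Q.
  suffices H : ∀ n, (∀ s : Finset X, s.card = n → ncSum k s = M n) ∧
      ∀ (x : X) (s : Finset X) (c : ℕ), (∀ z ∈ s, x < z) → s.card = n →
        ncSumFrom k x c (insert x s) = if Even c then P n else Q n from (H _).1 s rfl
  intro n
  induction n using Nat.strong_induction_on with
  | _ n ih =>
    have h1 : ∀ s : Finset X, s.card = n → ncSum k s = M n := by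
      intro s hs
      rcases s.eq_empty_or_nonempty with rfl | hne
      · subst hs; rw [ncSum_empty, Finset.card_empty, hM.zero]
      · have hx := s.min'_mem hne
        have hc : (s.erase (s.min' hne)).card + 1 = n := by
          rw [Finset.card_erase_add_one hx, hs]
        rw [← ncSumFrom_zero k (s.min' hne) s, ← hc, hM.succ]
        have := (ih _ (by omega)).2 (s.min' hne) (s.erase (s.min' hne)) 0
          (fun z hz => s.min'_lt_of_mem_erase_min' hne hz) rfl
        rw [Finset.insert_erase hx] at this
        rw [this]; simp
    refine ⟨h1, fun x s c hx hs => ?_⟩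
    rw [ncSumFrom_insert hx, h1 s hs, hk1]
    have hstep : ∀ y ∈ s, ncSum k (s.filter (· < y)) * ncSumFrom k y (c + 1) (s.filter (y ≤ ·)) =
        (fun i => M i * if Even c then Q (n - 1 - i) else P (n - 1 - i))
          (s.filter (· < y)).card := by
      intro y hy
      obtain ⟨T, hT⟩ : ∃ T, T = s.filter (y < ·) := ⟨_, rfl⟩
      have e : s.filter (y ≤ ·) = insert y T := by
        ext z
        simp only [hT, Finset.mem_filter, Finset.mem_insert, le_iff_lt_or_eq]
        constructor
        · rintro ⟨h, h' | rfl⟩ <;> tauto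
        · rintro (rfl | h) <;> tauto
      have hcard : (s.filter (· < y)).card + T.card + 1 = n := by
        have h2 := Finset.card_filter_add_card_filter_not (s := s) (· < y)
        simp only [not_lt] at h2
        rw [e, Finset.card_insert_of_notMem (by simp [hT])] at h2
        omega
      have e2 : T.card = n - 1 - (s.filter (· < y)).card := by omega
      rw [e, (ih _ (by omega)).1 _ rfl, (ih _ (by omega)).2 y T (c + 1)
        (fun z hz => (Finset.mem_filter.1 (hT ▸ hz)).2) rfl, e2]
      by_cases h : Even c <;> simp [h, Nat.even_add_one]
    rw [Finset.sum_congr rfl hstep, sum_card_filter_lt s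
      (fun i => M i * if Even c then Q (n - 1 - i) else P (n - 1 - i)), hs]
    by_cases h : Even c
    · simp only [h, if_true]; rw [hM.odd]
    · simp only [h, if_false]; rw [hM.even]

end NoncrossingMoments

theorem sum_isNoncrossing_eq {b d : ℝ} {M P Q : ℕ → ℝ} (hM : MomentRecursion b d M P Q) (p : ℕ) :
    ∑ τ : Finpartition (Finset.univ : Finset (Fin p)) with RandomState.IsNoncrossing τ,
      ∏ B ∈ τ.parts, (if Even B.card then d else b) = M p := by
  have := ncSum_eq hM (Finset.univ : Finset (Fin p))
  rw [Finset.card_univ, Fintype.card_fin] at this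
  rw [← this, ncSum]
  refine Finset.sum_congr ?_ fun _ _ => rfl
  ext τ
  simp only [Finset.mem_filter, Finset.mem_univ, true_and]
  rfl

/-! ### Free Poisson elements on the full Fock space -/

noncomputable section FockSpace

open ContinuousLinearMap

variable {H : Type*} [NormedAddCommGroup H] [InnerProductSpace ℂ H] [CompleteSpace H]

theorem clm_mul_apply (A B : H →L[ℂ] H) (x : H) : (A * B) x = A (B x) := rfl

theorem clm_one_apply (x : H) : (1 : H →L[ℂ] H) x = x := rfl

section Pushforward

variable {ι : Type*} (e : HilbertBasis ι ℂ H)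

theorem HilbertBasis.inner_eq_ite [DecidableEq ι] (i j : ι) :
    inner ℂ (e i) (e j) = if i = j then (1 : ℂ) else 0 :=
  orthonormal_iff_ite.1 e.orthonormal i j

theorem HilbertBasis.ext_inner {x y : H} (h : ∀ i, inner ℂ (e i) x = inner ℂ (e i) y) : x = y := by
  apply e.repr.injective
  ext i
  rw [e.repr_apply_apply, e.repr_apply_apply, h]

theorem HilbertBasis.hasSum_inner_apply (e : HilbertBasis ι ℂ H) (A : H →L[ℂ] H) (x y : H) :
    HasSum (fun i => inner ℂ (e i) x * inner ℂ y (A (e i))) (inner ℂ y (A x)) := by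
  have h := ((innerSL ℂ y).comp A).hasSum (e.hasSum_repr x)
  simpa [e.repr_apply_apply] using h

theorem HilbertBasis.ext_clm {A B : H →L[ℂ] H} (h : ∀ i, A (e i) = B (e i)) : A = B := by
  ext x
  apply e.ext_inner
  intro j
  refine (e.hasSum_inner_apply A x (e j)).unique ?_
  simpa only [h] using e.hasSum_inner_apply B x (e j)

/-- The isometry mapping the basis vector of index `w` to that of index `f w`. -/
def pushforward (f : ι → ι) (hf : Function.Injective f) : H →L[ℂ] H :=
  ((e.orthonormal.comp f hf).orthogonalFamily.linearIsometry.comp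
    e.repr.toLinearIsometry).toContinuousLinearMap

theorem pushforward_apply (f : ι → ι) (hf : Function.Injective f) (w : ι) :
    pushforward e f hf (e w) = e (f w) := by
  classical
  have : pushforward e f hf (e w)
    = (e.orthonormal.comp f hf).orthogonalFamily.linearIsometry (e.repr (e w)) := rfl
  rw [this, e.repr_self, OrthogonalFamily.linearIsometry_apply_single]
  simp

theorem inner_pushforward (f : ι → ι) (hf : Function.Injective f) (x y : H) :
    inner ℂ (pushforward e f hf x) (pushforward e f hf y) = inner ℂ x y :=
  ((e.orthonormal.comp f hf).orthogonalFamily.linearIsometry.comp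
    e.repr.toLinearIsometry).inner_map_map x y

theorem adjoint_pushforward_pushforward (f : ι → ι) (hf : Function.Injective f) (x : H) :
    (pushforward e f hf).adjoint (pushforward e f hf x) = x := by
  apply ext_inner_left ℂ
  intro y
  rw [adjoint_inner_right, inner_pushforward]

theorem adjoint_pushforward_apply (f : ι → ι) (hf : Function.Injective f) (w : ι) :
    (pushforward e f hf).adjoint (e (f w)) = e w := by
  rw [← pushforward_apply e f hf, adjoint_pushforward_pushforward]

theorem adjoint_pushforward_of_notMem (f : ι → ι) (hf : Function.Injective f) {w : ι}
    (hw : ∀ u, f u ≠ w) : (pushforward e f hf).adjoint (e w) = 0 := by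
  classical
  apply e.ext_inner
  intro i
  rw [adjoint_inner_right, pushforward_apply, inner_zero_right, e.inner_eq_ite, if_neg (hw i)]

end Pushforward

variable (e : HilbertBasis (List Bool) ℂ H)

/-- The left creation operator. -/
def leftCreation (i : Bool) : H →L[ℂ] H := pushforward e (i :: ·) (List.cons_injective)

/-- The right concatenation operator. -/
def rightConcat (w : List Bool) : H →L[ℂ] H :=
  pushforward e (· ++ w) (List.append_left_injective w)

theorem leftCreation_apply (i : Bool) (w : List Bool) : leftCreation e i (e w) = e (i :: w) :=
  pushforward_apply e _ _ _

theorem rightConcat_apply (w u : List Bool) : rightConcat e w (e u) = e (u ++ w) :=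
  pushforward_apply e _ _ _

theorem adjoint_leftCreation_cons (i j : Bool) (w : List Bool) :
    (leftCreation e i).adjoint (e (j :: w)) = if i = j then e w else 0 := by
  split_ifs with h
  · subst h; exact adjoint_pushforward_apply e _ _ _
  · exact adjoint_pushforward_of_notMem e _ _ fun u hu => h (List.cons.inj hu).1

theorem adjoint_leftCreation_nil (i : Bool) : (leftCreation e i).adjoint (e []) = 0 :=
  adjoint_pushforward_of_notMem e _ _ fun u hu => by simp at hu

theorem leftCreation_mul_rightConcat (i : Bool) (w : List Bool) :
    leftCreation e i * rightConcat e w = rightConcat e w * leftCreation e i := by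
  apply e.ext_clm
  intro u
  simp [rightConcat_apply, leftCreation_apply]

/-- Removing a first letter and appending a suffix interact only on the empty word, where the
removal would act on w itself. -/
theorem adjoint_leftCreation_mul_rightConcat {i : Bool} {w : List Bool} (hw : ∀ u, w ≠ i :: u) :
    (leftCreation e i).adjoint * rightConcat e w
      = rightConcat e w * (leftCreation e i).adjoint := by
  apply e.ext_clm
  intro u
  simp only [clm_mul_apply, rightConcat_apply]
  cases u with
  | nil =>
    rw [adjoint_leftCreation_nil, map_zero, List.nil_append]
    cases w with
    | nil => rw [adjoint_leftCreation_nil]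
    | cons j w =>
      rw [adjoint_leftCreation_cons, if_neg]
      rintro rfl
      exact hw w rfl
  | cons j u =>
    rw [List.cons_append, adjoint_leftCreation_cons, adjoint_leftCreation_cons]
    split_ifs
    · rw [rightConcat_apply]
    · rw [map_zero]

/-- The commutator with appending one letter is a rank one operator supported on the vacuum. It is
the source of the recursion for moments. -/
theorem adjoint_leftCreation_rightConcat (i j : Bool) (x : H) :
    (leftCreation e i).adjoint (rightConcat e [j] x) =
      rightConcat e [j] ((leftCreation e i).adjoint x) +
        if i = j then inner ℂ (e []) x • e [] else 0 := by
  have : (leftCreation e i).adjoint * rightConcat e [j] =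
      rightConcat e [j] * (leftCreation e i).adjoint +
        if i = j then (innerSL ℂ (e [])).smulRight (e []) else 0 := by
    apply e.ext_clm
    intro u
    simp only [clm_mul_apply, rightConcat_apply, add_apply]
    cases u with
    | nil =>
      rw [adjoint_leftCreation_nil, List.nil_append, adjoint_leftCreation_cons, map_zero]
      have : inner ℂ (e []) (e []) = (1 : ℂ) := by rw [e.inner_eq_ite]; simp
      split_ifs
      · rw [smulRight_apply, innerSL_apply_apply, this]; simp
      · simp
    | cons k u =>
      rw [List.cons_append, adjoint_leftCreation_cons, adjoint_leftCreation_cons]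
      have : inner ℂ (e []) (e (k :: u)) = (0 : ℂ) := by rw [e.inner_eq_ite]; simp
      split_ifs <;> simp [this, rightConcat_apply]
  have h := congrArg (fun A : H →L[ℂ] H => A x) this
  simp only [clm_mul_apply, add_apply] at h
  rw [h]
  split_ifs <;> simp

/-- The translated creation operator, with `V V*` free Poisson of rate `r ^ 2`. -/
def shiftedCreation (i : Bool) (r : ℝ) : H →L[ℂ] H := leftCreation e i + (r : ℂ) • 1

/-- The free Poisson element of rate `r ^ 2` on the full Fock space. -/
def poissonOp (i : Bool) (r : ℝ) : H →L[ℂ] H :=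
  shiftedCreation e i r * (shiftedCreation e i r).adjoint

theorem adjoint_shiftedCreation (i : Bool) (r : ℝ) :
    (shiftedCreation e i r).adjoint = (leftCreation e i).adjoint + (r : ℂ) • 1 := by
  rw [shiftedCreation, map_add, map_smulₛₗ, ← star_eq_adjoint (1 : H →L[ℂ] H), star_one]
  simp

theorem isSelfAdjoint_poissonOp (i : Bool) (r : ℝ) : IsSelfAdjoint (poissonOp e i r) := by
  rw [poissonOp, ← star_eq_adjoint]
  exact IsSelfAdjoint.mul_star_self _

theorem shiftedCreation_rightConcat (i : Bool) (r : ℝ) (w : List Bool) (x : H) :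
    shiftedCreation e i r (rightConcat e w x) = rightConcat e w (shiftedCreation e i r x) := by
  have h := congrArg (fun A : H →L[ℂ] H => A x) (leftCreation_mul_rightConcat e i w)
  simp only [clm_mul_apply] at h
  simp [shiftedCreation, h]

theorem poissonOp_rightConcat_singleton (i j : Bool) (r : ℝ) (x : H) :
    poissonOp e i r (rightConcat e [j] x) = rightConcat e [j] (poissonOp e i r x) +
      if i = j then inner ℂ (e []) x • (rightConcat e [i] (e []) + (r : ℂ) • e []) else 0 := by
  rw [poissonOp, clm_mul_apply, clm_mul_apply, adjoint_shiftedCreation]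
  simp only [add_apply, smul_apply, clm_one_apply]
  rw [adjoint_leftCreation_rightConcat]
  have : shiftedCreation e i r (e []) = rightConcat e [i] (e []) + (r : ℂ) • e [] := by
    simp [shiftedCreation, leftCreation_apply, rightConcat_apply]
  split_ifs
  · rw [← this, ← map_smul (shiftedCreation e i r), ← shiftedCreation_rightConcat,
      ← map_add (shiftedCreation e i r)]
    congr 1
    rw [map_add, map_smul (rightConcat e [j])]
    abel
  · rw [← shiftedCreation_rightConcat, map_add (rightConcat e [j]), map_smul]
    simp

theorem poissonOp_vacuum (i : Bool) (r : ℝ) :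
    poissonOp e i r (e []) = (r : ℂ) • (rightConcat e [i] (e []) + (r : ℂ) • e []) := by
  rw [poissonOp, clm_mul_apply, adjoint_shiftedCreation]
  simp [adjoint_leftCreation_nil, shiftedCreation, leftCreation_apply, rightConcat_apply]

/-- The vacuum state. -/
def vacuumState : (H →L[ℂ] H) →ₗ[ℂ] ℂ where
  toFun A := inner ℂ (e []) (A (e []))
  map_add' A B := by simp
  map_smul' c A := by simp

theorem vacuumState_apply (A : H →L[ℂ] H) : vacuumState e A = inner ℂ (e []) (A (e [])) := rfl

theorem isState_vacuumState : RandomState.IsState (A := H →L[ℂ] H) (vacuumState e) := by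
  constructor
  · rw [vacuumState_apply, clm_one_apply, e.inner_eq_ite]; simp
  · intro a
    rw [vacuumState_apply, clm_mul_apply, star_eq_adjoint, adjoint_inner_right]
    exact Complex.nonneg_iff.2 ⟨inner_self_nonneg (𝕜 := ℂ), (inner_self_im (𝕜 := ℂ) _).symm⟩

/-! #### Freeness -/

/-- The generator commutes with appending w as soon as w does not start with i, and a centralizer is
a subalgebra. -/
theorem adjoin_commute_rightConcat {i : Bool} {r : ℝ} {w : List Bool} (hw : ∀ u, w ≠ i :: u)
    {a : H →L[ℂ] H} (ha : a ∈ Algebra.adjoin ℂ {poissonOp e i r}) :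
    a * rightConcat e w = rightConcat e w * a := by
  have h1 : poissonOp e i r ∈ Subalgebra.centralizer ℂ {rightConcat e w} := by
    rw [Subalgebra.mem_centralizer_iff]
    intro g hg
    rw [Set.mem_singleton_iff] at hg
    subst hg
    have e1 := leftCreation_mul_rightConcat e i w
    have e2 := adjoint_leftCreation_mul_rightConcat e hw
    rw [poissonOp, adjoint_shiftedCreation, shiftedCreation]
    have e3 : rightConcat e w * (leftCreation e i + (r : ℂ) • 1)
        = (leftCreation e i + (r : ℂ) • 1) * rightConcat e w := by
      rw [mul_add, add_mul, e1]; simp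
    have e4 : rightConcat e w * ((leftCreation e i).adjoint + (r : ℂ) • 1)
        = ((leftCreation e i).adjoint + (r : ℂ) • 1) * rightConcat e w := by
      rw [mul_add, add_mul, e2]; simp
    rw [← mul_assoc, e3, mul_assoc, e4, mul_assoc]
  have h2 : Algebra.adjoin ℂ {poissonOp e i r} ≤ Subalgebra.centralizer ℂ {rightConcat e w} :=
    Algebra.adjoin_le (Set.singleton_subset_iff.2 h1)
  exact ((Subalgebra.mem_centralizer_iff ℂ).1 (h2 ha) _ rfl).symm

/-- The vectors whose coordinates vanish off the set `S` of words. -/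
def supportedOn (S : Set (List Bool)) : Submodule ℂ H where
  carrier := {x | ∀ w, w ∉ S → inner ℂ (e w) x = (0 : ℂ)}
  add_mem' hx hy w hw := by rw [inner_add_right, hx w hw, hy w hw, add_zero]
  zero_mem' w _ := inner_zero_right _
  smul_mem' c x hx w hw := by rw [inner_smul_right, hx w hw, mul_zero]

theorem basis_mem_supportedOn {S : Set (List Bool)} {w : List Bool} (hw : w ∈ S) :
    e w ∈ supportedOn e S := fun u hu => by
  rw [e.inner_eq_ite, if_neg]
  rintro rfl
  exact hu hw

theorem map_mem_supportedOn {S S' : Set (List Bool)} (A : H →L[ℂ] H)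
    (hA : ∀ w ∈ S, A (e w) ∈ supportedOn e S') {x : H} (hx : x ∈ supportedOn e S) :
    A x ∈ supportedOn e S' := by
  intro v hv
  refine (e.hasSum_inner_apply A x (e v)).unique ?_
  convert! hasSum_zero using 2 with w
  by_cases hw : w ∈ S
  · rw [hA w hw v hv, mul_zero]
  · rw [hx w hw, zero_mul]

theorem adjoin_vacuum_mem {i : Bool} {r : ℝ} {a : H →L[ℂ] H}
    (ha : a ∈ Algebra.adjoin ℂ {poissonOp e i r}) :
    a (e []) ∈ supportedOn e {w | ∀ j ∈ w, j = i} := by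
  set K := supportedOn e {w | ∀ j ∈ w, j = i} with hK
  have h1 : ∀ x ∈ K, leftCreation e i x ∈ K := fun x hx =>
    map_mem_supportedOn e _ (fun w hw => by
      rw [leftCreation_apply]
      apply basis_mem_supportedOn
      intro j hj
      rcases List.mem_cons.1 hj with rfl | hj
      · rfl
      · exact hw j hj) hx
  have h2 : ∀ x ∈ K, (leftCreation e i).adjoint x ∈ K := fun x hx =>
    map_mem_supportedOn e _ (fun w hw => by
      cases w with
      | nil => rw [adjoint_leftCreation_nil]; exact Submodule.zero_mem _
      | cons j w =>
        rw [adjoint_leftCreation_cons]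
        split_ifs
        · exact basis_mem_supportedOn e fun k hk => hw k (List.mem_cons_of_mem _ hk)
        · exact Submodule.zero_mem _) hx
  have h3 : ∀ x ∈ K, poissonOp e i r x ∈ K := fun x hx => by
    rw [poissonOp, clm_mul_apply, adjoint_shiftedCreation, shiftedCreation]
    simp only [add_apply, smul_apply, clm_one_apply]
    have h4 : (leftCreation e i).adjoint x + (r : ℂ) • x ∈ K :=
      K.add_mem (h2 x hx) (K.smul_mem _ hx)
    exact K.add_mem (h1 _ h4) (K.smul_mem _ h4)
  have h4 : ∀ x ∈ K, a x ∈ K := by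
    induction ha using Algebra.adjoin_induction with
    | mem b hb => rw [Set.mem_singleton_iff] at hb; subst hb; exact h3
    | algebraMap c => intro x hx; exact K.smul_mem c hx
    | add b c _ _ hb hc => intro x hx; exact K.add_mem (hb x hx) (hc x hx)
    | mul b c _ _ hb hc => intro x hx; exact hb _ (hc x hx)
  exact h4 _ (basis_mem_supportedOn e (by simp))

/-- A vector on words in the letter i without vacuum component lives on nonempty words, which
therefore start with i. -/
theorem rightConcat_mem_supportedOn {i : Bool} {x : H}
    (hx : x ∈ supportedOn e {w | ∀ j ∈ w, j = i}) (h0 : inner ℂ (e []) x = (0 : ℂ))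
    (w : List Bool) : rightConcat e w x ∈ supportedOn e {u | ∃ v, u = i :: v} := by
  refine map_mem_supportedOn e (S := {w | w ≠ [] ∧ ∀ j ∈ w, j = i}) _ (fun u hu => ?_) ?_
  · rw [rightConcat_apply]
    apply basis_mem_supportedOn
    cases u with
    | nil => exact absurd rfl hu.1
    | cons j u => exact ⟨u ++ w, by rw [hu.2 j (by simp)]; rfl⟩
  · intro u hu
    by_cases h : u = []
    · rw [h, h0]
    · exact hx u fun h' => hu ⟨h, h'⟩

/-- An alternating product of centered elements sends the vacuum into words starting with the letter
of its first factor. Indeed a factor a of letter i meets words v starting with the other letter, on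
which it acts as a applied to the vacuum followed by appending v; being centered, it leaves no
vacuum component. -/
theorem freePair_poissonOp (r₁ r₂ : ℝ) : RandomState.FreePair (A := H →L[ℂ] H) (vacuumState e)
    (poissonOp e true r₁) (poissonOp e false r₂) := by
  set X : Bool → H →L[ℂ] H := fun i => poissonOp e i (cond i r₁ r₂) with hX
  have hXc : ∀ i : Bool, cond i (poissonOp e true r₁) (poissonOp e false r₂) = X i := fun i => by
    cases i <;> rfl
  intro w hw hchain hmem
  suffices H : ∀ (w : List (Bool × (H →L[ℂ] H))) (i : Bool) (a : H →L[ℂ] H),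
      ((i, a) :: w).IsChain (fun x y => x.1 ≠ y.1) →
      (∀ x ∈ (i, a) :: w, x.2 ∈ Algebra.adjoin ℂ {X x.1} ∧ vacuumState e x.2 = 0) →
      ((((i, a) :: w).map Prod.snd).prod) (e []) ∈ supportedOn e {u | ∃ v, u = i :: v} by
    cases w with
    | nil => exact absurd rfl hw
    | cons p w =>
      rw [vacuumState_apply]
      refine H w p.1 p.2 hchain (fun x hx => ?_) [] (by simp)
      obtain ⟨h1, h2⟩ := hmem x hx
      simp only [hXc] at h1
      exact ⟨h1, h2⟩
  intro w
  induction w with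
  | nil =>
    intro i a _ h
    obtain ⟨h1, h2⟩ := h (i, a) (by simp)
    have := rightConcat_mem_supportedOn e (adjoin_vacuum_mem e h1) h2 []
    have h3 := adjoin_commute_rightConcat e (w := []) (by simp) h1
    have h4 := congrArg (fun A : H →L[ℂ] H => A (e [])) h3
    simp only [clm_mul_apply, rightConcat_apply, List.append_nil] at h4
    have h5 : (((i, a) :: []).map Prod.snd).prod (e []) = a (e []) := by simp
    rwa [h5, h4]
  | cons p w ih =>
    intro i a hc h
    obtain ⟨h1, h2⟩ := h (i, a) (by simp)
    have hc' := List.isChain_cons_cons.1 hc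
    have hrest := ih p.1 p.2 hc'.2 (fun x hx => h x (List.mem_cons_of_mem _ hx))
    have e1 : ((((i, a) :: p :: w).map Prod.snd).prod) (e []) =
        a ((((p.1, p.2) :: w).map Prod.snd).prod (e [])) := by
      simp
    rw [e1]
    refine map_mem_supportedOn e a ?_ hrest
    rintro _ ⟨v, rfl⟩
    have h3 := adjoin_commute_rightConcat e (w := p.1 :: v) (fun u hu => by
      have := (List.cons.inj hu).1
      exact hc'.1 this.symm) h1
    have h4 := congrArg (fun A : H →L[ℂ] H => A (e [])) h3
    simp only [clm_mul_apply, rightConcat_apply, List.nil_append] at h4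
    rw [h4]
    exact rightConcat_mem_supportedOn e (adjoin_vacuum_mem e h1) h2 _

/-! #### Moments of the difference -/

/-- The moments of a free difference, and the coefficients of the decomposition of the vectors
`(X - Y) ^ p Ω` by their last letter. -/
def diffCoeff (r₁ r₂ : ℝ) : ℕ → ℝ × ℝ × ℝ
  | 0 => (1, r₁, -r₂)
  | p + 1 =>
    let μ := r₁ * (diffCoeff r₁ r₂ p).2.1 + r₂ * (diffCoeff r₁ r₂ p).2.2
    (μ, r₁ * μ + ∑ i : Fin (p + 1), (diffCoeff r₁ r₂ i).2.1 * (diffCoeff r₁ r₂ (p - i)).1,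
      -r₂ * μ - ∑ i : Fin (p + 1), (diffCoeff r₁ r₂ i).2.2 * (diffCoeff r₁ r₂ (p - i)).1)
termination_by p => p
decreasing_by all_goals omega

/-- The moments of a free difference of free Poisson elements. -/
def diffMoment (r₁ r₂ : ℝ) (p : ℕ) : ℝ := (diffCoeff r₁ r₂ p).1

theorem diffMoment_zero (r₁ r₂ : ℝ) : diffMoment r₁ r₂ 0 = 1 := by
  rw [diffMoment, diffCoeff]

theorem diffMoment_succ (r₁ r₂ : ℝ) (p : ℕ) : diffMoment r₁ r₂ (p + 1) =
    r₁ * (diffCoeff r₁ r₂ p).2.1 + r₂ * (diffCoeff r₁ r₂ p).2.2 := by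
  rw [diffMoment, diffCoeff]

theorem diffCoeff_left (r₁ r₂ : ℝ) (p : ℕ) : (diffCoeff r₁ r₂ p).2.1 = r₁ * diffMoment r₁ r₂ p +
    ∑ i ∈ Finset.range p, (diffCoeff r₁ r₂ i).2.1 * diffMoment r₁ r₂ (p - 1 - i) := by
  cases p with
  | zero => rw [diffMoment_zero, diffCoeff]; simp
  | succ p => rw [diffMoment_succ, diffCoeff, Finset.sum_range]; rfl

theorem diffCoeff_right (r₁ r₂ : ℝ) (p : ℕ) : (diffCoeff r₁ r₂ p).2.2 = -r₂ * diffMoment r₁ r₂ p -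
    ∑ i ∈ Finset.range p, (diffCoeff r₁ r₂ i).2.2 * diffMoment r₁ r₂ (p - 1 - i) := by
  cases p with
  | zero => rw [diffMoment_zero, diffCoeff]; simp
  | succ p => rw [diffMoment_succ, diffCoeff, Finset.sum_range]; rfl

/-- If u and v are the two coefficients of `diffCoeff`, then P = r₁ u + r₂ v and Q = r₁ u - r₂ v.
The minus sign in front of Y swaps these two combinations at each step, which produces the
alternation between the weights r₁² - r₂² and r₁² + r₂². -/
theorem momentRecursion_diffMoment (r₁ r₂ : ℝ) : MomentRecursion (r₁ ^ 2 - r₂ ^ 2) (r₁ ^ 2 + r₂ ^ 2)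
    (diffMoment r₁ r₂) (fun p => diffMoment r₁ r₂ (p + 1))
    (fun p => r₁ * (diffCoeff r₁ r₂ p).2.1 - r₂ * (diffCoeff r₁ r₂ p).2.2) where
  zero := diffMoment_zero _ _
  succ _ := rfl
  odd p := by
    rw [diffMoment_succ, diffCoeff_left, diffCoeff_right, ← Finset.sum_range_reflect
      (fun i => diffMoment r₁ r₂ i * _)]
    rw [mul_add, Finset.mul_sum, mul_sub, Finset.mul_sum]
    have : ∑ i ∈ Finset.range p, diffMoment r₁ r₂ (p - 1 - i) *
        (r₁ * (diffCoeff r₁ r₂ (p - 1 - (p - 1 - i))).2.1 -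
          r₂ * (diffCoeff r₁ r₂ (p - 1 - (p - 1 - i))).2.2) =
        ∑ i ∈ Finset.range p, (r₁ * ((diffCoeff r₁ r₂ i).2.1 * diffMoment r₁ r₂ (p - 1 - i)) -
          r₂ * ((diffCoeff r₁ r₂ i).2.2 * diffMoment r₁ r₂ (p - 1 - i))) := by
      refine Finset.sum_congr rfl fun i hi => ?_
      have : p - 1 - (p - 1 - i) = i := by have := Finset.mem_range.1 hi; omega
      rw [this]; ring
    rw [this, Finset.sum_sub_distrib]
    ring
  even p := by
    rw [diffCoeff_left, diffCoeff_right, ← Finset.sum_range_reflect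
      (fun i => diffMoment r₁ r₂ i * _)]
    rw [mul_add, Finset.mul_sum, mul_sub, Finset.mul_sum]
    have : ∑ i ∈ Finset.range p, diffMoment r₁ r₂ (p - 1 - i) *
        diffMoment r₁ r₂ (p - 1 - (p - 1 - i) + 1) =
        ∑ i ∈ Finset.range p, (r₁ * ((diffCoeff r₁ r₂ i).2.1 * diffMoment r₁ r₂ (p - 1 - i)) +
          r₂ * ((diffCoeff r₁ r₂ i).2.2 * diffMoment r₁ r₂ (p - 1 - i))) := by
      refine Finset.sum_congr rfl fun i hi => ?_
      have : p - 1 - (p - 1 - i) = i := by have := Finset.mem_range.1 hi; omega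
      rw [this, diffMoment_succ]; ring
    rw [this, Finset.sum_add_distrib]
    ring

theorem inner_vacuum_rightConcat (i : Bool) (x : H) :
    inner ℂ (e []) (rightConcat e [i] x) = (0 : ℂ) := by
  have : x ∈ supportedOn e Set.univ := fun w hw => absurd (Set.mem_univ w) hw
  refine map_mem_supportedOn e (S' := {w | w ≠ []}) _ (fun w _ => ?_) this [] (by simp)
  rw [rightConcat_apply]
  exact basis_mem_supportedOn e (by simp)

/-- Each operator passes through the appending of a last letter up to a multiple of a fixed vector,
the multiple being a vacuum component. Applying T once more thus shifts the existing terms and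
collects the multiples into the next coefficients. -/
theorem poissonOp_sub_pow_vacuum (r₁ r₂ : ℝ) (p : ℕ) :
    ((poissonOp e true r₁ - poissonOp e false r₂) ^ p) (e []) =
      (diffMoment r₁ r₂ p : ℂ) • e [] + ∑ i ∈ Finset.range p,
        (((diffCoeff r₁ r₂ i).2.1 : ℂ) • rightConcat e [true]
          (((poissonOp e true r₁ - poissonOp e false r₂) ^ (p - 1 - i)) (e [])) +
        ((diffCoeff r₁ r₂ i).2.2 : ℂ) • rightConcat e [false]
          (((poissonOp e true r₁ - poissonOp e false r₂) ^ (p - 1 - i)) (e []))) := by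
  set T := poissonOp e true r₁ - poissonOp e false r₂ with hT
  induction p using Nat.strong_induction_on with
  | _ p ih =>
  cases p with
  | zero => simp [diffMoment_zero]
  | succ p =>
    -- Vectors ending in a letter are orthogonal to the vacuum, so the vacuum component is read off
    -- the induction hypothesis.
    have hin : ∀ q ≤ p, inner ℂ (e []) ((T ^ q) (e [])) = (diffMoment r₁ r₂ q : ℂ) := fun q hq => by
      rw [ih q (by omega), inner_add_right, inner_sum, inner_smul_right, e.inner_eq_ite]
      simp [inner_add_right, inner_vacuum_rightConcat]
    have hT1 : ∀ x, T (rightConcat e [true] x) = rightConcat e [true] (T x) +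
        inner ℂ (e []) x • (rightConcat e [true] (e []) + (r₁ : ℂ) • e []) := fun x => by
      rw [hT, sub_apply, sub_apply, poissonOp_rightConcat_singleton,
        poissonOp_rightConcat_singleton, map_sub]
      simp only [if_true, Bool.false_eq_true, if_false]
      abel
    have hT2 : ∀ x, T (rightConcat e [false] x) = rightConcat e [false] (T x) -
        inner ℂ (e []) x • (rightConcat e [false] (e []) + (r₂ : ℂ) • e []) := fun x => by
      rw [hT, sub_apply, sub_apply, poissonOp_rightConcat_singleton,
        poissonOp_rightConcat_singleton, map_sub]
      simp only [if_true, reduceCtorEq, if_false]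
      abel
    have hT0 : T (e []) = (r₁ : ℂ) • (rightConcat e [true] (e []) + (r₁ : ℂ) • e []) -
        (r₂ : ℂ) • (rightConcat e [false] (e []) + (r₂ : ℂ) • e []) := by
      rw [hT, sub_apply, poissonOp_vacuum, poissonOp_vacuum]
    rw [pow_succ', clm_mul_apply, ih p (by omega), map_add, map_sum, map_smul, hT0]
    have step : ∀ i ∈ Finset.range p,
        T (((diffCoeff r₁ r₂ i).2.1 : ℂ) • rightConcat e [true] ((T ^ (p - 1 - i)) (e [])) +
          ((diffCoeff r₁ r₂ i).2.2 : ℂ) • rightConcat e [false] ((T ^ (p - 1 - i)) (e []))) =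
        (((diffCoeff r₁ r₂ i).2.1 : ℂ) • rightConcat e [true] ((T ^ (p - i)) (e [])) +
          ((diffCoeff r₁ r₂ i).2.2 : ℂ) • rightConcat e [false] ((T ^ (p - i)) (e []))) +
        ((((diffCoeff r₁ r₂ i).2.1 * diffMoment r₁ r₂ (p - 1 - i) : ℝ) : ℂ) •
          (rightConcat e [true] (e []) + (r₁ : ℂ) • e []) -
        (((diffCoeff r₁ r₂ i).2.2 * diffMoment r₁ r₂ (p - 1 - i) : ℝ) : ℂ) •
          (rightConcat e [false] (e []) + (r₂ : ℂ) • e [])) := fun i hi => by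
      have hi' := Finset.mem_range.1 hi
      have hpow : T ((T ^ (p - 1 - i)) (e [])) = (T ^ (p - i)) (e []) := by
        have : p - i = (p - 1 - i) + 1 := by omega
        rw [this, pow_succ', clm_mul_apply]
      rw [map_add, map_smul, map_smul, hT1, hT2, hin _ (by omega), hpow, Complex.ofReal_mul,
        Complex.ofReal_mul]
      module
    rw [Finset.sum_congr rfl step, Finset.sum_add_distrib, Finset.sum_sub_distrib,
      ← Finset.sum_smul, ← Finset.sum_smul, Finset.sum_range_succ]
    have e1 := diffCoeff_left r₁ r₂ p
    have e2 := diffCoeff_right r₁ r₂ p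
    simp only [Nat.add_sub_cancel, Nat.sub_self, pow_zero, clm_one_apply]
    rw [diffMoment_succ]
    have e1' : ((∑ i ∈ Finset.range p, (diffCoeff r₁ r₂ i).2.1 * diffMoment r₁ r₂ (p - 1 - i) : ℝ)
        : ℂ) = ((diffCoeff r₁ r₂ p).2.1 : ℂ) - r₁ * diffMoment r₁ r₂ p := by
      rw [e1]; push_cast; ring
    have e2' : ((∑ i ∈ Finset.range p, (diffCoeff r₁ r₂ i).2.2 * diffMoment r₁ r₂ (p - 1 - i) : ℝ)
        : ℂ) = -((diffCoeff r₁ r₂ p).2.2 : ℂ) - r₂ * diffMoment r₁ r₂ p := by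
      rw [e2]; push_cast; ring
    rw [← Complex.ofReal_sum, ← Complex.ofReal_sum, e1', e2']
    push_cast
    module

theorem vacuumState_poissonOp_sub_pow (r₁ r₂ : ℝ) (p : ℕ) :
    vacuumState e ((poissonOp e true r₁ - poissonOp e false r₂) ^ p) =
      (diffMoment r₁ r₂ p : ℂ) := by
  rw [vacuumState_apply, poissonOp_sub_pow_vacuum, inner_add_right, inner_sum, inner_smul_right,
    e.inner_eq_ite]
  simp [inner_add_right, inner_vacuum_rightConcat]

end FockSpace

/-! ### Free Poisson laws: mass, support and moments -/

theorem MeasureTheory.Measure.integrable_of_compl_null {μ : Measure ℝ} [IsFiniteMeasure μ]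
    {K : Set ℝ} (hK : IsCompact K) (hμ : μ Kᶜ = 0) {f : ℝ → ℝ} (hf : Continuous f) :
    Integrable f μ := by
  have h : μ.restrict K = μ := Measure.restrict_eq_self_of_ae_mem (by
    rw [ae_iff]; exact hμ)
  rw [← h]
  exact hf.continuousOn.integrableOn_compact hK

section FreePoissonDensity

open Real

theorem integral_sin_mul_sin (n : ℕ) :
    ∫ θ in (0 : ℝ)..π, sin ((n + 1) * θ) * sin θ = if n = 0 then π / 2 else 0 := by
  split_ifs with h
  · subst h
    have : ∀ θ : ℝ, sin (((0 : ℕ) + 1 : ℝ) * θ) * sin θ = sin θ ^ 2 := fun θ => by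
      norm_num; ring
    simp_rw [this]
    rw [integral_sin_sq]; simp
  · have hn : (n : ℝ) ≠ 0 := by exact_mod_cast h
    have hn2 : (n + 2 : ℝ) ≠ 0 := by positivity
    have e : ∀ θ : ℝ, sin ((n + 1) * θ) * sin θ = (cos (n * θ) - cos ((n + 2) * θ)) / 2 := by
      intro θ
      have h1 : (n : ℝ) * θ = (n + 1) * θ - θ := by ring
      have h2 : ((n : ℝ) + 2) * θ = (n + 1) * θ + θ := by ring
      rw [h1, h2, cos_sub, cos_add]; ring
    have hder : ∀ θ ∈ Set.uIcc 0 π, HasDerivAt (fun θ : ℝ => (sin (n * θ) / n -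
        sin ((n + 2) * θ) / (n + 2)) / 2) ((cos (n * θ) - cos ((n + 2) * θ)) / 2) θ := by
      intro θ _
      have h1 : HasDerivAt (fun θ : ℝ => sin (n * θ)) (cos (n * θ) * n) θ := by
        simpa using ((hasDerivAt_id θ).const_mul (n : ℝ)).sin
      have h2 : HasDerivAt (fun θ : ℝ => sin ((n + 2) * θ)) (cos ((n + 2) * θ) * (n + 2)) θ := by
        simpa using ((hasDerivAt_id θ).const_mul (n + 2 : ℝ)).sin
      convert! ((h1.div_const (n : ℝ)).sub (h2.div_const (n + 2 : ℝ))).div_const 2 using 2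
      field_simp
    simp_rw [e]
    rw [intervalIntegral.integral_eq_sub_of_hasDerivAt hder
      (Continuous.intervalIntegrable (by fun_prop) _ _)]
    have h3 : sin (n * π) = 0 := sin_nat_mul_pi n
    have h4 : sin ((n + 2) * π) = 0 := by
      have := sin_nat_mul_pi (n + 2)
      push_cast at this
      exact this
    rw [h3, h4]; simp

/-- The expansion of `sin θ / (1 + 2 s cos θ + s²)` in powers of `s`, with remainder. -/
theorem mul_sum_pow_mul_sin (s θ : ℝ) (N : ℕ) :
    (1 + s ^ 2 + 2 * s * cos θ) * ∑ n ∈ Finset.range N, (-s) ^ n * sin ((n + 1) * θ) =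
      sin θ - (-s) ^ N * sin ((N + 1) * θ) + (-s) ^ (N + 1) * sin (N * θ) := by
  induction N with
  | zero => simp
  | succ N ih =>
    have h1 : sin (((N + 1 : ℕ) + 1 : ℝ) * θ) = 2 * cos θ * sin ((N + 1) * θ) - sin (N * θ) := by
      have e1 : ((N + 1 : ℕ) + 1 : ℝ) * θ = (N + 1) * θ + θ := by push_cast; ring
      have e2 : (N : ℝ) * θ = (N + 1) * θ - θ := by ring
      rw [e1, e2, sin_add, sin_sub]; ring
    rw [Finset.sum_range_succ, mul_add, ih, h1]
    push_cast
    ring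

theorem poissonKernel_pos {s : ℝ} (hs : 0 < s) {θ : ℝ} (hθ : θ ∈ Set.Ioo 0 π) :
    0 < 1 + s ^ 2 + 2 * s * cos θ := by
  have h : -1 < cos θ := by
    rw [← cos_pi]
    exact cos_lt_cos_of_nonneg_of_le_pi hθ.1.le le_rfl hθ.2
  nlinarith [sq_nonneg (1 - s)]

/-- Among the terms (-s)^n sin((n + 1)θ) in the expansion of sin θ over the denominator, only n = 0
is not orthogonal to sin θ. The remainder after finitely many terms decays geometrically. -/
theorem integral_sin_sq_div {s : ℝ} (hs0 : 0 ≤ s) (hs1 : s < 1) :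
    ∫ θ in (0 : ℝ)..π, sin θ ^ 2 / (1 + s ^ 2 + 2 * s * cos θ) = π / 2 := by
  have hD : ∀ θ : ℝ, (1 - s) ^ 2 ≤ 1 + s ^ 2 + 2 * s * cos θ := fun θ => by
    nlinarith [neg_one_le_cos θ]
  have hpos : 0 < (1 - s) ^ 2 := by have : 0 < 1 - s := by linarith
                                    positivity
  have hDne : ∀ θ : ℝ, 1 + s ^ 2 + 2 * s * cos θ ≠ 0 := fun θ => (hpos.trans_le (hD θ)).ne'
  have key : ∀ N : ℕ, |(∫ θ in (0 : ℝ)..π, sin θ ^ 2 / (1 + s ^ 2 + 2 * s * cos θ)) - π / 2| ≤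
      2 / (1 - s) ^ 2 * π * s ^ (N + 1) := by
    intro N
    have e1 : ∫ θ in (0 : ℝ)..π, ∑ n ∈ Finset.range (N + 1),
        (-s) ^ n * (sin ((n + 1) * θ) * sin θ) = π / 2 := by
      rw [intervalIntegral.integral_finsetSum]
      · simp_rw [intervalIntegral.integral_const_mul, integral_sin_mul_sin]
        rw [Finset.sum_eq_single 0]
        · simp
        · intro n _ hn; simp [hn]
        · simp
      · intro n _
        exact Continuous.intervalIntegrable (by fun_prop) _ _
    rw [← e1, ← intervalIntegral.integral_sub]
    · have := intervalIntegral.norm_integral_le_of_norm_le_const (a := 0) (b := π)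
        (C := 2 / (1 - s) ^ 2 * s ^ (N + 1)) (f := fun θ => sin θ ^ 2 / (1 + s ^ 2 + 2 * s * cos θ) -
          ∑ n ∈ Finset.range (N + 1), (-s) ^ n * (sin ((n + 1) * θ) * sin θ)) ?_
      · rw [sub_zero, abs_of_pos pi_pos] at this
        rw [← norm_eq_abs]
        linarith
      · intro θ _
        have e2 := mul_sum_pow_mul_sin s θ (N + 1)
        set S := ∑ n ∈ Finset.range (N + 1), (-s) ^ n * sin ((n + 1) * θ) with hS
        have e3 : ∑ n ∈ Finset.range (N + 1), (-s) ^ n * (sin ((n + 1) * θ) * sin θ) =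
            S * sin θ := by
          rw [hS, Finset.sum_mul]
          exact Finset.sum_congr rfl fun n _ => by ring
        set D := 1 + s ^ 2 + 2 * s * cos θ with hDdef
        have hD' : (1 - s) ^ 2 ≤ D := hD θ
        have hDpos : 0 < D := hpos.trans_le hD'
        have e4 : sin θ ^ 2 / D - S * sin θ = ((-s) ^ (N + 1) * sin (((N + 1 : ℕ) + 1) * θ) -
            (-s) ^ (N + 1 + 1) * sin ((N + 1 : ℕ) * θ)) * sin θ / D := by
          rw [eq_div_iff hDpos.ne', sub_mul, div_mul_cancel₀ _ hDpos.ne']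
          linear_combination (-sin θ) * e2
        rw [e3, e4, norm_eq_abs, abs_div, abs_of_pos hDpos, div_le_iff₀ hDpos]
        have b1 : |(-s) ^ (N + 1) * sin (((N + 1 : ℕ) + 1) * θ)| ≤ s ^ (N + 1) := by
          rw [abs_mul, abs_pow, abs_neg, abs_of_nonneg hs0]
          exact mul_le_of_le_one_right (by positivity) (abs_sin_le_one _)
        have b2 : |(-s) ^ (N + 1 + 1) * sin ((N + 1 : ℕ) * θ)| ≤ s ^ (N + 1) := by
          rw [abs_mul, abs_pow, abs_neg, abs_of_nonneg hs0]
          exact (mul_le_of_le_one_right (by positivity) (abs_sin_le_one _)).trans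
            (pow_le_pow_of_le_one hs0 hs1.le (by omega))
        have b3 : |((-s) ^ (N + 1) * sin (((N + 1 : ℕ) + 1) * θ) -
            (-s) ^ (N + 1 + 1) * sin ((N + 1 : ℕ) * θ)) * sin θ| ≤ 2 * s ^ (N + 1) := by
          rw [abs_mul]
          refine (mul_le_of_le_one_right (abs_nonneg _) (abs_sin_le_one _)).trans ?_
          refine (abs_sub _ _).trans ?_
          linarith
        refine b3.trans ?_
        have : 2 / (1 - s) ^ 2 * s ^ (N + 1) * (1 - s) ^ 2 = 2 * s ^ (N + 1) := by
          rw [div_mul_eq_mul_div, div_mul_cancel₀ _ hpos.ne']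
        rw [← this]
        exact mul_le_mul_of_nonneg_left hD' (by positivity)
    · exact Continuous.intervalIntegrable (by fun_prop (disch := exact hDne _)) _ _
    · exact Continuous.intervalIntegrable (by fun_prop) _ _
  have hlim : Tendsto (fun N : ℕ => 2 / (1 - s) ^ 2 * π * s ^ (N + 1)) atTop (𝓝 0) := by
    have := ((tendsto_pow_atTop_nhds_zero_of_lt_one hs0 hs1).comp (tendsto_add_atTop_nat 1)).const_mul
      (2 / (1 - s) ^ 2 * π)
    simpa using this
  have := ge_of_tendsto' hlim key
  exact sub_eq_zero.1 (abs_nonpos_iff.1 this)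

/-- For r > 1 the denominator is r² times the one for 1/r, which reduces to r < 1. At r = 1 it
vanishes at θ = π, but the integrand simplifies to (1 - cos θ)/2. -/
theorem integral_poissonMass {r : ℝ} (hr : 0 < r) :
    ∫ θ in (0 : ℝ)..π, r ^ 2 * sin θ ^ 2 / (1 + r ^ 2 + 2 * r * cos θ) = min 1 (r ^ 2) * (π / 2) := by
  rcases lt_trichotomy r 1 with h | h | h
  · have : ∀ θ : ℝ, r ^ 2 * sin θ ^ 2 / (1 + r ^ 2 + 2 * r * cos θ) =
        r ^ 2 * (sin θ ^ 2 / (1 + r ^ 2 + 2 * r * cos θ)) := fun θ => by ring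
    simp_rw [this]
    rw [intervalIntegral.integral_const_mul, integral_sin_sq_div hr.le h, min_eq_right]
    nlinarith
  · subst h
    have : ∀ θ ∈ Set.Ioo (0 : ℝ) π, (1 : ℝ) ^ 2 * sin θ ^ 2 / (1 + 1 ^ 2 + 2 * 1 * cos θ) =
        (1 - cos θ) / 2 := fun θ hθ => by
      have hp := poissonKernel_pos one_pos hθ
      rw [div_eq_div_iff hp.ne' two_ne_zero, sin_sq]; ring
    rw [intervalIntegral.integral_of_le pi_pos.le, integral_Ioc_eq_integral_Ioo,
      setIntegral_congr_fun measurableSet_Ioo this, ← integral_Ioc_eq_integral_Ioo,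
      ← intervalIntegral.integral_of_le pi_pos.le, intervalIntegral.integral_div,
      intervalIntegral.integral_sub (by simp) (Continuous.intervalIntegrable (by fun_prop) _ _)]
    simp
  · have hr' : r⁻¹ < 1 := inv_lt_one_of_one_lt₀ h
    have : ∀ θ : ℝ, r ^ 2 * sin θ ^ 2 / (1 + r ^ 2 + 2 * r * cos θ) =
        sin θ ^ 2 / (1 + r⁻¹ ^ 2 + 2 * r⁻¹ * cos θ) := fun θ => by
      have e : 1 + r⁻¹ ^ 2 + 2 * r⁻¹ * cos θ = (1 + r ^ 2 + 2 * r * cos θ) / r ^ 2 := by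
        field_simp; ring
      rw [e, div_div_eq_mul_div, mul_comm]
    simp_rw [this]
    rw [integral_sin_sq_div (inv_pos.2 hr).le hr', min_eq_left, one_mul]
    nlinarith

/-- The density of the free Poisson distribution of rate `r ^ 2`. -/
noncomputable def poissonDensity (r t : ℝ) : ℝ := √(4 * r ^ 2 - (t - (1 + r ^ 2)) ^ 2) / (2 * π * t)

theorem poissonDensity_nonneg (r t : ℝ) : 0 ≤ poissonDensity r t := by
  rcases le_or_gt 0 t with h | h
  · unfold poissonDensity; positivity
  · rw [poissonDensity, sqrt_eq_zero_of_nonpos, zero_div]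
    nlinarith [sq_nonneg (1 - r ^ 2), mul_neg_of_neg_of_pos h (by positivity : 0 < 1 + r ^ 2),
      sq_nonneg t]

theorem poissonDensity_eq_zero {r t : ℝ} (hr : 0 < r)
    (ht : t ∉ (fun θ => 1 + r ^ 2 + 2 * r * cos θ) '' Set.Ioo 0 π) : poissonDensity r t = 0 := by
  rw [poissonDensity, sqrt_eq_zero_of_nonpos, zero_div]
  by_contra hcon
  push Not at hcon
  have h1 : |t - (1 + r ^ 2)| < 2 * r := by
    apply abs_lt_of_sq_lt_sq _ (by positivity)
    nlinarith
  obtain ⟨h2, h3⟩ := abs_lt.1 h1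
  set x := (t - (1 + r ^ 2)) / (2 * r) with hx
  have hx1 : -1 < x := by rw [hx, lt_div_iff₀ (by positivity)]; linarith
  have hx2 : x < 1 := by rw [hx, div_lt_iff₀ (by positivity)]; linarith
  refine ht ⟨arccos x, ⟨arccos_pos.2 hx2, lt_of_le_of_ne (arccos_le_pi x) fun h => ?_⟩, ?_⟩
  · exact absurd (arccos_eq_pi.1 h) (not_le.2 hx1)
  · simp only
    rw [cos_arccos hx1.le hx2.le, hx]
    field_simp
    ring

/-- Under t = 1 + r² + 2 r cos θ the square root becomes 2 r sin θ, as does the Jacobian. -/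
theorem poissonDensity_param {r : ℝ} (hr : 0 < r) {θ : ℝ} (hθ : θ ∈ Set.Ioo 0 π) :
    |-(2 * r * sin θ)| * poissonDensity r (1 + r ^ 2 + 2 * r * cos θ) =
      2 / π * (r ^ 2 * sin θ ^ 2 / (1 + r ^ 2 + 2 * r * cos θ)) := by
  have hs := sin_pos_of_mem_Ioo hθ
  have hp := poissonKernel_pos hr hθ
  have h1 : √(4 * r ^ 2 - (1 + r ^ 2 + 2 * r * cos θ - (1 + r ^ 2)) ^ 2) = 2 * r * sin θ := by
    rw [sqrt_eq_iff_mul_self_eq_of_pos (by positivity)]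
    have := sin_sq θ
    nlinarith
  rw [poissonDensity, h1, abs_neg, abs_of_pos (by positivity)]
  have := pi_pos
  field_simp

theorem hasDerivWithinAt_poissonParam (r : ℝ) : ∀ θ ∈ Set.Ioo (0 : ℝ) π,
    HasDerivWithinAt (fun θ => 1 + r ^ 2 + 2 * r * cos θ) (-(2 * r * sin θ)) (Set.Ioo 0 π) θ := by
  intro θ _
  have := ((hasDerivAt_cos θ).const_mul (2 * r)).const_add (1 + r ^ 2)
  convert! this.hasDerivWithinAt using 1
  ring

theorem injOn_poissonParam {r : ℝ} (hr : 0 < r) :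
    Set.InjOn (fun θ => 1 + r ^ 2 + 2 * r * cos θ) (Set.Ioo 0 π) := by
  intro a ha b hb h
  have : cos a = cos b := by
    have : 2 * r * cos a = 2 * r * cos b := by simpa using h
    exact mul_left_cancel₀ (by positivity) this
  exact injOn_cos ⟨ha.1.le, ha.2.le⟩ ⟨hb.1.le, hb.2.le⟩ this

theorem integral_mul_poissonDensity {r : ℝ} (hr : 0 < r) (g : ℝ → ℝ) :
    ∫ t, g t * poissonDensity r t = ∫ θ in (0 : ℝ)..π, g (1 + r ^ 2 + 2 * r * cos θ) *
      (2 / π * (r ^ 2 * sin θ ^ 2 / (1 + r ^ 2 + 2 * r * cos θ))) := by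
  rw [← setIntegral_eq_integral_of_forall_compl_eq_zero
    (s := (fun θ => 1 + r ^ 2 + 2 * r * cos θ) '' Set.Ioo 0 π)
    (fun t ht => by rw [poissonDensity_eq_zero hr ht, mul_zero]),
    integral_image_eq_integral_abs_deriv_smul measurableSet_Ioo (hasDerivWithinAt_poissonParam r)
      (injOn_poissonParam hr), intervalIntegral.integral_of_le pi_pos.le,
    integral_Ioc_eq_integral_Ioo]
  refine setIntegral_congr_fun measurableSet_Ioo fun θ hθ => ?_
  simp only [smul_eq_mul]
  rw [← poissonDensity_param hr hθ]
  ring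

theorem measurable_poissonDensity (r : ℝ) : Measurable (poissonDensity r) := by
  unfold poissonDensity; fun_prop

theorem integrable_poissonDensity {r : ℝ} (hr : 0 < r) : Integrable (poissonDensity r) := by
  have himg : MeasurableSet ((fun θ => 1 + r ^ 2 + 2 * r * cos θ) '' Set.Ioo 0 π) :=
    measurableSet_Ioo.image_of_continuousOn_injOn (by fun_prop) (injOn_poissonParam hr)
  have h1 : IntegrableOn (poissonDensity r)
      ((fun θ => 1 + r ^ 2 + 2 * r * cos θ) '' Set.Ioo 0 π) := by
    rw [integrableOn_image_iff_integrableOn_abs_deriv_smul measurableSet_Ioo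
      (hasDerivWithinAt_poissonParam r) (injOn_poissonParam hr)]
    refine Measure.integrableOn_of_bounded (M := 2 / π * r) (by simp) ?_ ?_
    · apply Measurable.aestronglyMeasurable
      have := measurable_poissonDensity r
      fun_prop
    · refine (ae_restrict_iff' measurableSet_Ioo).2 (ae_of_all _ fun θ hθ => ?_)
      have hp := poissonKernel_pos hr hθ
      rw [smul_eq_mul, poissonDensity_param hr hθ, norm_eq_abs, abs_of_nonneg (by positivity)]
      refine mul_le_mul_of_nonneg_left ?_ (by positivity)
      rw [div_le_iff₀ hp, sin_sq]
      -- With D the denominator, r D - r² sin² θ = r ((1 - r)² + r (1 + cos θ)²) ≥ 0.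
      nlinarith [mul_nonneg hr.le (sq_nonneg (1 + r * cos θ)), sq_nonneg (r - 1 ),
        mul_nonneg hr.le (sq_nonneg (r + cos θ)), mul_nonneg hr.le (sq_nonneg (1 + r * cos θ - r))]
  rw [← integrableOn_iff_integrable_of_support_subset (s := (fun θ => 1 + r ^ 2 + 2 * r * cos θ) ''
    Set.Ioo 0 π)]
  · exact h1
  · intro t ht
    by_contra hcon
    exact ht (poissonDensity_eq_zero hr hcon)

theorem integral_poissonDensity {r : ℝ} (hr : 0 < r) :
    ∫ t, poissonDensity r t = min 1 (r ^ 2) := by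
  have := integral_mul_poissonDensity hr fun _ => 1
  simp only [one_mul] at this
  rw [this, intervalIntegral.integral_const_mul, integral_poissonMass hr]
  have := pi_pos
  field_simp

theorem freePoisson_sq (r : ℝ) : RandomState.freePoisson (r ^ 2) =
    ENNReal.ofReal (1 - r ^ 2) • Measure.dirac 0 +
      volume.withDensity fun t => ENNReal.ofReal (poissonDensity r t) := rfl

theorem freePoisson_zero : RandomState.freePoisson 0 = Measure.dirac 0 := by
  have h : (fun t : ℝ => ENNReal.ofReal (√(4 * 0 - (t - (1 + 0)) ^ 2) / (2 * π * t))) = 0 := by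
    funext t
    rw [sqrt_eq_zero_of_nonpos (by nlinarith [sq_nonneg (t - (1 + 0))])]
    simp
  rw [RandomState.freePoisson, h]
  simp

theorem isProbabilityMeasure_freePoisson {r : ℝ} (hr : 0 ≤ r) :
    IsProbabilityMeasure (RandomState.freePoisson (r ^ 2)) := by
  rcases hr.eq_or_lt with rfl | hr
  · norm_num [freePoisson_zero]
    infer_instance
  constructor
  rw [freePoisson_sq, Measure.add_apply, withDensity_apply _ MeasurableSet.univ,
    Measure.restrict_univ, ← ofReal_integral_eq_lintegral_ofReal (integrable_poissonDensity hr)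
      (ae_of_all _ (poissonDensity_nonneg r)), integral_poissonDensity hr]
  simp only [Measure.smul_apply, measure_univ, smul_eq_mul, mul_one]
  rcases le_total (r ^ 2) 1 with h | h
  · rw [min_eq_right h, ← ENNReal.ofReal_add (by linarith) (by positivity)]
    simp
  · rw [min_eq_left h, ENNReal.ofReal_of_nonpos (by linarith)]
    simp

theorem freePoisson_compl_null {r : ℝ} (hr : 0 ≤ r) :
    RandomState.freePoisson (r ^ 2) (Set.Icc 0 ((1 + r) ^ 2))ᶜ = 0 := by
  rcases hr.eq_or_lt with rfl | hr
  · norm_num [freePoisson_zero]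
  rw [freePoisson_sq, Measure.add_apply, withDensity_apply _ measurableSet_Icc.compl]
  have h1 : ∫⁻ t in (Set.Icc 0 ((1 + r) ^ 2))ᶜ, ENNReal.ofReal (poissonDensity r t) = 0 := by
    rw [setLIntegral_congr_fun (g := fun _ => 0) measurableSet_Icc.compl]
    · simp
    · intro t ht
      simp only
      rw [poissonDensity_eq_zero hr, ENNReal.ofReal_zero]
      rintro ⟨θ, hθ, rfl⟩
      refine ht ⟨(poissonKernel_pos hr hθ).le, ?_⟩
      simp only
      nlinarith [cos_le_one θ]
  rw [h1]
  have : (0 : ℝ) ∈ Set.Icc 0 ((1 + r) ^ 2) := ⟨le_rfl, by positivity⟩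
  simp [this]

/-- One factor t kills the atom at 0 and cancels the 1/t of the density. -/
theorem integral_pow_succ_freePoisson {r : ℝ} (hr : 0 ≤ r) (k : ℕ) :
    ∫ t, t ^ (k + 1) ∂(RandomState.freePoisson (r ^ 2)) = r ^ 2 * (2 / π *
      ∫ θ in (0 : ℝ)..π, (1 + r ^ 2 + 2 * r * cos θ) ^ k * sin θ ^ 2) := by
  rcases hr.eq_or_lt with rfl | hr
  · norm_num [freePoisson_zero]
  have := isProbabilityMeasure_freePoisson hr.le
  have hint : Integrable (fun t : ℝ => t ^ (k + 1)) (RandomState.freePoisson (r ^ 2)) :=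
    Measure.integrable_of_compl_null isCompact_Icc (freePoisson_compl_null hr.le) (by fun_prop)
  rw [freePoisson_sq] at hint ⊢
  rw [integral_add_measure hint.left_of_add_measure hint.right_of_add_measure,
    integral_withDensity_eq_integral_toReal_smul
      (measurable_poissonDensity r).ennreal_ofReal (by simp)]
  simp only [integral_smul_measure, integral_dirac, smul_eq_mul, zero_pow (Nat.succ_ne_zero k),
    mul_zero, zero_add, ENNReal.toReal_ofReal (poissonDensity_nonneg r _)]
  have h := integral_mul_poissonDensity hr fun t => t ^ (k + 1)
  simp_rw [mul_comm (poissonDensity r _)]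
  rw [h, ← intervalIntegral.integral_const_mul, ← intervalIntegral.integral_const_mul,
    intervalIntegral.integral_of_le pi_pos.le, intervalIntegral.integral_of_le pi_pos.le,
    integral_Ioc_eq_integral_Ioo, integral_Ioc_eq_integral_Ioo]
  refine setIntegral_congr_fun measurableSet_Ioo fun θ hθ => ?_
  have hp := (poissonKernel_pos hr hθ).ne'
  rw [pow_succ]
  generalize 1 + r ^ 2 + 2 * r * cos θ = D at hp ⊢
  field_simp

end FreePoissonDensity

/-! ### Spectral measures in a state -/

section SpectralMeasure

open scoped CompactlySupported

/-- A self-adjoint element of a C*-algebra has a compactly supported distribution in any state. -/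
theorem RandomState.IsState.exists_measure {A : Type*} [CStarAlgebra A] {φ : A →ₗ[ℂ] ℂ}
    (hφ : RandomState.IsState φ) {a : A} (ha : IsSelfAdjoint a) :
    ∃ μ : Measure ℝ, IsProbabilityMeasure μ ∧ (∃ K : Set ℝ, IsCompact K ∧ μ Kᶜ = 0) ∧
      ∀ k : ℕ, ∫ t, t ^ k ∂μ = (φ (a ^ k)).re := by
  let Φ : C_c(spectrum ℝ a, ℝ) →ₗ[ℝ] ℝ :=
    { toFun := fun f => (φ (cfcHom ha (f : C(spectrum ℝ a, ℝ)))).re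
      map_add' := fun f g => by
        have : ((f + g : C_c(spectrum ℝ a, ℝ)) : C(spectrum ℝ a, ℝ)) =
          (f : C(spectrum ℝ a, ℝ)) + (g : C(spectrum ℝ a, ℝ)) := rfl
        rw [this, map_add, map_add, Complex.add_re]
      map_smul' := fun c f => by
        have : ((c • f : C_c(spectrum ℝ a, ℝ)) : C(spectrum ℝ a, ℝ)) =
          c • (f : C(spectrum ℝ a, ℝ)) := rfl
        have h2 : ∀ x : A, c • x = (c : ℂ) • x := fun x => (Complex.coe_smul c x).symm
        rw [this, map_smul, h2, map_smul, smul_eq_mul, Complex.re_ofReal_mul]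
        rfl }
  have hpos : ∀ f : C_c(spectrum ℝ a, ℝ), 0 ≤ f → 0 ≤ Φ f := by
    intro f hf
    -- A nonnegative f is the square of √f, so its image under the functional calculus has the form
    -- star b * b, on which a state is nonnegative.
    let g : C(spectrum ℝ a, ℝ) := ⟨fun x => √(f x), by fun_prop⟩
    have hg : (f : C(spectrum ℝ a, ℝ)) = star g * g := by
      ext x
      have hx : 0 ≤ f x := hf x
      simp [g, Real.mul_self_sqrt hx]
    change 0 ≤ (φ (cfcHom ha (f : C(spectrum ℝ a, ℝ)))).re
    rw [hg, map_mul, map_star]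
    exact (Complex.nonneg_iff.1 (hφ.2 _)).1
  let Λ : C_c(spectrum ℝ a, ℝ) →ₚ[ℝ] ℝ := PositiveLinearMap.mk₀ Φ hpos
  let ν := RealRMK.rieszMeasure Λ
  have hν : ∀ f : C(spectrum ℝ a, ℝ), ∫ x, f x ∂ν = (φ (cfcHom ha f)).re := fun f =>
    RealRMK.integral_rieszMeasure Λ (CompactlySupportedContinuousMap.continuousMapEquiv f)
  have hprob : IsProbabilityMeasure ν := by
    have h1 := hν 1
    rw [map_one, hφ.1] at h1
    simp only [ContinuousMap.one_apply, integral_const, smul_eq_mul, mul_one, Complex.one_re] at h1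
    constructor
    rw [Measure.real] at h1
    exact (ENNReal.toReal_eq_one_iff _).1 h1
  refine ⟨ν.map Subtype.val, Measure.isProbabilityMeasure_map measurable_subtype_coe.aemeasurable,
    ⟨spectrum ℝ a, isCompact_iff_compactSpace.2 inferInstance, ?_⟩, fun k => ?_⟩
  · rw [Measure.map_apply measurable_subtype_coe (spectrum.isClosed a).measurableSet.compl]
    convert measure_empty (μ := ν)
    ext x
    simp
  · rw [integral_map measurable_subtype_coe.aemeasurable (by fun_prop)]
    have := hν (((ContinuousMap.id ℝ).restrict (spectrum ℝ a)) ^ k)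
    rw [map_pow, cfcHom_id ha] at this
    rw [← this]
    rfl

end SpectralMeasure

/-! ### The law of the Fock space elements -/

noncomputable section PoissonMoments

open ContinuousLinearMap Real

variable {H : Type*} [NormedAddCommGroup H] [InnerProductSpace ℂ H] [CompleteSpace H]
  (e : HilbertBasis (List Bool) ℂ H)

/-- On words in the single letter i, V* V is a Jacobi matrix with constant diagonal 1 + r² and
constant off-diagonal r. -/
theorem adjoint_mul_shiftedCreation_apply (i : Bool) (r : ℝ) (n : ℕ) :
    ((shiftedCreation e i r).adjoint * shiftedCreation e i r) (e (List.replicate n i)) =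
      (1 + r ^ 2 : ℂ) • e (List.replicate n i) + (r : ℂ) • e (List.replicate (n + 1) i) +
        (r : ℂ) • (leftCreation e i).adjoint (e (List.replicate n i)) := by
  rw [clm_mul_apply, adjoint_shiftedCreation]
  have h : shiftedCreation e i r (e (List.replicate n i)) =
      e (List.replicate (n + 1) i) + (r : ℂ) • e (List.replicate n i) := by
    rw [shiftedCreation, add_apply, leftCreation_apply]; rfl
  have h2 : (leftCreation e i).adjoint (e (List.replicate (n + 1) i)) =
      e (List.replicate n i) := by
    rw [List.replicate_succ, adjoint_leftCreation_cons, if_pos rfl]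
  rw [h, add_apply, map_add, map_smul, h2, smul_apply, clm_one_apply]
  module

/-- The functions sin((n + 1)θ) diagonalize this Jacobi matrix, with symbol 1 + r² + 2 r cos θ, by
the addition formulas. At n = 0 the missing neighbour matches sin 0 = 0. -/
theorem inner_vacuum_pow_replicate (i : Bool) (r : ℝ) (k n : ℕ) :
    inner ℂ (e []) ((((shiftedCreation e i r).adjoint * shiftedCreation e i r) ^ k)
      (e (List.replicate n i))) = ((2 / π * ∫ θ in (0 : ℝ)..π,
        (1 + r ^ 2 + 2 * r * cos θ) ^ k * (sin ((n + 1) * θ) * sin θ) : ℝ) : ℂ) := by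
  induction k generalizing n with
  | zero =>
    simp only [pow_zero, clm_one_apply, one_mul]
    rw [integral_sin_mul_sin, e.inner_eq_ite]
    have := pi_ne_zero
    cases n with
    | zero => simp [this]
    | succ n => simp [List.replicate_succ]
  | succ k ih =>
    have hint : ∀ m : ℕ, IntervalIntegrable (fun θ : ℝ => (1 + r ^ 2 + 2 * r * cos θ) ^ k *
        (sin ((m + 1) * θ) * sin θ)) volume 0 π := fun m =>
      Continuous.intervalIntegrable (by fun_prop) _ _
    rw [pow_succ, clm_mul_apply, adjoint_mul_shiftedCreation_apply, map_add, map_add, map_smul,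
      map_smul, map_smul, inner_add_right, inner_add_right, inner_smul_right, inner_smul_right,
      inner_smul_right, ih, ih]
    cases n with
    | zero =>
      rw [List.replicate_zero, adjoint_leftCreation_nil, map_zero, inner_zero_right]
      have : ∀ θ : ℝ, (1 + r ^ 2 + 2 * r * cos θ) ^ (k + 1) *
          (sin (((0 : ℕ) + 1) * θ) * sin θ) = (1 + r ^ 2) * ((1 + r ^ 2 + 2 * r * cos θ) ^ k *
          (sin (((0 : ℕ) + 1) * θ) * sin θ)) + r * ((1 + r ^ 2 + 2 * r * cos θ) ^ k *
          (sin (((0 + 1 : ℕ) + 1) * θ) * sin θ)) := fun θ => by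
        have h2 : sin (((0 + 1 : ℕ) + 1) * θ) = 2 * sin θ * cos θ := by
          rw [← sin_two_mul]; norm_num
        have h1 : sin (((0 : ℕ) + 1) * θ) = sin θ := by norm_num
        rw [h1, h2]; ring
      simp_rw [this]
      rw [intervalIntegral.integral_add ((hint 0).const_mul _) ((hint (0 + 1)).const_mul _),
        intervalIntegral.integral_const_mul, intervalIntegral.integral_const_mul]
      push_cast
      ring
    | succ n =>
      rw [List.replicate_succ (n := n), adjoint_leftCreation_cons, if_pos rfl, ih]
      have : ∀ θ : ℝ, (1 + r ^ 2 + 2 * r * cos θ) ^ (k + 1) *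
          (sin (((n + 1 : ℕ) + 1) * θ) * sin θ) = (1 + r ^ 2) * ((1 + r ^ 2 + 2 * r * cos θ) ^ k *
          (sin (((n + 1 : ℕ) + 1) * θ) * sin θ)) + r * ((1 + r ^ 2 + 2 * r * cos θ) ^ k *
          (sin (((n + 1 + 1 : ℕ) + 1) * θ) * sin θ)) + r * ((1 + r ^ 2 + 2 * r * cos θ) ^ k *
          (sin ((n + 1) * θ) * sin θ)) := fun θ => by
        have e1 : (((n + 1 + 1 : ℕ) : ℝ) + 1) * θ = ((n + 1 : ℕ) + 1) * θ + θ := by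
          push_cast; ring
        have e2 : ((n : ℝ) + 1) * θ = ((n + 1 : ℕ) + 1) * θ - θ := by push_cast; ring
        rw [e1, e2, sin_add, sin_sub]; ring
      simp_rw [this]
      rw [intervalIntegral.integral_add (((hint (n + 1)).const_mul _).add
        ((hint (n + 1 + 1)).const_mul _)) ((hint n).const_mul _),
        intervalIntegral.integral_add ((hint (n + 1)).const_mul _) ((hint (n + 1 + 1)).const_mul _),
        intervalIntegral.integral_const_mul, intervalIntegral.integral_const_mul,
        intervalIntegral.integral_const_mul]
      push_cast
      ring

/-- (V V*)^(k+1) = V (V* V)^k V*, and V* multiplies the vacuum by r. -/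
theorem vacuumState_poissonOp_pow_succ (i : Bool) (r : ℝ) (k : ℕ) :
    vacuumState e (poissonOp e i r ^ (k + 1)) = ((r ^ 2 * (2 / π * ∫ θ in (0 : ℝ)..π,
        (1 + r ^ 2 + 2 * r * cos θ) ^ k * sin θ ^ 2) : ℝ) : ℂ) := by
  set V := shiftedCreation e i r with hV
  have hpow : poissonOp e i r ^ (k + 1) = V * (V.adjoint * V) ^ k * V.adjoint := by
    induction k with
    | zero => simp [poissonOp, hV]
    | succ k ih =>
      rw [pow_succ, ih, pow_succ (V.adjoint * V), poissonOp]
      simp only [mul_assoc, hV]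
  have hvac : V.adjoint (e []) = (r : ℂ) • e [] := by
    rw [hV, adjoint_shiftedCreation]
    simp [adjoint_leftCreation_nil]
  have h := inner_vacuum_pow_replicate e i r k 0
  rw [List.replicate_zero, ← hV] at h
  rw [vacuumState_apply, hpow, clm_mul_apply, clm_mul_apply, ← adjoint_inner_left, hvac, map_smul,
    inner_smul_left, inner_smul_right, h]
  have : ∀ θ : ℝ, sin (((0 : ℕ) + 1) * θ) * sin θ = sin θ ^ 2 := fun θ => by
    norm_num; ring
  simp_rw [this]
  rw [Complex.conj_ofReal]
  push_cast
  ring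

theorem hasDistribution_poissonOp (i : Bool) {r : ℝ} (hr : 0 ≤ r) :
    RandomState.HasDistribution (A := H →L[ℂ] H) (vacuumState e) (poissonOp e i r)
      (RandomState.freePoisson (r ^ 2)) := by
  have := isProbabilityMeasure_freePoisson hr
  refine ⟨this, ⟨_, isCompact_Icc, freePoisson_compl_null hr⟩, fun k => ?_⟩
  cases k with
  | zero => simpa using (isState_vacuumState e).1
  | succ k => rw [vacuumState_poissonOp_pow_succ, integral_pow_succ_freePoisson hr]

/-- The free difference of two free Poisson distributions, with its moments. -/
theorem exists_isFreeDifference_freePoisson {r₁ r₂ : ℝ} (h₁ : 0 ≤ r₁) (h₂ : 0 ≤ r₂) :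
    ∃ μ : Measure ℝ, IsProbabilityMeasure μ ∧ (∃ K : Set ℝ, IsCompact K ∧ μ Kᶜ = 0) ∧
      RandomState.IsFreeDifference (RandomState.freePoisson (r₁ ^ 2))
        (RandomState.freePoisson (r₂ ^ 2)) μ ∧ ∀ k : ℕ, ∫ t, t ^ k ∂μ = diffMoment r₁ r₂ k := by
  let e : HilbertBasis (List Bool) ℂ (lp (fun _ : List Bool => ℂ) 2) :=
    HilbertBasis.ofRepr (LinearIsometryEquiv.refl ℂ _)
  have hsa : IsSelfAdjoint (poissonOp e true r₁ - poissonOp e false r₂) :=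
    (isSelfAdjoint_poissonOp e _ _).sub (isSelfAdjoint_poissonOp e _ _)
  obtain ⟨μ, hμ, hK, hm⟩ := (isState_vacuumState e).exists_measure hsa
  have hm' : ∀ k : ℕ, ∫ t, t ^ k ∂μ = diffMoment r₁ r₂ k := fun k => by
    rw [hm, vacuumState_poissonOp_sub_pow, Complex.ofReal_re]
  refine ⟨μ, hμ, hK, ⟨_, inferInstance, vacuumState e, poissonOp e true r₁, poissonOp e false r₂,
    isState_vacuumState e, isSelfAdjoint_poissonOp e _ _, isSelfAdjoint_poissonOp e _ _,
    freePair_poissonOp e r₁ r₂, hasDistribution_poissonOp e _ h₁, hasDistribution_poissonOp e _ h₂,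
    hμ, hK, fun k => ?_⟩, hm'⟩
  rw [hm', vacuumState_poissonOp_sub_pow]

end PoissonMoments

/-! ### The method of moments -/

section MomentMethod

theorem integrable_polynomial_eval {μ : Measure ℝ} (h : ∀ k : ℕ, Integrable (fun t : ℝ => t ^ k) μ)
    (q : Polynomial ℝ) : Integrable (fun t => q.eval t) μ := by
  simp only [Polynomial.eval_eq_sum_range]
  exact integrable_finsetSum _ fun i _ => (h i).const_mul _

theorem integral_polynomial_eval {μ : Measure ℝ} (h : ∀ k : ℕ, Integrable (fun t : ℝ => t ^ k) μ)
    (q : Polynomial ℝ) :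
    ∫ t, q.eval t ∂μ = ∑ i ∈ Finset.range (q.natDegree + 1), q.coeff i * ∫ t, t ^ i ∂μ := by
  simp only [Polynomial.eval_eq_sum_range]
  rw [integral_finsetSum _ fun i _ => (h i).const_mul _]
  simp only [integral_const_mul]

/-- A bounded continuous function is close to a polynomial on `[-R, R]`, with an error outside that
is controlled by high even powers. -/
theorem exists_polynomial_abs_sub_le (f : BoundedContinuousFunction ℝ ℝ) {R ε : ℝ} (hR : 1 ≤ R)
    (hε : 0 < ε) :
    ∃ (q : Polynomial ℝ) (C : ℝ) (d : ℕ), 0 ≤ C ∧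
      ∀ k, d ≤ k → ∀ t, |f t - q.eval t| ≤ ε + C * (t / R) ^ (2 * k) := by
  obtain ⟨q, hq⟩ := exists_polynomial_near_of_continuousOn (-R) R f f.continuous.continuousOn ε hε
  have hC : 0 ≤ ‖f‖ + ∑ i ∈ Finset.range (q.natDegree + 1), |q.coeff i| * R ^ i :=
    add_nonneg (norm_nonneg _) (Finset.sum_nonneg fun i _ => by positivity)
  refine ⟨q, ‖f‖ + ∑ i ∈ Finset.range (q.natDegree + 1), |q.coeff i| * R ^ i, q.natDegree, hC,
    fun k hk t => ?_⟩
  have hpow : 0 ≤ (t / R) ^ (2 * k) := (even_two_mul k).pow_nonneg _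
  by_cases ht : t ∈ Set.Icc (-R) R
  · rw [abs_sub_comm]
    have := hq t ht
    nlinarith [mul_nonneg hC hpow]
  · have hR0 : 0 < R := by linarith
    -- Outside the interval |t / R| ≥ 1, so every power of degree at most 2k is dominated by the
    -- power 2k.
    have h1 : 1 ≤ |t / R| := by
      rw [abs_div, abs_of_pos hR0, one_le_div hR0]
      by_contra hlt
      exact ht (abs_le.1 (not_le.1 hlt).le)
    have habs : (t / R) ^ (2 * k) = |t / R| ^ (2 * k) := by
      rw [← abs_pow, abs_of_nonneg hpow]
    have hq' : |q.eval t| ≤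
        (∑ i ∈ Finset.range (q.natDegree + 1), |q.coeff i| * R ^ i) * (t / R) ^ (2 * k) := by
      rw [Polynomial.eval_eq_sum_range, Finset.sum_mul]
      refine (Finset.abs_sum_le_sum_abs _ _).trans (Finset.sum_le_sum fun i hi => ?_)
      rw [abs_mul, mul_assoc, habs]
      gcongr
      have : |t ^ i| = R ^ i * |t / R| ^ i := by
        rw [abs_pow, ← mul_pow, abs_div, abs_of_pos hR0, mul_div_cancel₀ _ hR0.ne']
      rw [this]
      have hi' := Finset.mem_range.1 hi
      have hik : i ≤ 2 * k := by omega
      gcongr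
    have hf : |f t| ≤ ‖f‖ * (t / R) ^ (2 * k) := by
      have h2 : |f t| ≤ ‖f‖ := f.norm_coe_le_norm t
      have h3 : 1 ≤ (t / R) ^ (2 * k) := habs ▸ one_le_pow₀ h1
      nlinarith [norm_nonneg f]
    have := abs_sub_le (f t) 0 (q.eval t)
    simp only [sub_zero, zero_sub, abs_neg] at this
    rw [add_mul]
    linarith

/-- The method of moments, for a compactly supported limit. -/
theorem MeasureTheory.FiniteMeasure.tendsto_of_tendsto_moments {μs : ℕ → FiniteMeasure ℝ}
    {μ : FiniteMeasure ℝ} (hint : ∀ n k, Integrable (fun t : ℝ => t ^ k) (μs n : Measure ℝ))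
    {K : Set ℝ} (hK : IsCompact K) (hμ : (μ : Measure ℝ) Kᶜ = 0)
    (h : ∀ k : ℕ, Tendsto (fun n => ∫ t, t ^ k ∂(μs n : Measure ℝ)) atTop
      (𝓝 (∫ t, t ^ k ∂(μ : Measure ℝ)))) :
    Tendsto μs atTop (𝓝 μ) := by
  have hintμ : ∀ k : ℕ, Integrable (fun t : ℝ => t ^ k) (μ : Measure ℝ) := fun k =>
    Measure.integrable_of_compl_null hK hμ (by fun_prop)
  have hpoly : ∀ q : Polynomial ℝ, Tendsto (fun n => ∫ t, q.eval t ∂(μs n : Measure ℝ)) atTop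
      (𝓝 (∫ t, q.eval t ∂(μ : Measure ℝ))) := by
    intro q
    rw [integral_polynomial_eval hintμ]
    simp_rw [fun n => integral_polynomial_eval (hint n) q]
    exact tendsto_finsetSum _ fun i _ => (h i).const_mul _
  obtain ⟨R₀, hR₀, hKR⟩ : ∃ R₀ : ℝ, 0 ≤ R₀ ∧ ∀ t ∈ K, |t| ≤ R₀ := by
    obtain ⟨R₀, h1⟩ := hK.isBounded.exists_norm_le
    exact ⟨max R₀ 0, le_max_right _ _, fun t ht => (h1 t ht).trans (le_max_left _ _)⟩
  set m : ℝ := ∫ t, t ^ 0 ∂(μ : Measure ℝ) with hm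
  have hm0 : 0 ≤ m := integral_nonneg fun t => by simp
  rw [FiniteMeasure.tendsto_iff_forall_integral_tendsto]
  intro f
  rw [Metric.tendsto_atTop']
  intro ε hε
  -- Here m is the mass of μ. Replacing f by q costs at most 2δm under μ and asymptotically as much
  -- under `μs n`; 4δm < ε leaves the margin used for η.
  set δ : ℝ := ε / (4 * (m + 1)) with hδ
  have hδ0 : 0 < δ := by positivity
  obtain ⟨q, C, d, hC, hqC⟩ := exists_polynomial_abs_sub_le f (R := R₀ + 1) (by linarith) hδ0
  have hr : R₀ / (R₀ + 1) < 1 := by rw [div_lt_one (by linarith)]; linarith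
  have hr0 : 0 ≤ R₀ / (R₀ + 1) := by positivity
  -- The radius R₀ + 1 exceeds that of the support, so on K the error term decays as k grows.
  obtain ⟨k, hk, hkd⟩ : ∃ k, C * (R₀ / (R₀ + 1)) ^ (2 * k) ≤ δ ∧ d ≤ k := by
    have ht : Tendsto (fun k : ℕ => C * (R₀ / (R₀ + 1)) ^ (2 * k)) atTop (𝓝 (C * 0)) :=
      ((tendsto_pow_atTop_nhds_zero_of_lt_one hr0 hr).comp
        (tendsto_id.const_mul_atTop' (by norm_num : 0 < 2))).const_mul C
    rw [mul_zero] at ht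
    exact ((ht.eventually (ge_mem_nhds hδ0)).and (eventually_ge_atTop d)).exists
  -- The majorant of |f - q| is itself a polynomial, so its integrals are controlled by convergence
  -- of moments, with no tightness argument.
  let e : Polynomial ℝ := Polynomial.C δ +
    Polynomial.C (C * ((R₀ + 1)⁻¹) ^ (2 * k)) * Polynomial.X ^ (2 * k)
  have he : ∀ t, e.eval t = δ + C * (t / (R₀ + 1)) ^ (2 * k) := by
    intro t
    simp [e, div_eq_mul_inv, mul_pow]
    ring
  have hbound : ∀ (ν : FiniteMeasure ℝ), (∀ k : ℕ, Integrable (fun t : ℝ => t ^ k) (ν : Measure ℝ)) →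
      |∫ t, f t ∂(ν : Measure ℝ) - ∫ t, q.eval t ∂(ν : Measure ℝ)| ≤
        ∫ t, e.eval t ∂(ν : Measure ℝ) := by
    intro ν hν
    rw [← integral_sub (f.integrable _) (integrable_polynomial_eval hν q)]
    refine (abs_integral_le_integral_abs).trans (integral_mono_of_nonneg
      (Eventually.of_forall fun t => abs_nonneg _) (integrable_polynomial_eval hν e)
      (Eventually.of_forall fun t => ?_))
    simp only [he]
    exact hqC k hkd t
  have hμe : ∫ t, e.eval t ∂(μ : Measure ℝ) ≤ 2 * δ * m := by
    have : ∫ t, 2 * δ * t ^ 0 ∂(μ : Measure ℝ) = 2 * δ * m := integral_const_mul _ _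
    rw [← this]
    refine integral_mono_ae (integrable_polynomial_eval hintμ e) ((hintμ 0).const_mul _) ?_
    have hK' : ∀ᵐ t ∂(μ : Measure ℝ), t ∈ K := by
      rw [ae_iff]; exact hμ
    filter_upwards [hK'] with t ht
    rw [he]
    have : (t / (R₀ + 1)) ^ (2 * k) ≤ (R₀ / (R₀ + 1)) ^ (2 * k) := by
      rw [← (even_two_mul k).pow_abs, abs_div, abs_of_pos (by linarith : 0 < R₀ + 1)]
      have := hKR t ht
      gcongr
    have := mul_le_mul_of_nonneg_left this hC
    simp only [pow_zero, mul_one]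
    linarith
  have hfin : 4 * δ * m < ε := by
    rw [hδ]
    have : 4 * (ε / (4 * (m + 1))) * m = ε * (m / (m + 1)) := by field_simp
    rw [this]
    have : m / (m + 1) < 1 := by rw [div_lt_one (by linarith)]; linarith
    nlinarith
  set η : ℝ := (ε - 4 * δ * m) / 2 with hη
  have hη0 : 0 < η := by rw [hη]; linarith
  have h1 := Metric.tendsto_atTop'.1 (hpoly q) η hη0
  have h2 := Metric.tendsto_atTop'.1 (hpoly e) η hη0
  obtain ⟨N₁, hN₁⟩ := h1
  obtain ⟨N₂, hN₂⟩ := h2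
  refine ⟨max N₁ N₂, fun n hn => ?_⟩
  have h1 := hN₁ n ((le_max_left _ _).trans_lt hn)
  have h2 := hN₂ n ((le_max_right _ _).trans_lt hn)
  have h3 := hbound (μs n) (hint n)
  have h4 := hbound μ hintμ
  rw [Real.dist_eq] at h1 h2 ⊢
  rw [abs_lt] at h1 h2 ⊢
  rw [abs_le] at h3 h4
  constructor <;> linarith [h1.1, h1.2, h2.1, h2.2, h3.1, h3.2, h4.1, h4.2]

end MomentMethod

/-! ### Moments of the empirical distribution as traces -/

section Empirical

open RandomState

variable {ι : Type*} [Fintype ι] [DecidableEq ι] {A : Matrix ι ι ℂ}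

theorem coe_empiricalDistribution (hA : A.IsHermitian) :
    (empiricalDistribution hA : Measure ℝ) =
      ((Fintype.card ι : NNReal)⁻¹) • ∑ i, Measure.dirac (hA.eigenvalues i) := by
  unfold empiricalDistribution
  rw [FiniteMeasure.toMeasure_smul, FiniteMeasure.toMeasure_sum]
  rfl

theorem integrable_empiricalDistribution (hA : A.IsHermitian) (f : ℝ → ℝ) :
    Integrable f (empiricalDistribution hA : Measure ℝ) := by
  rw [coe_empiricalDistribution]
  refine Integrable.smul_measure_nnreal ?_
  rw [integrable_finsetSum_measure]
  exact fun i _ => integrable_dirac (by simp)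

theorem Matrix.IsHermitian.trace_pow_eq_sum (hA : A.IsHermitian) (p : ℕ) :
    (A ^ p).trace = ∑ i, ((hA.eigenvalues i ^ p : ℝ) : ℂ) := by
  conv_lhs => rw [hA.spectral_theorem, ← map_pow, Unitary.conjStarAlgAut_apply,
    Matrix.trace_mul_comm, ← mul_assoc]
  simp [Matrix.diagonal_pow, Matrix.trace_diagonal]

theorem integral_pow_empiricalDistribution (hA : A.IsHermitian) (p : ℕ) :
    ∫ t, t ^ p ∂(empiricalDistribution hA : Measure ℝ) =
      (Fintype.card ι : ℝ)⁻¹ * ((A ^ p).trace).re := by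
  rw [coe_empiricalDistribution, integral_smul_nnreal_measure,
    integral_finsetSum_measure fun i _ => integrable_dirac (by simp), hA.trace_pow_eq_sum]
  simp [NNReal.smul_def, -Complex.ofReal_pow, Complex.ofReal_re]

end Empirical

/-! ### Moments of a complex Gaussian -/

section Gaussian

theorem integral_pow_mul_conj_pow_mul_exp (a b : ℕ) :
    ∫ z : ℂ, z ^ a * conj z ^ b * (Real.exp (-‖z‖ ^ 2) : ℂ) =
      if a = b then (Real.pi : ℂ) * a.factorial else 0 := by
  split_ifs with hab
  · subst hab
    have h := Complex.integral_rpow_mul_exp_neg_rpow (p := 2) (q := 2 * a) (by norm_num)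
      (by have : (0 : ℝ) ≤ a := a.cast_nonneg
          linarith)
    have h2 : ((2 * a + 2 : ℝ)) / 2 = a + 1 := by ring
    rw [h2, Real.Gamma_nat_eq_factorial] at h
    have h3 : ∀ z : ℂ, z ^ a * conj z ^ a * (Real.exp (-‖z‖ ^ 2) : ℂ) =
        ((‖z‖ ^ (2 * a : ℝ) * Real.exp (-‖z‖ ^ (2 : ℝ)) : ℝ) : ℂ) := by
      intro z
      rw [← mul_pow, Complex.mul_conj, Complex.normSq_eq_norm_sq, Real.rpow_mul (norm_nonneg _),
        Real.rpow_two, Real.rpow_natCast]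
      push_cast
      rfl
    simp_rw [h3]
    rw [integral_complex_ofReal, h]
    push_cast
    ring
  -- Rotation by the angle π/(a - b) preserves the measure and changes the sign of the integrand.
  · set c : ℂ := Complex.exp (Complex.I * (Real.pi / ((a : ℝ) - b) : ℝ)) with hc
    have hab' : (a : ℝ) - b ≠ 0 := sub_ne_zero.2 (by exact_mod_cast hab)
    have hc1 : c ^ a * conj c ^ b = -1 := by
      rw [hc, ← Complex.exp_conj, ← Complex.exp_nat_mul, ← Complex.exp_nat_mul, ← Complex.exp_add,
        ← Complex.exp_pi_mul_I]
      congr 1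
      have : (a : ℂ) - b ≠ 0 := by exact_mod_cast hab'
      simp only [map_mul, Complex.conj_I, Complex.conj_ofReal]
      push_cast
      field_simp
      ring
    have hnorm : ‖c‖ = 1 := by rw [hc, mul_comm, Complex.norm_exp_ofReal_mul_I]
    let u : Circle := ⟨c, by simp [Submonoid.unitSphere, hnorm]⟩
    have hu : ∀ z, rotation u z = c * z := fun z => rotation_apply u z
    have := (rotation u).measurePreserving.integral_comp
      (rotation u).toHomeomorph.measurableEmbedding
      (fun z : ℂ => z ^ a * conj z ^ b * (Real.exp (-‖z‖ ^ 2) : ℂ))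
    have h2 : ∀ z : ℂ, (rotation u z) ^ a * conj (rotation u z) ^ b *
        (Real.exp (-‖rotation u z‖ ^ 2) : ℂ) =
        -1 * (z ^ a * conj z ^ b * (Real.exp (-‖z‖ ^ 2) : ℂ)) := by
      intro z
      rw [LinearIsometryEquiv.norm_map, hu, ← hc1, map_mul]
      ring
    simp_rw [h2] at this
    rw [integral_const_mul] at this
    linear_combination (-1 / 2) * this

end Gaussian

/-! ### Polar coordinates -/

section Sphere

variable {E : Type*} [NormedAddCommGroup E] [NormedSpace ℝ E] [MeasurableSpace E] [BorelSpace E]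
  [FiniteDimensional ℝ E] [Nontrivial E]

/-- Polar integration of a homogeneous function against the Gaussian weight. -/
theorem integral_homogeneous_mul_exp (μ : Measure E) [μ.IsAddHaarMeasure] {F : E → ℂ} {k : ℕ}
    (hF : ∀ (r : ℝ) (x : E), 0 < r → F (r • x) = (r : ℂ) ^ k * F x) :
    ∫ x, F x * (Real.exp (-‖x‖ ^ 2) : ℂ) ∂μ =
      (∫ x, F x ∂(Measure.map Subtype.val μ.toSphere)) *
        ((1 / 2 * Real.Gamma ((Module.finrank ℝ E + k) / 2) : ℝ) : ℂ) := by
  -- The radial factor: r^(dim - 1 + k) exp(-r²) on the half line gives half a Gamma value.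
  have hrad : ∫ r : Set.Ioi (0 : ℝ), (((r : ℝ) ^ k * Real.exp (-(r : ℝ) ^ 2) : ℝ) : ℂ)
      ∂(Measure.volumeIoiPow (Module.finrank ℝ E - 1)) =
      ((1 / 2 * Real.Gamma ((Module.finrank ℝ E + k) / 2) : ℝ) : ℂ) := by
    have hpos : 0 < Module.finrank ℝ E := Module.finrank_pos
    rw [integral_complex_ofReal]
    congr 1
    simp only [Measure.volumeIoiPow, ENNReal.ofReal]
    rw [integral_withDensity_eq_integral_smul
      (measurable_subtype_coe.pow_const _).real_toNNReal,
      integral_subtype_comap measurableSet_Ioi fun a : ℝ =>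
        Real.toNNReal (a ^ (Module.finrank ℝ E - 1)) • (a ^ k * Real.exp (-a ^ 2))]
    have := integral_rpow_mul_exp_neg_rpow (p := 2) (q := (Module.finrank ℝ E + k : ℝ) - 1)
      (by norm_num) (by
        have : (0 : ℝ) < Module.finrank ℝ E := by exact_mod_cast hpos
        have : (0 : ℝ) ≤ k := by positivity
        linarith)
    rw [sub_add_cancel] at this
    rw [← this]
    refine setIntegral_congr_fun measurableSet_Ioi fun x (hx : 0 < x) => ?_
    rw [NNReal.smul_def, Real.coe_toNNReal _ (pow_nonneg hx.le _), smul_eq_mul, ← mul_assoc,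
      ← pow_add]
    have h1 : ((Module.finrank ℝ E : ℝ) + k - 1) = ((Module.finrank ℝ E - 1 + k : ℕ) : ℝ) := by
      push_cast [Nat.cast_sub (Nat.one_le_iff_ne_zero.2 hpos.ne')]
      ring
    rw [h1, Real.rpow_natCast, Real.rpow_two]
  calc
    _ = ∫ x : ({(0)}ᶜ : Set E), F x * (Real.exp (-‖(x : E)‖ ^ 2) : ℂ) ∂(μ.comap (↑)) := by
      rw [integral_subtype_comap (measurableSet_singleton _).compl
        fun x => F x * (Real.exp (-‖x‖ ^ 2) : ℂ), restrict_compl_singleton]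
    _ = ∫ x : Metric.sphere (0 : E) 1 × Set.Ioi (0 : ℝ),
        F x.1 * (((x.2 : ℝ) ^ k * Real.exp (-(x.2 : ℝ) ^ 2) : ℝ) : ℂ)
          ∂μ.toSphere.prod (.volumeIoiPow (Module.finrank ℝ E - 1)) := by
      rw [← μ.measurePreserving_homeomorphUnitSphereProd.integral_comp
        (Homeomorph.measurableEmbedding _)]
      refine integral_congr_ae (Eventually.of_forall fun x => ?_)
      have hx : 0 < ‖(x : E)‖ := norm_pos_iff.2 x.2
      have h0 : (x : E) = ‖(x : E)‖ • (‖(x : E)‖⁻¹ • (x : E)) := by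
        rw [smul_smul, mul_inv_cancel₀ hx.ne', one_smul]
      simp only [homeomorphUnitSphereProd_apply_snd_coe, homeomorphUnitSphereProd_apply_fst_coe]
      conv_lhs => rw [h0, hF _ _ hx]
      rw [← h0]
      push_cast
      ring
    _ = _ := by
      rw [integral_prod_mul (fun x : Metric.sphere (0 : E) 1 => F x)
        (fun r : Set.Ioi (0 : ℝ) => (((r : ℝ) ^ k * Real.exp (-(r : ℝ) ^ 2) : ℝ) : ℂ)), hrad,
        (MeasurableEmbedding.subtype_coe Metric.isClosed_sphere.measurableSet).integral_map]

end Sphere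

/-! ### Counting matchings of indices -/

section Count

variable {I ι : Type*} [Fintype I] [DecidableEq I] [DecidableEq ι] [Fintype ι]

/-- A permutation with i = j ∘ α exists exactly when all fibres of i and j have equal sizes. These
permutations then form a coset of the stabilizer of j, a product of symmetric groups of the fibres.
-/
theorem card_perm_comp_eq (i j : I → ι) :
    (Finset.univ.filter fun α : Equiv.Perm I => i = j ∘ α).card =
      ∏ a, if (Finset.univ.filter fun k => i k = a).card = (Finset.univ.filter fun k => j k = a).card
        then (Finset.univ.filter fun k => i k = a).card.factorial else 0 := by
  by_cases h : ∃ α₀ : Equiv.Perm I, i = j ∘ α₀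
  · obtain ⟨α₀, h₀⟩ := h
    have hcard : ∀ a, (Finset.univ.filter fun k => i k = a).card =
        (Finset.univ.filter fun k => j k = a).card := by
      intro a
      refine Finset.card_bij (fun k _ => α₀ k) ?_ (fun _ _ _ _ h => α₀.injective h) ?_
      · intro k; simp [h₀]
      · intro k hk
        exact ⟨α₀.symm k, by simpa [h₀] using hk, by simp⟩
    simp only [hcard, if_true]
    have := DomMulAct.stabilizer_card j
    simp only [Fintype.card_subtype] at this
    rw [← this]
    refine Finset.card_bij (fun α _ => α * α₀⁻¹) ?_ (fun _ _ _ _ h => mul_right_cancel h) ?_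
    · intro α hα
      simp only [Finset.mem_filter, Finset.mem_univ, true_and] at hα ⊢
      rw [Equiv.Perm.coe_mul, ← Function.comp_assoc, ← hα, h₀]
      ext x; simp
    · intro α hα
      simp only [Finset.mem_filter, Finset.mem_univ, true_and] at hα ⊢
      refine ⟨α * α₀, ?_, by simp⟩
      rw [Equiv.Perm.coe_mul, ← Function.comp_assoc, hα, h₀]
  · have h0 : (Finset.univ.filter fun α : Equiv.Perm I => i = j ∘ α) = ∅ := by
      rw [Finset.filter_eq_empty_iff]
      exact fun α _ hα => h ⟨α, hα⟩
    rw [h0, Finset.card_empty]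
    symm
    by_contra hne
    rw [← ne_eq, Finset.prod_ne_zero_iff] at hne
    have hcard : ∀ a, Fintype.card {k // i k = a} = Fintype.card {k // j k = a} := by
      intro a
      by_contra hh
      refine hne a (Finset.mem_univ _) (if_neg ?_)
      simpa [Fintype.card_subtype] using hh
    refine h ⟨(Equiv.sigmaFiberEquiv i).symm.trans ((Equiv.sigmaCongrRight fun a =>
      Fintype.equivOfCardEq (hcard a)).trans (Equiv.sigmaFiberEquiv j)), ?_⟩
    ext k
    exact ((Fintype.equivOfCardEq (hcard (i k))) ⟨k, rfl⟩).2.symm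

end Count

/-! ### Moments of a uniform unit vector -/

section SphereMoments

variable {I ι : Type*} [Fintype I] [DecidableEq I] [Fintype ι] [DecidableEq ι]

/-- Wick's formula: the integral factorizes over coordinates, and the factorials multiply up to the
number of matchings. -/
theorem integral_gaussian_prod (i j : I → ι) :
    ∫ x : ι → ℂ, (∏ k, x (i k) * conj (x (j k))) * ∏ a, (Real.exp (-‖x a‖ ^ 2) : ℂ) =
      (Real.pi : ℂ) ^ Fintype.card ι *
        (Finset.univ.filter fun α : Equiv.Perm I => i = j ∘ α).card := by
  have h : ∀ x : ι → ℂ, (∏ k, x (i k) * conj (x (j k))) * ∏ a, (Real.exp (-‖x a‖ ^ 2) : ℂ) =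
      ∏ a, (x a ^ (Finset.univ.filter fun k => i k = a).card *
        conj (x a) ^ (Finset.univ.filter fun k => j k = a).card *
        (Real.exp (-‖x a‖ ^ 2) : ℂ)) := by
    intro x
    rw [Finset.prod_mul_distrib, Finset.prod_mul_distrib, Finset.prod_mul_distrib,
      ← Finset.prod_fiberwise' Finset.univ i x,
      ← Finset.prod_fiberwise' Finset.univ j fun a => conj (x a)]
    simp only [Finset.prod_const]
  simp_rw [h]
  rw [integral_fintype_prod_volume_eq_prod (fun a (z : ℂ) =>
    z ^ (Finset.univ.filter fun k => i k = a).card *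
        conj z ^ (Finset.univ.filter fun k => j k = a).card *
        (Real.exp (-‖z‖ ^ 2) : ℂ))]
  simp_rw [integral_pow_mul_conj_pow_mul_exp]
  rw [card_perm_comp_eq, Nat.cast_prod, ← Finset.card_univ, ← Finset.prod_const,
    ← Finset.prod_mul_distrib]
  refine Finset.prod_congr rfl fun a _ => ?_
  split_ifs <;> simp

/-- Uniqueness of Haar measure up to scaling. The constant cancels later, so its value is not
needed. -/
theorem exists_integral_ofLp (ι : Type*) [Fintype ι] : ∃ c : ℂ, c ≠ 0 ∧ ∀ F : (ι → ℂ) → ℂ,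
    ∫ x : EuclideanSpace ℂ ι, F x.ofLp = c * ∫ x, F x := by
  let e : EuclideanSpace ℂ ι ≃L[ℝ] (ι → ℂ) := (PiLp.continuousLinearEquiv 2 ℝ fun _ : ι => ℂ)
  have := e.isAddHaarMeasure_map (volume : Measure (EuclideanSpace ℂ ι))
  have h := Measure.isAddLeftInvariant_eq_smul (Measure.map e (volume : Measure (EuclideanSpace ℂ ι)))
    (volume : Measure (ι → ℂ))
  set c := Measure.addHaarScalarFactor (Measure.map e (volume : Measure (EuclideanSpace ℂ ι)))
    (volume : Measure (ι → ℂ)) with hc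
  have hc0 : c ≠ 0 := (Measure.addHaarScalarFactor_pos_of_isAddHaarMeasure _ _).ne'
  refine ⟨(c : ℂ), by exact_mod_cast hc0, fun F => ?_⟩
  have h1 := e.toHomeomorph.measurableEmbedding.integral_map (μ := volume) F
  have h2 : ∫ y, F y ∂(Measure.map e (volume : Measure (EuclideanSpace ℂ ι))) =
    ∫ x : EuclideanSpace ℂ ι, F x.ofLp := h1
  rw [← h2, h, integral_smul_nnreal_measure, NNReal.smul_def]
  simp

open RandomState

/-- The moments of the coordinates of a uniform unit vector. -/
theorem integral_uniformUnitVector [Nonempty ι] (i j : I → ι) :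
    ∫ v, (∏ k, v (i k) * conj (v (j k))) ∂(uniformUnitVector ι) =
      (Finset.univ.filter fun α : Equiv.Perm I => i = j ∘ α).card /
        ((Fintype.card ι).ascFactorial (Fintype.card I) : ℂ) := by
  obtain ⟨c, hc, hcF⟩ := exists_integral_ofLp ι
  set D := Fintype.card ι with hD
  have hD0 : 0 < D := Fintype.card_pos
  have hfin : (Module.finrank ℝ (EuclideanSpace ℂ ι) : ℝ) = 2 * D := by
    have := finrank_real_of_complex (EuclideanSpace ℂ ι)
    rw [this, finrank_euclideanSpace]
    push_cast
    rfl
  have : Nontrivial (EuclideanSpace ℂ ι) := by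
    refine Module.nontrivial_of_finrank_pos (R := ℝ) ?_
    have : (0 : ℝ) < 2 * D := by positivity
    rw [← hfin] at this
    exact_mod_cast this
  set ν := Measure.map Subtype.val (volume : Measure (EuclideanSpace ℂ ι)).toSphere with hν
  have key : ∀ (J : Type _) [Fintype J] [DecidableEq J] (i j : J → ι),
      c * ((Real.pi : ℂ) ^ D * (Finset.univ.filter fun α : Equiv.Perm J => i = j ∘ α).card) =
        (∫ v, (∏ k, v (i k) * conj (v (j k))) ∂ν) *
          (1 / 2 * ((D + Fintype.card J - 1).factorial : ℂ)) := by
    intro J _ _ i j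
    have h := integral_homogeneous_mul_exp (volume : Measure (EuclideanSpace ℂ ι))
      (F := fun v => ∏ k, v (i k) * conj (v (j k))) (k := 2 * Fintype.card J) (by
        intro r x _
        simp only [PiLp.smul_apply, Complex.real_smul, map_mul, Complex.conj_ofReal]
        rw [pow_mul, ← Finset.card_univ, ← Finset.prod_const, ← Finset.prod_mul_distrib]
        exact Finset.prod_congr rfl fun k _ => by ring)
    rw [hfin] at h
    have hΓ : Real.Gamma ((2 * D + ((2 * Fintype.card J : ℕ) : ℝ)) / 2) =
        ((D + Fintype.card J - 1).factorial : ℝ) := by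
      rw [← Real.Gamma_nat_eq_factorial, Nat.cast_sub (by omega)]
      congr 1
      push_cast
      ring
    rw [hΓ] at h
    push_cast at h
    rw [← h, ← integral_gaussian_prod i j, ← hcF]
    refine integral_congr_ae (Eventually.of_forall fun x => ?_)
    have hx : (Real.exp (-‖x‖ ^ 2)) = ∏ a, Real.exp (-‖x a‖ ^ 2) := by
      rw [EuclideanSpace.norm_sq_eq, ← Real.exp_sum, Finset.sum_neg_distrib]
    have hx' := congrArg (fun t : ℝ => (t : ℂ)) hx
    push_cast at hx'
    simp only [hx', Complex.ofReal_exp, Complex.ofReal_neg, Complex.ofReal_pow]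
  have h1 := key I i j
  -- The empty product gives the total mass of the sphere. Comparing it with h1 removes c, the
  -- powers of π and the factor 1/2; the ratio of factorials is the rising factorial.
  have h0 := key PEmpty (fun e => e.elim) (fun e => e.elim)
  have hone : (Finset.univ.filter fun α : Equiv.Perm PEmpty =>
      (fun e : PEmpty => (e.elim : ι)) = (fun e : PEmpty => (e.elim : ι)) ∘ α).card = 1 := by
    rw [Finset.filter_true_of_mem fun α _ => Subsingleton.elim _ _]
    rfl
  rw [hone] at h0
  simp only [Finset.univ_eq_empty, Finset.prod_empty, Fintype.card_pempty, add_zero,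
    Nat.cast_one, mul_one, integral_const, Complex.real_smul] at h0
  have hfac : (((D - 1).factorial : ℂ)) * (D.ascFactorial (Fintype.card I) : ℂ) =
      ((D + Fintype.card I - 1).factorial : ℂ) := by
    exact_mod_cast Nat.factorial_mul_ascFactorial' D (Fintype.card I) hD0
  rw [← hfac] at h1
  have huni : ν Set.univ = (volume : Measure (EuclideanSpace ℂ ι)).toSphere Set.univ := by
    rw [hν, Measure.map_apply measurable_subtype_coe MeasurableSet.univ, Set.preimage_univ]
  have hint : ∀ F : EuclideanSpace ℂ ι → ℂ, ∫ v, F v ∂(uniformUnitVector ι) =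
      ((ν.real Set.univ : ℝ) : ℂ)⁻¹ * ∫ v, F v ∂ν := by
    intro F
    rw [uniformUnitVector, Measure.map_smul, integral_smul_measure, ← huni, ENNReal.toReal_inv,
      Complex.real_smul, Complex.ofReal_inv]
    rfl
  rw [hint]
  have hpi : (Real.pi : ℂ) ≠ 0 := by exact_mod_cast Real.pi_ne_zero
  have hf0 : ((D - 1).factorial : ℂ) ≠ 0 := by exact_mod_cast Nat.factorial_ne_zero _
  have ha0 : (D.ascFactorial (Fintype.card I) : ℂ) ≠ 0 := by
    intro h
    rw [h, mul_zero] at hfac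
    exact Nat.factorial_ne_zero _ (by exact_mod_cast hfac.symm)
  have hν0 : ((ν.real Set.univ : ℝ) : ℂ) ≠ 0 := by
    intro h
    rw [h, zero_mul] at h0
    exact mul_ne_zero hc (pow_ne_zero _ hpi) h0
  rw [eq_div_iff ha0, mul_assoc, inv_mul_eq_iff_eq_mul₀ hν0]
  refine mul_left_cancel₀ (mul_ne_zero (one_div_ne_zero two_ne_zero) hf0) ?_
  linear_combination (Finset.univ.filter fun α : Equiv.Perm I => i = j ∘ α).card * h0 - h1

end SphereMoments

/-! ### Permutations of disjoint unions -/

section SumPerm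

open Equiv Equiv.Perm

variable {I J : Type*} [Fintype I] [DecidableEq I] [Fintype J] [DecidableEq J]

/-- Invariant Boolean functions number 2 to the orbit count and multiply over a disjoint union. -/
theorem orbitCount_sumCongr (a : Perm I) (b : Perm J) :
    orbitCount (Perm.sumCongr a b) = orbitCount a + orbitCount b := by
  have e : {f : I ⊕ J → Bool // ∀ i, f (Perm.sumCongr a b i) = f i} ≃
      {f : I → Bool // ∀ i, f (a i) = f i} × {f : J → Bool // ∀ i, f (b i) = f i} :=
    ((Equiv.sumArrowEquivProdArrow I J Bool).subtypeEquiv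
      (q := fun p => (∀ i, p.1 (a i) = p.1 i) ∧ ∀ i, p.2 (b i) = p.2 i) fun f => by
        simp [Equiv.sumArrowEquivProdArrow]).trans
      (Equiv.subtypeProdEquivProd (p := fun f : I → Bool => ∀ i, f (a i) = f i)
        (q := fun f : J → Bool => ∀ i, f (b i) = f i))
  have h := Nat.card_congr e
  rw [Nat.card_prod, card_invariant, card_invariant, card_invariant, ← pow_add] at h
  exact Nat.pow_right_injective (le_of_eq Fintype.card_bool.symm) h

theorem permLength_sumCongr (a : Perm I) (b : Perm J) :
    permLength (Perm.sumCongr a b) = permLength a + permLength b := by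
  have h := orbitCount_add_permLength (Perm.sumCongr a b)
  rw [orbitCount_sumCongr, Fintype.card_sum, ← orbitCount_add_permLength a,
    ← orbitCount_add_permLength b] at h
  omega

theorem sumCongr_mem_geodesics {γ α : Perm I} {δ β : Perm J} :
    Perm.sumCongr α β ∈ geodesics (Perm.sumCongr γ δ) ↔ α ∈ geodesics γ ∧ β ∈ geodesics δ := by
  have e : (Perm.sumCongr α β)⁻¹ * Perm.sumCongr γ δ = Perm.sumCongr (α⁻¹ * γ) (β⁻¹ * δ) := by
    rw [Perm.sumCongr_inv, Perm.sumCongr_mul]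
  rw [mem_geodesics, mem_geodesics, mem_geodesics, e, permLength_sumCongr, permLength_sumCongr,
    permLength_sumCongr]
  have h1 := permLength_mul_le α (α⁻¹ * γ)
  have h2 := permLength_mul_le β (β⁻¹ * δ)
  rw [mul_inv_cancel_left] at h1 h2
  omega

/-- A geodesic preserves each summand, hence is a pair of geodesics. This is what makes leading
orders factorize. -/
theorem sum_geodesics_sumCongr {R : Type*} [AddCommMonoid R] (γ : Perm I) (δ : Perm J)
    (F : Perm (I ⊕ J) → R) :
    ∑ α ∈ geodesics (Perm.sumCongr γ δ), F α =
      ∑ a ∈ geodesics γ, ∑ c ∈ geodesics δ, F (Perm.sumCongr a c) := by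
  rw [← Finset.sum_product' (f := fun a c => F (Perm.sumCongr a c))]
  symm
  refine Finset.sum_nbij (fun p => Perm.sumCongr p.1 p.2) ?_ ?_ ?_ (fun _ _ => rfl)
  · intro p hp
    exact sumCongr_mem_geodesics.2 (Finset.mem_product.1 hp)
  · intro p _ q _ h
    exact sumCongrHom_injective (by simpa using h)
  · intro α hα
    have hm : Set.MapsTo α (Set.range Sum.inl) (Set.range Sum.inl) := by
      refine fun x hx => (apply_mem_of_mem_geodesics (Finset.mem_coe.1 hα) ?_ x).2 hx
      rintro (x | x) <;> simp
    obtain ⟨⟨a, c⟩, h⟩ := mem_sumCongrHom_range_of_perm_mapsTo_inl hm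
    have h' : Perm.sumCongr a c = α := h
    refine ⟨(a, c), ?_, h'⟩
    rw [Finset.mem_coe, Finset.mem_product]
    exact sumCongr_mem_geodesics.1 (h' ▸ hα)

theorem orbitCount_mul_inv (α γ : Perm I) : orbitCount (α * γ⁻¹) = orbitCount (α⁻¹ * γ) := by
  have h : permLength (α * γ⁻¹) = permLength (α⁻¹ * γ) := by
    rw [← permLength_inv, mul_inv_rev, inv_inv, permLength_mul_comm]
  have h1 := orbitCount_add_permLength (α * γ⁻¹)
  have h2 := orbitCount_add_permLength (α⁻¹ * γ)
  omega

theorem sum_ite_invariant (σ : Perm I) (F : Type*) [Fintype F] [DecidableEq F] :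
    ∑ f : I → F, (if ∀ i, f (σ i) = f i then (1 : ℂ) else 0) =
      (Fintype.card F : ℂ) ^ orbitCount σ := by
  rw [Finset.sum_boole, ← Fintype.card_subtype, ← Nat.card_eq_fintype_card, card_invariant]
  push_cast
  rfl

theorem formPerm_finRange (n : ℕ) : (List.finRange n).formPerm = finRotate n := by
  cases n with
  | zero => exact Subsingleton.elim _ _
  | succ n =>
    ext i
    have h := List.formPerm_apply_getElem (List.finRange (n + 1)) (List.nodup_finRange _) i
      (by rw [List.length_finRange]; exact i.2)
    simp only [List.getElem_finRange, List.length_finRange, Fin.cast_mk, Fin.eta] at h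
    rw [h, finRotate_apply, Fin.val_add]
    simp

end SumPerm

/-! ### Expectation of the contracted polynomials -/

section PermInvariant

open RandomState Equiv

variable {I J X Y Z : Type*} [Fintype I] [DecidableEq I] [Fintype J] [DecidableEq J]
  [Fintype X] [DecidableEq X] [Fintype Y] [DecidableEq Y] [Fintype Z] [DecidableEq Z]

/-- The polynomial in the coordinates of `v` whose indices are contracted according to `γ`. For a
cycle it is the trace of a power of the partially transposed state. -/
noncomputable def permInvariant (γ : Perm I) (v : EuclideanSpace ℂ (Z × X × Y)) : ℂ :=
  ∑ z : I → Z, ∑ x : I → X, ∑ y : I → Y,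
    ∏ i, v (z i, x i, y (γ i)) * conj (v (z i, x (γ i), y i))

theorem continuous_permInvariant (γ : Perm I) :
    Continuous (permInvariant (X := X) (Y := Y) (Z := Z) γ) := by
  unfold permInvariant
  fun_prop

theorem permInvariant_sumCongr (γ : Perm I) (δ : Perm J) (v : EuclideanSpace ℂ (Z × X × Y)) :
    permInvariant (Perm.sumCongr γ δ) v = permInvariant γ v * permInvariant δ v := by
  unfold permInvariant
  rw [← (Equiv.sumArrowEquivProdArrow I J Z).symm.sum_comp, Fintype.sum_prod_type,
    Finset.sum_mul_sum]
  refine Finset.sum_congr rfl fun z _ => Finset.sum_congr rfl fun z' _ => ?_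
  rw [← (Equiv.sumArrowEquivProdArrow I J X).symm.sum_comp, Fintype.sum_prod_type,
    Finset.sum_mul_sum]
  refine Finset.sum_congr rfl fun x _ => Finset.sum_congr rfl fun x' _ => ?_
  rw [← (Equiv.sumArrowEquivProdArrow I J Y).symm.sum_comp, Fintype.sum_prod_type,
    Finset.sum_mul_sum]
  refine Finset.sum_congr rfl fun y _ => Finset.sum_congr rfl fun y' _ => ?_
  rw [Fintype.prod_sum_type]
  rfl

theorem toSphere_univ_ne_zero (ι : Type*) [Fintype ι] [Nonempty ι] :
    (volume : Measure (EuclideanSpace ℂ ι)).toSphere Set.univ ≠ 0 := by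
  have : Nontrivial (EuclideanSpace ℂ ι) := by
    refine Module.nontrivial_of_finrank_pos (R := ℂ) ?_
    rw [finrank_euclideanSpace]
    exact Fintype.card_pos
  rw [Ne, Measure.measure_univ_eq_zero]
  exact Measure.toSphere_ne_zero _

theorem isProbabilityMeasure_uniformUnitVector (ι : Type*) [Fintype ι] [Nonempty ι] :
    IsProbabilityMeasure (uniformUnitVector ι) := by
  refine ⟨?_⟩
  rw [uniformUnitVector, Measure.map_apply measurable_subtype_coe MeasurableSet.univ,
    Set.preimage_univ, Measure.smul_apply, smul_eq_mul,
    ENNReal.inv_mul_cancel (toSphere_univ_ne_zero ι) (measure_ne_top _ _)]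

theorem Continuous.integrable_uniformUnitVector {ι E : Type*} [Fintype ι] [Nonempty ι]
    [NormedAddCommGroup E] {F : EuclideanSpace ℂ ι → E} (hF : Continuous F) :
    Integrable F (uniformUnitVector ι) := by
  rw [uniformUnitVector, (MeasurableEmbedding.subtype_coe
    Metric.isClosed_sphere.measurableSet).integrable_map_iff]
  refine Integrable.smul_measure ?_ (ENNReal.inv_ne_top.2 (toSphere_univ_ne_zero ι))
  have : CompactSpace (Metric.sphere (0 : EuclideanSpace ℂ ι) 1) :=
    isCompact_iff_compactSpace.1 (isCompact_sphere _ _)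
  exact (hF.comp continuous_subtype_val).integrable_of_hasCompactSupport
    (HasCompactSupport.of_compactSpace _)

/-- For each α in the moment formula the constraints separate: z is invariant under α, x under γ * α
and y under α * γ⁻¹. Each is a count of functions on orbits. The partial transpose is responsible
for γ and γ⁻¹ appearing in opposite roles. -/
theorem integral_permInvariant [Nonempty X] [Nonempty Y] [Nonempty Z] (γ : Perm I) :
    ∫ v, permInvariant γ v ∂(uniformUnitVector (Z × X × Y)) =
      (∑ α : Perm I, (Fintype.card Z : ℂ) ^ orbitCount α *
        (Fintype.card X : ℂ) ^ orbitCount (γ * α) *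
        (Fintype.card Y : ℂ) ^ orbitCount (α⁻¹ * γ)) /
      ((Fintype.card (Z × X × Y)).ascFactorial (Fintype.card I) : ℂ) := by
  have hint : ∀ (z : I → Z) (x : I → X) (y : I → Y),
      Integrable (fun v : EuclideanSpace ℂ (Z × X × Y) =>
        ∏ i, v (z i, x i, y (γ i)) * conj (v (z i, x (γ i), y i)))
        (uniformUnitVector (Z × X × Y)) := fun z x y =>
    Continuous.integrable_uniformUnitVector (by fun_prop)
  unfold permInvariant
  rw [integral_finsetSum _ fun z _ => integrable_finsetSum _ fun x _ =>
    integrable_finsetSum _ fun y _ => hint z x y]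
  simp_rw [integral_finsetSum _ fun x _ => integrable_finsetSum _ fun y _ => hint _ x y,
    integral_finsetSum _ fun y _ => hint _ _ y]
  have h := fun (z : I → Z) (x : I → X) (y : I → Y) => integral_uniformUnitVector
    (fun i => (z i, x i, y (γ i))) (fun i => (z i, x (γ i), y i))
  simp only at h
  simp_rw [h, ← Finset.sum_div]
  congr 1
  have hiff : ∀ (z : I → Z) (x : I → X) (y : I → Y) (α : Perm I),
      ((fun i => (z i, x i, y (γ i))) = (fun i => (z i, x (γ i), y i)) ∘ α) ↔
        (∀ i, z (α i) = z i) ∧ (∀ i, x ((γ * α) i) = x i) ∧ (∀ i, y ((α * γ⁻¹) i) = y i) := by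
    intro z x y α
    simp only [funext_iff, Function.comp, Prod.mk.injEq, forall_and, Perm.mul_apply]
    refine and_congr (forall_congr' fun _ => eq_comm)
      (and_congr (forall_congr' fun _ => eq_comm) ?_)
    constructor
    · intro hy i
      rw [← hy, ← Perm.mul_apply, mul_inv_cancel, Perm.one_apply]
    · intro hy i
      have h := hy (γ i)
      rw [show γ⁻¹ (γ i) = i from γ.symm_apply_apply i] at h
      exact h.symm
  have hcard : ∀ (z : I → Z) (x : I → X) (y : I → Y),
      ((Finset.univ.filter fun α : Perm I => (fun i => (z i, x i, y (γ i))) =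
        (fun i => (z i, x (γ i), y i)) ∘ α).card : ℂ) =
      ∑ α : Perm I, (if ∀ i, z (α i) = z i then (1 : ℂ) else 0) *
        ((if ∀ i, x ((γ * α) i) = x i then (1 : ℂ) else 0) *
          (if ∀ i, y ((α * γ⁻¹) i) = y i then (1 : ℂ) else 0)) := by
    intro z x y
    rw [Finset.card_filter, Nat.cast_sum]
    refine Finset.sum_congr rfl fun α _ => ?_
    rw [Nat.cast_ite, Nat.cast_one, Nat.cast_zero, if_congr (hiff z x y α) rfl rfl, ite_and,
      ite_and]
    split_ifs <;> simp
  simp_rw [hcard]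
  rw [Finset.sum_congr rfl fun z _ => Finset.sum_congr rfl fun x _ => Finset.sum_comm,
    Finset.sum_congr rfl fun z _ => Finset.sum_comm, Finset.sum_comm]
  refine Finset.sum_congr rfl fun α _ => ?_
  simp_rw [← Finset.mul_sum]
  rw [← Finset.sum_mul, ← Finset.sum_mul, sum_ite_invariant, sum_ite_invariant, sum_ite_invariant,
    orbitCount_mul_inv]
  ring

end PermInvariant

/-! ### Powers of the partial transpose as contracted polynomials -/

section Trace

open RandomState

theorem Matrix.pow_succ_apply_eq_sum {n R : Type*} [Fintype n] [DecidableEq n] [CommSemiring R]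
    (M : Matrix n n R) (p : ℕ) (a b : n) :
    (M ^ (p + 1)) a b = ∑ f : Fin p → n, ∏ i : Fin (p + 1),
      M (Fin.cons (α := fun _ => n) a f i) (Fin.snoc (α := fun _ => n) f b i) := by
  induction p generalizing a with
  | zero => simp [Fin.snoc]
  | succ p ih =>
    rw [pow_succ', Matrix.mul_apply, ← (Fin.consEquiv fun _ => n).sum_comp, Fintype.sum_prod_type]
    refine Finset.sum_congr rfl fun c _ => ?_
    rw [ih, Finset.mul_sum]
    refine Finset.sum_congr rfl fun f _ => ?_
    change _ = ∏ i, M (Fin.cons (α := fun _ => n) a (Fin.cons (α := fun _ => n) c f) i)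
      (Fin.snoc (α := fun _ => n) (Fin.cons (α := fun _ => n) c f) b i)
    rw [Fin.prod_univ_succ (n := p + 1), ← Fin.cons_snoc_eq_snoc_cons]
    simp only [Fin.cons_zero, Fin.cons_succ]

theorem Matrix.trace_pow_succ_eq_sum {n R : Type*} [Fintype n] [DecidableEq n] [CommSemiring R]
    (M : Matrix n n R) (p : ℕ) :
    (M ^ (p + 1)).trace =
      ∑ f : Fin (p + 1) → n, ∏ i, M (f i) (f (finRotate (p + 1) i)) := by
  rw [← (Fin.consEquiv fun _ => n).sum_comp, Fintype.sum_prod_type]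
  refine Finset.sum_congr rfl fun a _ => ?_
  rw [Matrix.diag_apply, Matrix.pow_succ_apply_eq_sum]
  refine Finset.sum_congr rfl fun f _ => ?_
  rw [Fin.snoc_eq_cons_rotate]
  rfl

variable {X Y Z : Type*} [Fintype X] [DecidableEq X] [Fintype Y] [DecidableEq Y]
  [Fintype Z] [DecidableEq Z]

theorem trace_partialTranspose_pow (v : EuclideanSpace ℂ (Z × X × Y)) (p : ℕ) :
    (partialTranspose (reducedState v) ^ (p + 1)).trace = permInvariant (finRotate (p + 1)) v := by
  have h : ∀ q q' : X × Y, partialTranspose (reducedState v) q q' =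
      ∑ z, v (z, q.1, q'.2) * conj (v (z, q'.1, q.2)) := fun _ _ => rfl
  rw [Matrix.trace_pow_succ_eq_sum, permInvariant]
  simp only [h, Fintype.prod_sum]
  rw [Finset.sum_comm]
  refine Finset.sum_congr rfl fun z _ => ?_
  rw [← (Equiv.arrowProdEquivProdArrow _ _ _).symm.sum_comp, Fintype.sum_prod_type]
  rfl

end Trace

/-! ### The genus expansion -/

section GenusExpansion

open Equiv

variable {I J : Type*} [Fintype I] [DecidableEq I] [Fintype J] [DecidableEq J]

/-- The genus of `α` relative to `γ`, which measures how far `α` is from being a geodesic. -/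
def permGenus (γ α : Perm I) : ℕ := (permLength α + permLength (α⁻¹ * γ) - permLength γ) / 2

/-- The triangle inequality and parity make the truncated subtraction and the halving exact. -/
theorem permLength_add_permLength (γ α : Perm I) :
    permLength α + permLength (α⁻¹ * γ) = permLength γ + 2 * permGenus γ α := by
  have h1 := permLength_mul_le α (α⁻¹ * γ)
  have h2 := permLength_parity α (α⁻¹ * γ)
  rw [mul_inv_cancel_left] at h1 h2
  unfold permGenus
  omega

theorem permGenus_eq_zero_iff {γ α : Perm I} : permGenus γ α = 0 ↔ α ∈ geodesics γ := by
  have h := permLength_add_permLength γ α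
  rw [mem_geodesics]
  omega

/-- The genus expansion of the normalized expectation of `permInvariant γ`. -/
noncomputable def genusSum (γ : Perm I) (β m ε : ℝ) : ℝ :=
  ∑ α, β ^ orbitCount α * (m ^ orbitCount (γ * α) / m ^ orbitCount γ) * ε ^ permGenus γ α

theorem genusSum_zero (γ : Perm I) (β m : ℝ) :
    genusSum γ β m 0 = ∑ α ∈ geodesics γ,
      β ^ orbitCount α * (m ^ orbitCount (γ * α) / m ^ orbitCount γ) := by
  have h : geodesics γ = Finset.univ.filter fun α => permGenus γ α = 0 := by
    ext α
    simp [permGenus_eq_zero_iff]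
  rw [genusSum, h, Finset.sum_filter]
  refine Finset.sum_congr rfl fun α _ => ?_
  rw [zero_pow_eq, mul_ite, mul_one, mul_zero]

/-- Multiplicativity at genus 0 is the cancellation that makes the variance small. -/
theorem genusSum_sumCongr_zero (γ : Perm I) (δ : Perm J) (β m : ℝ) :
    genusSum (Perm.sumCongr γ δ) β m 0 = genusSum γ β m 0 * genusSum δ β m 0 := by
  rw [genusSum_zero, genusSum_zero, genusSum_zero, sum_geodesics_sumCongr, Finset.sum_mul_sum]
  refine Finset.sum_congr rfl fun a _ => Finset.sum_congr rfl fun c _ => ?_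
  rw [Perm.sumCongr_mul, orbitCount_sumCongr, orbitCount_sumCongr, orbitCount_sumCongr, pow_add,
    pow_add, pow_add]
  ring

theorem orbitCount_finRotate (p : ℕ) : orbitCount (finRotate (p + 1)) = 1 := by
  have h := orbitCount_add_permLength (finRotate (p + 1))
  rw [← formPerm_finRange, permLength_formPerm (List.nodup_finRange _), List.length_finRange,
    Fintype.card_fin, formPerm_finRange] at h
  omega

theorem genusSum_finRotate_zero (p : ℕ) (β : ℝ) {m : ℝ} (hm : m ≠ 0) :
    genusSum (finRotate (p + 1)) β m 0 = cycleSum β m (List.finRange (p + 1)) := by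
  rw [genusSum_zero, cycleSum, formPerm_finRange, orbitCount_finRotate]
  refine Finset.sum_congr rfl fun α hα => ?_
  rw [← formPerm_finRange] at hα
  have h := permLength_le_of_mem_geodesics hα
  rw [formPerm_finRange, List.length_finRange] at h
  have h1 := orbitCount_add_permLength α
  have h2 := orbitCount_add_permLength (finRotate (p + 1) * α)
  rw [Fintype.card_fin] at h1 h2
  rw [List.length_finRange, show p + 1 - permLength α = orbitCount α by omega,
    show orbitCount (finRotate (p + 1) * α) = p + 1 - permLength (finRotate (p + 1) * α) - 1 + 1 by
      omega, pow_succ, pow_one, mul_div_cancel_right₀ _ hm]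

/-- In terms of orbits the genus identity reads |I| + #(γ) = #(α) + #(α⁻¹γ) + 2g, which trades the
powers of n for l/n and 1/n². -/
theorem sum_pow_orbitCount_eq (γ : Perm I) {l m n : ℝ} (hm : m ≠ 0) (hn : n ≠ 0) :
    (m * l) ^ Fintype.card I / (m * n) ^ orbitCount γ *
      ∑ α, l ^ orbitCount α * m ^ orbitCount (γ * α) * n ^ orbitCount (α⁻¹ * γ) =
    (l * m * n) ^ Fintype.card I * genusSum γ (l / n) m (1 / n ^ 2) := by
  rw [genusSum, Finset.mul_sum, Finset.mul_sum]
  refine Finset.sum_congr rfl fun α _ => ?_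
  have h := permLength_add_permLength γ α
  have h1 := orbitCount_add_permLength α
  have h2 := orbitCount_add_permLength (α⁻¹ * γ)
  have h3 := orbitCount_add_permLength γ
  have e : n ^ Fintype.card I * n ^ orbitCount γ =
      n ^ orbitCount α * n ^ orbitCount (α⁻¹ * γ) * (n ^ 2) ^ permGenus γ α := by
    rw [← pow_mul, ← pow_add, ← pow_add, ← pow_add]
    congr 1
    omega
  rw [mul_pow, mul_pow, mul_pow, mul_pow, div_pow, div_pow, one_pow]
  field_simp
  linear_combination (-(l ^ Fintype.card I * l ^ orbitCount α)) * e

end GenusExpansion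

/-! ### Exact normalized expectations -/

section Expectation

open RandomState Equiv

variable {I : Type*} [Fintype I] [DecidableEq I]

theorem integral_normalized_permInvariant (γ : Perm I) {l m n : ℕ} (hl : 0 < l) (hm : 0 < m)
    (hn : 0 < n) :
    ∫ v, (((m : ℂ) * l) ^ Fintype.card I / ((m : ℂ) * n) ^ orbitCount γ) * permInvariant γ v
      ∂(uniformUnitVector (Fin l × Fin m × Fin n)) =
    (((∏ i ∈ Finset.range (Fintype.card I), (1 + i * (1 / ((l : ℝ) * m * n))))⁻¹ *
      genusSum γ ((l : ℝ) / n) m (1 / (n : ℝ) ^ 2) : ℝ) : ℂ) := by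
  have := Fin.pos_iff_nonempty.1 hl
  have := Fin.pos_iff_nonempty.1 hm
  have := Fin.pos_iff_nonempty.1 hn
  have hl' : (l : ℝ) ≠ 0 := by exact_mod_cast hl.ne'
  have hm' : (m : ℝ) ≠ 0 := by exact_mod_cast hm.ne'
  have hn' : (n : ℝ) ≠ 0 := by exact_mod_cast hn.ne'
  rw [integral_const_mul, integral_permInvariant]
  simp only [Fintype.card_prod, Fintype.card_fin]
  have h := sum_pow_orbitCount_eq γ (l := l) hm' hn'
  -- With D = lmn, the rising factorial is D^k times the product of the 1 + i/D, a correction of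
  -- relative order 1/D.
  have hasc : (((l * (m * n)).ascFactorial (Fintype.card I) : ℕ) : ℝ) =
      ((l : ℝ) * m * n) ^ Fintype.card I *
        ∏ i ∈ Finset.range (Fintype.card I), (1 + i * (1 / ((l : ℝ) * m * n))) := by
    rw [Nat.ascFactorial_eq_prod_range]
    push_cast
    rw [← Finset.card_range (Fintype.card I), ← Finset.prod_const, Finset.card_range,
      ← Finset.prod_mul_distrib]
    refine Finset.prod_congr rfl fun i _ => ?_
    field_simp
  have hD : ((l : ℝ) * m * n) ^ Fintype.card I ≠ 0 := by positivity
  have hP : ∏ i ∈ Finset.range (Fintype.card I), (1 + i * (1 / ((l : ℝ) * m * n))) ≠ 0 :=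
    Finset.prod_ne_zero_iff.2 fun i _ => by positivity
  have key : ((m : ℝ) * l) ^ Fintype.card I / ((m : ℝ) * n) ^ orbitCount γ *
      ((∑ α : Perm I, (l : ℝ) ^ orbitCount α * (m : ℝ) ^ orbitCount (γ * α) *
        (n : ℝ) ^ orbitCount (α⁻¹ * γ)) /
        (((l * (m * n)).ascFactorial (Fintype.card I) : ℕ) : ℝ)) =
      (∏ i ∈ Finset.range (Fintype.card I), (1 + i * (1 / ((l : ℝ) * m * n))))⁻¹ *
        genusSum γ ((l : ℝ) / n) m (1 / (n : ℝ) ^ 2) := by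
    rw [← mul_div_assoc, h, hasc]
    field_simp
  rw [← key]
  push_cast
  rfl

theorem coe_moment_empiricalDistribution {l m n : ℕ}
    (v : EuclideanSpace ℂ (Fin l × Fin m × Fin n)) (p : ℕ) :
    ((∫ t, t ^ (p + 1) ∂(empiricalDistribution
      (isHermitian_smul_partialTranspose ((m : ℝ) * l) v) : Measure ℝ) : ℝ) : ℂ) =
    ((m : ℂ) * l) ^ Fintype.card (Fin (p + 1)) / ((m : ℂ) * n) ^ orbitCount (finRotate (p + 1)) *
      permInvariant (finRotate (p + 1)) v := by
  have hA := isHermitian_smul_partialTranspose ((m : ℝ) * l) v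
  rw [integral_pow_empiricalDistribution, Complex.ofReal_mul]
  have h : ((((((m : ℝ) * l) • partialTranspose (reducedState v)) ^ (p + 1)).trace).re : ℂ) =
      ((((m : ℝ) * l) • partialTranspose (reducedState v)) ^ (p + 1)).trace := by
    rw [hA.trace_pow_eq_sum, ← Complex.ofReal_sum, Complex.ofReal_re]
  rw [h, smul_pow, Matrix.trace_smul, trace_partialTranspose_pow, orbitCount_finRotate,
    Complex.real_smul]
  simp only [Fintype.card_prod, Fintype.card_fin]
  push_cast
  rw [pow_one]
  ring

end Expectation

/-! ### Error estimates of order 1/n² -/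

section Asymptotics

open Asymptotics Equiv

variable {I : Type*} [Fintype I] [DecidableEq I]

theorem genusSum_sub_isBigO (γ : Perm I) (m : ℝ) {b : ℝ} {β ε : ℕ → ℝ}
    (hβ : Tendsto β atTop (𝓝 b)) (hε : Tendsto ε atTop (𝓝 0)) :
    (fun n => genusSum γ (β n) m (ε n) - genusSum γ (β n) m 0) =O[atTop] ε := by
  simp only [genusSum, ← Finset.sum_sub_distrib, ← mul_sub]
  refine IsBigO.fun_sum fun α _ => ?_
  have h1 : (fun n => β n ^ orbitCount α * (m ^ orbitCount (γ * α) / m ^ orbitCount γ))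
      =O[atTop] fun _ => (1 : ℝ) := ((hβ.pow _).mul_const _).isBigO_one ℝ
  have h2 : (fun n => ε n ^ permGenus γ α - 0 ^ permGenus γ α) =O[atTop] ε := by
    have hd : DifferentiableAt ℝ (fun x : ℝ => x ^ permGenus γ α) 0 := by fun_prop
    simpa [Function.comp_def] using hd.isBigO_sub.comp_tendsto hε
  simpa using h1.mul h2

theorem inv_prod_sub_one_isBigO (k : ℕ) {u : ℕ → ℝ} (hu : Tendsto u atTop (𝓝 0)) :
    (fun n => (∏ i ∈ Finset.range k, (1 + i * u n))⁻¹ - 1) =O[atTop] u := by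
  have hd : DifferentiableAt ℝ (fun x : ℝ => (∏ i ∈ Finset.range k, (1 + i * x))⁻¹) 0 := by
    refine DifferentiableAt.inv ?_ (by simp)
    fun_prop
  simpa [Function.comp_def] using hd.isBigO_sub.comp_tendsto hu

theorem continuous_genusSum_zero (γ : Perm I) (m : ℝ) :
    Continuous fun β => genusSum γ β m 0 := by
  unfold genusSum
  fun_prop

/-- Both corrections are O(1/n²): positive genus directly, and 1/(lmn) because l grows like b n. The
reference point is the current ratio l/n and not b, since no rate is known for its convergence. -/
theorem expectation_sub_isBigO (γ : Perm I) {m : ℕ} (hm : 0 < m) {b : ℝ} (hb : 0 < b) {l : ℕ → ℕ}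
    (hl : Tendsto (fun n => (l n : ℝ) / n) atTop (𝓝 b)) :
    (fun n : ℕ => (∏ i ∈ Finset.range (Fintype.card I), (1 + i * (1 / ((l n : ℝ) * m * n))))⁻¹ *
      genusSum γ ((l n : ℝ) / n) m (1 / (n : ℝ) ^ 2) - genusSum γ ((l n : ℝ) / n) m 0)
      =O[atTop] fun n : ℕ => 1 / (n : ℝ) ^ 2 := by
  have hε : Tendsto (fun n : ℕ => 1 / (n : ℝ) ^ 2) atTop (𝓝 0) := by
    simpa using tendsto_const_div_pow (1 : ℝ) 2 (by norm_num)
  have hm' : (m : ℝ) ≠ 0 := by exact_mod_cast hm.ne'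
  have hu : (fun n : ℕ => 1 / ((l n : ℝ) * m * n)) =O[atTop] fun n : ℕ => 1 / (n : ℝ) ^ 2 := by
    have h1 : Tendsto (fun n : ℕ => ((l n : ℝ) / n * m)⁻¹) atTop (𝓝 (b * m)⁻¹) :=
      (hl.mul_const _).inv₀ (by positivity)
    have h2 := (h1.isBigO_one ℝ).mul (isBigO_refl (fun n : ℕ => 1 / (n : ℝ) ^ 2) atTop)
    simp only [one_mul] at h2
    refine IsBigO.congr' h2 ?_ EventuallyEq.rfl
    filter_upwards [eventually_gt_atTop 0] with n hn
    have : (n : ℝ) ≠ 0 := by exact_mod_cast hn.ne'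
    simp only [div_eq_mul_inv, mul_inv, inv_inv, one_mul]
    field_simp
  have h1 := (inv_prod_sub_one_isBigO (Fintype.card I) (hu.trans_tendsto hε)).trans hu
  have h2 := genusSum_sub_isBigO γ m hl hε
  have h3 : (fun n : ℕ => genusSum γ ((l n : ℝ) / n) m (1 / (n : ℝ) ^ 2)) =O[atTop]
      fun _ => (1 : ℝ) := by
    have h4 : Tendsto (fun n : ℕ => genusSum γ ((l n : ℝ) / n) m 0) atTop
        (𝓝 (genusSum γ b m 0)) := ((continuous_genusSum_zero γ m).tendsto b).comp hl
    have h5 := (h2.trans_tendsto hε).add h4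
    simp only [sub_add_cancel] at h5
    exact h5.isBigO_one ℝ
  have h6 := (h1.mul h3).add (by simpa only [mul_one] using h2)
  simp only [mul_one] at h6
  refine h6.congr_left fun n => ?_
  rw [sub_mul, one_mul, sub_add_sub_cancel]

end Asymptotics

/-! ### From summable second moments to almost sure convergence -/

section BorelCantelli

variable {Ω : Type*} [MeasurableSpace Ω] {P : Measure Ω}

/-- The sum of the squares has finite expectation from some index on, hence is almost surely finite,
and its terms tend to 0. Nothing about the joint law enters. -/
theorem ae_tendsto_zero_of_integral_sq_isBigO {f : ℕ → Ω → ℝ}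
    (hf : ∀ᶠ n in atTop, Integrable (fun ω => f n ω ^ 2) P)
    (h : (fun n => ∫ ω, f n ω ^ 2 ∂P) =O[atTop] fun n : ℕ => 1 / (n : ℝ) ^ 2) :
    ∀ᵐ ω ∂P, Tendsto (fun n => f n ω) atTop (𝓝 0) := by
  obtain ⟨C, hC⟩ := h.bound
  obtain ⟨N, hN⟩ := eventually_atTop.1 (hf.and hC)
  have hsum : Summable fun n : ℕ => ∫ ω, f (n + N) ω ^ 2 ∂P := by
    have h1 : Summable fun n : ℕ => C * ‖1 / ((n + N : ℕ) : ℝ) ^ 2‖ := by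
      refine Summable.mul_left _ ?_
      have h2 : Summable fun n : ℕ => ‖1 / (n : ℝ) ^ 2‖ :=
        (Real.summable_one_div_nat_pow.2 (by norm_num)).norm
      exact (summable_nat_add_iff (f := fun n : ℕ => ‖1 / (n : ℝ) ^ 2‖) N).2 h2
    exact h1.of_norm_bounded fun n => (hN (n + N) (by omega)).2
  have hmeas : ∀ n, AEMeasurable (fun ω => ENNReal.ofReal (f (n + N) ω ^ 2)) P := fun n =>
    (hN (n + N) (by omega)).1.aestronglyMeasurable.aemeasurable.ennreal_ofReal
  have hfin : ∫⁻ ω, ∑' n, ENNReal.ofReal (f (n + N) ω ^ 2) ∂P ≠ ⊤ := by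
    rw [lintegral_tsum hmeas]
    have : ∀ n, ∫⁻ ω, ENNReal.ofReal (f (n + N) ω ^ 2) ∂P =
        ENNReal.ofReal (∫ ω, f (n + N) ω ^ 2 ∂P) := fun n =>
      (ofReal_integral_eq_lintegral_ofReal (hN (n + N) (by omega)).1
        (Eventually.of_forall fun ω => sq_nonneg _)).symm
    simp_rw [this]
    exact hsum.tsum_ofReal_ne_top
  filter_upwards [ae_lt_top' (AEMeasurable.tsum hmeas) hfin] with ω hω
  have h1 := ENNReal.tendsto_atTop_zero_of_tsum_ne_top hω.ne
  have h2 : Tendsto (fun n => f (n + N) ω ^ 2) atTop (𝓝 0) := by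
    have := (ENNReal.tendsto_toReal ENNReal.zero_ne_top).comp h1
    simpa [Function.comp_def, ENNReal.toReal_ofReal, sq_nonneg] using this
  have h3 : Tendsto (fun n => |f (n + N) ω|) atTop (𝓝 0) := by
    have := h2.sqrt
    simpa [Real.sqrt_sq_eq_abs] using this
  exact (tendsto_add_atTop_iff_nat (f := fun n => f n ω) N).1 (tendsto_zero_iff_abs_tendsto_zero _ |>.2 h3)

end BorelCantelli

/-! ### Almost sure convergence of the moments -/

section AlmostSure

open RandomState Equiv

/-- The moments of the empirical eigenvalue distribution of the rescaled partial transpose. -/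
noncomputable def empiricalMoment {l m n : ℕ} (p : ℕ) (v : EuclideanSpace ℂ (Fin l × Fin m × Fin n)) : ℝ :=
  ∫ t, t ^ p ∂(empiricalDistribution
    (isHermitian_smul_partialTranspose ((m : ℝ) * l) v) : Measure ℝ)

variable {l m n : ℕ}

theorem continuous_empiricalMoment (p : ℕ) :
    Continuous (empiricalMoment (l := l) (m := m) (n := n) (p + 1)) := by
  have h : ∀ v : EuclideanSpace ℂ (Fin l × Fin m × Fin n), empiricalMoment (p + 1) v =
      (((m : ℂ) * l) ^ Fintype.card (Fin (p + 1)) /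
        ((m : ℂ) * n) ^ orbitCount (finRotate (p + 1)) *
        permInvariant (finRotate (p + 1)) v).re := fun v => by
    rw [← coe_moment_empiricalDistribution, Complex.ofReal_re]
    rfl
  rw [funext h]
  exact Complex.continuous_re.comp (continuous_const.mul (continuous_permInvariant _))

theorem integral_empiricalMoment (p : ℕ) (hl : 0 < l) (hm : 0 < m) (hn : 0 < n) :
    ∫ v, empiricalMoment (p + 1) v ∂(uniformUnitVector (Fin l × Fin m × Fin n)) =
      (∏ i ∈ Finset.range (Fintype.card (Fin (p + 1))), (1 + i * (1 / ((l : ℝ) * m * n))))⁻¹ *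
        genusSum (finRotate (p + 1)) ((l : ℝ) / n) m (1 / (n : ℝ) ^ 2) := by
  apply Complex.ofReal_injective
  rw [← integral_normalized_permInvariant _ hl hm hn, ← integral_complex_ofReal]
  simp only [empiricalMoment, coe_moment_empiricalDistribution]

/-- The square is again a contracted polynomial, for two disjoint copies of the cycle. -/
theorem integral_empiricalMoment_sq (p : ℕ) (hl : 0 < l) (hm : 0 < m) (hn : 0 < n) :
    ∫ v, empiricalMoment (p + 1) v ^ 2 ∂(uniformUnitVector (Fin l × Fin m × Fin n)) =
      (∏ i ∈ Finset.range (Fintype.card (Fin (p + 1) ⊕ Fin (p + 1))),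
        (1 + i * (1 / ((l : ℝ) * m * n))))⁻¹ *
        genusSum (Perm.sumCongr (finRotate (p + 1)) (finRotate (p + 1)))
          ((l : ℝ) / n) m (1 / (n : ℝ) ^ 2) := by
  apply Complex.ofReal_injective
  rw [← integral_normalized_permInvariant _ hl hm hn, ← integral_complex_ofReal]
  simp only [empiricalMoment, Complex.ofReal_pow, coe_moment_empiricalDistribution,
    permInvariant_sumCongr, orbitCount_sumCongr, Fintype.card_sum]
  congr 1
  funext v
  rw [pow_add, pow_add]
  ring

theorem ae_tendsto_empiricalMoment {m₀ : ℕ} (hm₀ : 0 < m₀) {b : ℝ} (hb : 0 < b) (p : ℕ)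
    {Ω : Type*} [MeasurableSpace Ω] {P : Measure Ω} [IsProbabilityMeasure P]
    {l : ℕ → ℕ} (hl : Tendsto (fun n => (l n : ℝ) / n) atTop (𝓝 b))
    {v : (n : ℕ) → Ω → EuclideanSpace ℂ (Fin (l n) × Fin m₀ × Fin n)}
    (hv : ∀ n, 0 < n → 0 < l n →
      HasLaw (v n) (uniformUnitVector (Fin (l n) × Fin m₀ × Fin n)) P) :
    ∀ᵐ ω ∂P, Tendsto (fun n => empiricalMoment (p + 1) (v n ω)) atTop
      (𝓝 (cycleSum b m₀ (List.finRange (p + 1)))) := by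
  have hpos : ∀ᶠ n in atTop, 0 < n ∧ 0 < l n := by
    filter_upwards [eventually_gt_atTop 0, hl.eventually_const_lt hb] with n hn hln
    refine ⟨hn, Nat.pos_of_ne_zero fun h => ?_⟩
    simp [h] at hln
  let γ : Perm (Fin (p + 1)) := finRotate (p + 1)
  let s : ℕ → ℝ := fun n => genusSum γ ((l n : ℝ) / n) m₀ 0
  have hs : Tendsto s atTop (𝓝 (genusSum γ b m₀ 0)) :=
    ((continuous_genusSum_zero γ m₀).tendsto b).comp hl
  have h1 := expectation_sub_isBigO γ hm₀ hb hl
  have h2 := expectation_sub_isBigO (Perm.sumCongr γ γ) hm₀ hb hl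
  -- With M the random moment, E(M - s)² = (E M² - s²) - 2s (E M - s); both brackets are O(1/n²) and
  -- s is bounded.
  have h3 := h2.sub (((hs.const_mul 2).isBigO_one ℝ).mul h1 |>.congr_right fun n => one_mul _)
  have hint : ∀ n, 0 < n → 0 < l n → ∀ F : EuclideanSpace ℂ (Fin (l n) × Fin m₀ × Fin n) → ℝ,
      Continuous F → Integrable F (uniformUnitVector (Fin (l n) × Fin m₀ × Fin n)) := by
    intro n hn hln F hF
    have := Fin.pos_iff_nonempty.1 hn
    have := Fin.pos_iff_nonempty.1 hln
    have := Fin.pos_iff_nonempty.1 hm₀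
    exact hF.integrable_uniformUnitVector
  have key := ae_tendsto_zero_of_integral_sq_isBigO (P := P)
    (f := fun n ω => empiricalMoment (p + 1) (v n ω) - s n) ?_ ?_
  · filter_upwards [key] with ω hω
    have := hω.add hs
    simp only [sub_add_cancel, zero_add] at this
    rwa [genusSum_finRotate_zero p b (by exact_mod_cast hm₀.ne')] at this
  · filter_upwards [hpos] with n hn
    have hlaw := hv n hn.1 hn.2
    have h := hint n hn.1 hn.2 (fun w => (empiricalMoment (p + 1) w - s n) ^ 2)
      (((continuous_empiricalMoment p).sub continuous_const).pow 2)
    rw [← hlaw.map_eq] at h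
    exact h.comp_aemeasurable hlaw.aemeasurable
  · refine Asymptotics.IsBigO.congr' h3 ?_ EventuallyEq.rfl
    filter_upwards [hpos] with n hn
    have hlaw := hv n hn.1 hn.2
    have := Fin.pos_iff_nonempty.1 hn.1
    have := Fin.pos_iff_nonempty.1 hn.2
    have := Fin.pos_iff_nonempty.1 hm₀
    have := isProbabilityMeasure_uniformUnitVector (Fin (l n) × Fin m₀ × Fin n)
    have hc := continuous_empiricalMoment (l := l n) (m := m₀) (n := n) p
    have e1 : ∫ ω, (empiricalMoment (p + 1) (v n ω) - s n) ^ 2 ∂P =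
        ∫ w, (empiricalMoment (p + 1) w - s n) ^ 2
          ∂(uniformUnitVector (Fin (l n) × Fin m₀ × Fin n)) :=
      hlaw.integral_comp ((hc.sub continuous_const).pow 2).aestronglyMeasurable
    have e2 : ∀ w : EuclideanSpace ℂ (Fin (l n) × Fin m₀ × Fin n),
        (empiricalMoment (p + 1) w - s n) ^ 2 =
        empiricalMoment (p + 1) w ^ 2 - 2 * s n * empiricalMoment (p + 1) w + s n ^ 2 :=
      fun w => by ring
    have i1 := hint n hn.1 hn.2 (fun w => empiricalMoment (p + 1) w ^ 2) (hc.pow 2)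
    have i2 := hint n hn.1 hn.2 (fun w => 2 * s n * empiricalMoment (p + 1) w)
      (continuous_const.mul hc)
    rw [e1]
    simp_rw [e2]
    rw [integral_add (by exact i1.sub i2) (integrable_const _), integral_sub i1 i2,
      integral_const_mul,
      integral_empiricalMoment p hn.2 hm₀ hn.1, integral_empiricalMoment_sq p hn.2 hm₀ hn.1,
      genusSum_sumCongr_zero]
    simp only [integral_const, probReal_univ, one_smul, s, γ]
    ring

end AlmostSure

/-! ### Conclusion -/

theorem theorem5p1 (m₀ : ℕ) (hm₀ : 1 ≤ m₀) (b : ℝ) (hb : 0 < b) :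
    ∃ μ : ProbabilityMeasure ℝ,
      RandomState.IsFreeDifference (RandomState.freePoisson (b * (m₀ + 1) / 2))
        (RandomState.freePoisson (b * (m₀ - 1) / 2)) (μ : Measure ℝ) ∧
      RandomState.HasFreeCumulants (μ : Measure ℝ) (fun r => if Even r then b * m₀ else b) ∧
      ∀ (Ω : Type*) [MeasurableSpace Ω] (P : Measure Ω) [IsProbabilityMeasure P]
        (l : ℕ → ℕ) (_ : Tendsto (fun n => (l n : ℝ) / n) atTop (𝓝 b))
        (v : (n : ℕ) → Ω → EuclideanSpace ℂ (Fin (l n) × Fin m₀ × Fin n))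
        (_ : ∀ n, 0 < n → 0 < l n →
          HasLaw (v n) (RandomState.uniformUnitVector (Fin (l n) × Fin m₀ × Fin n)) P),
        ∀ᵐ ω ∂P, Tendsto
          (fun n => RandomState.empiricalDistribution
            (RandomState.isHermitian_smul_partialTranspose ((m₀ : ℝ) * l n) (v n ω)))
          atTop (𝓝 μ.toFiniteMeasure) := by
  have hm : (1 : ℝ) ≤ m₀ := by exact_mod_cast hm₀
  have hr₁ : √(b * (m₀ + 1) / 2) ^ 2 = b * (m₀ + 1) / 2 := Real.sq_sqrt (by positivity)
  have hr₂ : √(b * (m₀ - 1) / 2) ^ 2 = b * (m₀ - 1) / 2 :=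
    Real.sq_sqrt (by have : (0 : ℝ) ≤ m₀ - 1 := by linarith
                     positivity)
  obtain ⟨μ, hμ, ⟨K, hK, hμK⟩, hfree, hmom⟩ := exists_isFreeDifference_freePoisson
    (Real.sqrt_nonneg (b * (m₀ + 1) / 2)) (Real.sqrt_nonneg (b * (m₀ - 1) / 2))
  have hrec := momentRecursion_diffMoment (√(b * (m₀ + 1) / 2)) (√(b * (m₀ - 1) / 2))
  rw [hr₁, hr₂] at hrec hfree
  -- The odd and even weights are the difference and the sum of the two rates.
  rw [show b * (m₀ + 1) / 2 - b * (m₀ - 1) / 2 = b by ring,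
    show b * (m₀ + 1) / 2 + b * (m₀ - 1) / 2 = b * m₀ by ring] at hrec
  refine ⟨⟨μ, hμ⟩, hfree, ⟨fun p => Measure.integrable_of_compl_null hK hμK (by fun_prop),
    fun p _ => ?_⟩, ?_⟩
  · rw [sum_isNoncrossing_eq hrec]
    exact hmom p
  · intro Ω _ P _ l hl v hv
    have hall := ae_all_iff.2 fun p => ae_tendsto_empiricalMoment hm₀ hb p hl hv
    filter_upwards [hall] with ω hω
    refine FiniteMeasure.tendsto_of_tendsto_moments
      (fun n k => integrable_empiricalDistribution _ _) hK hμK fun k => ?_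
    change Tendsto (fun n => empiricalMoment k (v n ω)) atTop (𝓝 (∫ t, t ^ k ∂μ))
    rw [hmom]
    cases k with
    | zero =>
      rw [diffMoment_zero]
      -- The empirical distribution has mass 1 only for n > 0, so the moment of order 0 is constant
      -- only eventually.
      refine tendsto_const_nhds.congr' ?_
      filter_upwards [eventually_gt_atTop 0] with n hn
      have : (m₀ : ℝ) * n ≠ 0 := by positivity
      rw [empiricalMoment, integral_pow_empiricalDistribution, pow_zero, Matrix.trace_one]
      simp only [Fintype.card_prod, Fintype.card_fin, Complex.natCast_re]
      push_cast
      rw [inv_mul_cancel₀ this]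
    | succ p =>
      have h := hω p
      rwa [cycleSum_eq hrec (List.nodup_finRange _), List.length_finRange] at h
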